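/- Let $(M^4,g,J,\omega)$ be an almost Hermitian manifold of real dimension $4$: a smooth manifold (Hausdorff, without boundary) with a smooth Riemannian metric $g=\langle\cdot,\cdot\rangle$, a smooth $g$-orthogonal endomorphism field $J$ with $J^2=-\mathrm{Id}$, and the fundamental form $\omega(X,Y)=g(JX,Y)$. Let $\nabla$ be the Levi-Civita connection of $g$, let $(J\alpha)(X)=-\alpha(JX)$ for a 1-form $\alpha$, let $\theta=J\delta\omega$ be the Lee form, where $\delta\omega=-\sum_i(\nabla_{e_i}\omega)(e_i,\cdot)$ for a local orthonormal frame $(e_i)$, and let $\theta^\sharp$ be the vector field dual to $\theta$. Let $$N(A,B)=[JA,JB]-[A,B]-J[JA,B]-J[A,JB],\qquad N_X(A,B)=\langle N(A,B),X\rangle,$$ so that each $N_X$ is a 2-form, and let $\Phi$ be the 2-form $$\Phi(X,Y)=\tfrac14\langle J(\nabla_XJ),\nabla_YJ\rangle .$$ Here $\langle A,B\rangle=\sum_i\langle Ae_i,Be_i\rangle$ for endomorphisms and $\langle\varphi,\psi\rangle=\sum_{i<j}\varphi(e_i,e_j)\psi(e_i,e_j)$ for 2-forms, and $d\alpha(X,Y)=X(\alpha(Y))-Y(\alpha(X))-\alpha([X,Y])$.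 Then the equality $-4\Phi=d(J\theta)$ holds on $M$ if and only if, for all vector fields $X,Y$, $$(\nabla_X\theta)(JY)-(\nabla_Y\theta)(JX)=-\tfrac12\langle N_{JX},N_Y\rangle-\tfrac12N_{J\theta^\sharp}(X,Y).$$ Moreover, if $M$ is compact, the equality $-4\Phi=d(J\theta)$ holds if and only if $(g,J)$ is Vaisman, that is, $J$ is integrable ($N=0$) and $\nabla\theta=0$. -/

import Mathlib

open Bundle Manifold ContDiff VectorField

noncomputable section

namespace AlmostHermitian

variable {E : Type*} [NormedAddCommGroup E] [NormedSpace ℝ E]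
  {H : Type*} [TopologicalSpace H] (I : ModelWithCorners ℝ E H)
  {M : Type*} [TopologicalSpace M] [ChartedSpace H M]

/-! ### Vector fields and 1-forms -/

/-- The vector field `X` on `M` is smooth. -/
def IsSmoothField [IsManifold I ∞ M] (X : Π x : M, TangentSpace I x) : Prop :=
  ContMDiff I I.tangent ∞ (fun x ↦ (⟨x, X x⟩ : TangentBundle I M))

/-- The directional derivative `X(f)` of a function along a vector field, at the point `x`. -/
def lieDeriv (X : Π x : M, TangentSpace I x) (f : M → ℝ) (x : M) : ℝ :=
  mvfderiv I f x (X x)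

/-- The exterior derivative of a 1-form,
`(dα)(X, Y) = X(α(Y)) - Y(α(X)) - α([X, Y])`, on vector fields `X`, `Y`. -/
def extDerivOneForm (α : Π x : M, TangentSpace I x →L[ℝ] ℝ)
    (X Y : Π x : M, TangentSpace I x) (x : M) : ℝ :=
  lieDeriv I X (fun y ↦ α y (Y y)) x - lieDeriv I Y (fun y ↦ α y (X y)) x
    - α x (mlieBracket I X Y x)

/-! ### The Levi-Civita connection -/

section LeviCivita

variable [RiemannianBundle (fun x : M ↦ TangentSpace I x)]

/-- Half of the right-hand side of the Koszul formula, that is, the function which the Levi-Civita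
connection has to satisfy `⟨∇_X Y, Z⟩ = koszul X Y Z`. -/
def koszul (X Y Z : Π x : M, TangentSpace I x) (x : M) : ℝ :=
  (1 / 2) * (lieDeriv I X (fun y ↦ inner ℝ (Y y) (Z y)) x
    + lieDeriv I Y (fun y ↦ inner ℝ (X y) (Z y)) x
    - lieDeriv I Z (fun y ↦ inner ℝ (X y) (Y y)) x
    + inner ℝ (mlieBracket I X Y x) (Z x)
    - inner ℝ (mlieBracket I X Z x) (Y x)
    - inner ℝ (mlieBracket I Y Z x) (X x))

variable [IsManifold I ∞ M]
  [IsContMDiffRiemannianBundle I ∞ E (fun x : M ↦ TangentSpace I x)]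

variable {I} {x : M} {X X' Y Y' Z Z' : Π x : M, TangentSpace I x}

theorem mdifferentiableAt_inner (hX : MDiffAt (T% X) x) (hY : MDiffAt (T% Y) x) :
    MDiffAt (fun y ↦ (inner ℝ (X y) (Y y) : ℝ)) x :=
  MDifferentiableAt.inner_bundle (b := fun y : M ↦ y) hX hY

variable [FiniteDimensional ℝ E]

instance finiteDimensional_tangentSpace (x : M) : FiniteDimensional ℝ (TangentSpace I x) :=
  inferInstanceAs (FiniteDimensional ℝ E)

theorem koszul_tensorial_left (hY : MDiffAt (T% Y) x) (hZ : MDiffAt (T% Z) x) :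
    TensorialAt I E (fun X ↦ koszul I X Y Z x) x where
  smul {f X} hf hX := by
    have := FiniteDimensional.complete ℝ E
    simp only [koszul, lieDeriv, Pi.smul_apply', real_inner_smul_left, mlieBracket_smul_left hf hX,
      mvfderiv_fun_mul hf (mdifferentiableAt_inner hX hZ),
      mvfderiv_fun_mul hf (mdifferentiableAt_inner hX hY), inner_add_left, real_inner_smul_right]
    simp [real_inner_comm]
    ring
  add {X X'} hX hX' := by
    have := FiniteDimensional.complete ℝ E
    simp only [koszul, lieDeriv, Pi.add_apply, inner_add_left, inner_add_right,
      mlieBracket_add_left hX hX',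
      mvfderiv_fun_add (mdifferentiableAt_inner hX hZ) (mdifferentiableAt_inner hX' hZ),
      mvfderiv_fun_add (mdifferentiableAt_inner hX hY) (mdifferentiableAt_inner hX' hY)]
    simp
    ring

theorem koszul_tensorial_right (hX : MDiffAt (T% X) x) (hY : MDiffAt (T% Y) x) :
    TensorialAt I E (fun Z ↦ koszul I X Y Z x) x where
  smul {f Z} hf hZ := by
    have := FiniteDimensional.complete ℝ E
    simp only [koszul, lieDeriv, Pi.smul_apply', real_inner_smul_right, mlieBracket_smul_right hf hZ,
      mvfderiv_fun_mul hf (mdifferentiableAt_inner hX hZ),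
      mvfderiv_fun_mul hf (mdifferentiableAt_inner hY hZ), inner_add_left, real_inner_smul_left]
    simp [real_inner_comm]
    ring
  add {Z Z'} hZ hZ' := by
    have := FiniteDimensional.complete ℝ E
    simp only [koszul, lieDeriv, Pi.add_apply, inner_add_left, inner_add_right,
      mlieBracket_add_right hZ hZ',
      mvfderiv_fun_add (mdifferentiableAt_inner hX hZ) (mdifferentiableAt_inner hX hZ'),
      mvfderiv_fun_add (mdifferentiableAt_inner hY hZ) (mdifferentiableAt_inner hY hZ')]
    simp
    ring

theorem koszul_smul_middle {f : M → ℝ} (hf : MDiffAt f x) (hX : MDiffAt (T% X) x)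
    (hY : MDiffAt (T% Y) x) (hZ : MDiffAt (T% Z) x) :
    koszul I X (f • Y) Z x
      = f x * koszul I X Y Z x + mvfderiv I f x (X x) * inner ℝ (Y x) (Z x) := by
  have := FiniteDimensional.complete ℝ E
  simp only [koszul, lieDeriv, Pi.smul_apply', real_inner_smul_left, real_inner_smul_right,
    mlieBracket_smul_right hf hY, mlieBracket_smul_left hf hY,
    mvfderiv_fun_mul hf (mdifferentiableAt_inner hX hY),
    mvfderiv_fun_mul hf (mdifferentiableAt_inner hY hZ), inner_add_left]
  simp [real_inner_comm]
  ring

theorem koszul_add_middle (hX : MDiffAt (T% X) x)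
    (hY : MDiffAt (T% Y) x) (hY' : MDiffAt (T% Y') x) (hZ : MDiffAt (T% Z) x) :
    koszul I X (Y + Y') Z x = koszul I X Y Z x + koszul I X Y' Z x := by
  have := FiniteDimensional.complete ℝ E
  simp only [koszul, lieDeriv, Pi.add_apply, inner_add_left, inner_add_right,
    mlieBracket_add_right hY hY', mlieBracket_add_left hY hY',
    mvfderiv_fun_add (mdifferentiableAt_inner hX hY) (mdifferentiableAt_inner hX hY'),
    mvfderiv_fun_add (mdifferentiableAt_inner hY hZ) (mdifferentiableAt_inner hY' hZ)]
  simp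
  ring

/-- The vector `∇_v Y ∈ T_x M` given by the Koszul formula
(set to `0` if `Y` is not differentiable at `x`). -/
def leviCivitaFun (Y : Π x : M, TangentSpace I x) (x : M) :
    TangentSpace I x →L[ℝ] TangentSpace I x := by
  classical
  exact
  if hY : MDiffAt (T% Y) x then
    LinearMap.toContinuousLinearMap
      { toFun := fun v ↦ (InnerProductSpace.toDual ℝ (TangentSpace I x)).symm
          (TensorialAt.mkHom₂ (I := I) (F := E) (F' := E) (fun X Z ↦ koszul I X Y Z x) x
            (fun _ hZ ↦ koszul_tensorial_left hY hZ)
            (fun _ hX ↦ koszul_tensorial_right hX hY) v)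
        map_add' := fun v w ↦ by simp only [map_add]
        map_smul' := fun c v ↦ by simp }
  else 0

theorem inner_leviCivitaFun (hX : MDiffAt (T% X) x) (hY : MDiffAt (T% Y) x)
    (hZ : MDiffAt (T% Z) x) :
    inner ℝ (leviCivitaFun Y x (X x)) (Z x) = koszul I X Y Z x := by
  simp only [leviCivitaFun, dif_pos hY]
  simp only [LinearMap.coe_toContinuousLinearMap', LinearMap.coe_mk, AddHom.coe_mk,
    InnerProductSpace.toDual_symm_apply]
  exact TensorialAt.mkHom₂_apply _ _ hX hZ

variable (I M) in
/-- The Levi-Civita connection of the Riemannian manifold `M`: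
`leviCivita Y x v` is `∇_v Y ∈ T_x M`. -/
def leviCivita : CovariantDerivative I E (fun x : M ↦ TangentSpace I x) where
  toFun := leviCivitaFun
  isCovariantDerivativeOnUniv :=
    { add := by
        intro Y Y' x hY hY' _
        ext v
        refine ext_inner_right ℝ fun w ↦ ?_
        have hv := FiberBundle.mdifferentiableAt_extend I E v
        have hw := FiberBundle.mdifferentiableAt_extend I E w
        have hs := mdifferentiableAt_add_section hY hY'
        have h1 := inner_leviCivitaFun hv hs hw
        have h2 := inner_leviCivitaFun hv hY hw
        have h3 := inner_leviCivitaFun hv hY' hw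
        rw [koszul_add_middle hv hY hY' hw, ← h2, ← h3] at h1
        simpa [inner_add_left] using h1
      leibniz := by
        intro Y f x hY hf _
        ext v
        refine ext_inner_right ℝ fun w ↦ ?_
        have hv := FiberBundle.mdifferentiableAt_extend I E v
        have hw := FiberBundle.mdifferentiableAt_extend I E w
        have hs := hf.smul_section hY
        have h1 := inner_leviCivitaFun hv hs hw
        have h2 := inner_leviCivitaFun hv hY hw
        rw [koszul_smul_middle hf hv hY hw, ← h2] at h1
        simpa [inner_add_left, real_inner_smul_left] using h1 }

theorem inner_leviCivita (hX : MDiffAt (T% X) x) (hY : MDiffAt (T% Y) x)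
    (hZ : MDiffAt (T% Z) x) :
    inner ℝ (leviCivita I M Y x (X x)) (Z x) = koszul I X Y Z x :=
  inner_leviCivitaFun hX hY hZ

variable (I M) in
/-- The Levi-Civita connection is torsion-free. -/
theorem leviCivita_torsion [CompleteSpace E] : (leviCivita I M).torsion = 0 := by
  rw [CovariantDerivative.torsion_eq_zero_iff]
  intro X Y x hX hY
  refine ext_inner_right ℝ fun w ↦ ?_
  have hw := FiberBundle.mdifferentiableAt_extend I E w
  have h1 := inner_leviCivita hX hY hw
  have h2 := inner_leviCivita hY hX hw
  simp only [FiberBundle.extend_apply_self] at h1 h2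
  rw [inner_sub_left, h1, h2]
  simp only [koszul, mlieBracket_swap_apply (V := Y) (W := X), real_inner_comm,
    FiberBundle.extend_apply_self, inner_neg_left]
  ring

/-- The Levi-Civita connection is compatible with the metric. -/
theorem leviCivita_metric (hX : MDiffAt (T% X) x) (hY : MDiffAt (T% Y) x)
    (hZ : MDiffAt (T% Z) x) :
    lieDeriv I X (fun y ↦ inner ℝ (Y y) (Z y)) x
      = inner ℝ (leviCivita I M Y x (X x)) (Z x) + inner ℝ (Y x) (leviCivita I M Z x (X x)) := by
  have h1 := inner_leviCivita hX hY hZ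
  have h2 := inner_leviCivita hX hZ hY
  rw [real_inner_comm] at h2
  rw [h1, h2]
  simp only [koszul, lieDeriv, mlieBracket_swap_apply (V := Z) (W := Y), real_inner_comm,
    inner_neg_left]
  ring

end LeviCivita

section Structure

variable (M) [RiemannianBundle (fun x : M ↦ TangentSpace I x)] [IsManifold I ∞ M]

/-- An almost Hermitian structure on the Riemannian manifold `(M, g)`:
a smooth field `J` of endomorphisms of the tangent spaces which satisfies `J² = -Id` and which is
orthogonal with respect to the metric. -/
structure AlmostHermitianStructure where
  /-- the almost complex structure -/
  J (x : M) : TangentSpace I x →L[ℝ] TangentSpace I x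
  contMDiff_J : ContMDiff I (I.prod 𝓘(ℝ, E →L[ℝ] E)) ∞
    (fun x ↦ TotalSpace.mk' (E →L[ℝ] E)
      (E := fun x : M ↦ (TangentSpace I x →L[ℝ] TangentSpace I x)) x (J x))
  J_J (x : M) (v : TangentSpace I x) : J x (J x v) = -v
  inner_J_J (x : M) (v w : TangentSpace I x) : inner ℝ (J x v) (J x w) = inner ℝ v w

namespace AlmostHermitianStructure

variable {I M}
variable (S : AlmostHermitianStructure I M)

/-- The vector field `JX`. -/
def mapField (X : Π x : M, TangentSpace I x) : Π x : M, TangentSpace I x :=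
  fun x ↦ S.J x (X x)

/-- The 1-form `Jα`, `(Jα)(X) = -α(JX)`. -/
def mapOneForm (α : Π x : M, TangentSpace I x →L[ℝ] ℝ) : Π x : M, TangentSpace I x →L[ℝ] ℝ :=
  fun x ↦ -(α x ∘L S.J x)

/-- The expression `[JA, JB] - [A, B] - J[JA, B] - J[A, JB]` in two vector fields. -/
def nijenhuisField (A B : Π x : M, TangentSpace I x) (x : M) : TangentSpace I x :=
  mlieBracket I (S.mapField A) (S.mapField B) x - mlieBracket I A B x
    - S.J x (mlieBracket I (S.mapField A) B x) - S.J x (mlieBracket I A (S.mapField B) x)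

theorem nijenhuisField_swap (X Y : Π x : M, TangentSpace I x) (x : M) :
    S.nijenhuisField X Y x = - S.nijenhuisField Y X x := by
  simp only [nijenhuisField, mlieBracket_swap_apply (V := X),
    mlieBracket_swap_apply (V := S.mapField X), map_neg]
  module

variable {x : M} {X Y : Π x : M, TangentSpace I x}

theorem mdifferentiableAt_mapField (hX : MDiffAt (T% X) x) : MDiffAt (T% (S.mapField X)) x :=
  MDifferentiableAt.clm_bundle_apply (b := fun y : M ↦ y)
    ((S.contMDiff_J x).mdifferentiableAt (by simp)) hX

variable [FiniteDimensional ℝ E]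

theorem nijenhuisField_tensorial_left (Y : Π x : M, TangentSpace I x) (x : M) :
    TensorialAt I E (fun X ↦ S.nijenhuisField X Y x) x where
  smul {f X} hf hX := by
    have := FiniteDimensional.complete ℝ E
    have e : S.mapField (f • X) = f • S.mapField X := by ext y; simp [mapField]
    simp only [nijenhuisField, e, mlieBracket_smul_left hf hX,
      mlieBracket_smul_left hf (S.mdifferentiableAt_mapField hX), map_add, map_smul]
    simp only [mapField, S.J_J]
    module
  add {X X'} hX hX' := by
    have := FiniteDimensional.complete ℝ E
    have e : S.mapField (X + X') = S.mapField X + S.mapField X' := by ext y; simp [mapField]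
    simp only [nijenhuisField, e, mlieBracket_add_left hX hX', mlieBracket_add_left
      (S.mdifferentiableAt_mapField hX) (S.mdifferentiableAt_mapField hX'), map_add]
    module

theorem nijenhuisField_tensorial_right (X : Π x : M, TangentSpace I x) (x : M) :
    TensorialAt I E (fun Y ↦ S.nijenhuisField X Y x) x where
  smul {f Y} hf hY := by
    simp only [S.nijenhuisField_swap X]
    rw [(S.nijenhuisField_tensorial_left X x).smul hf hY, smul_neg]
  add {Y Y'} hY hY' := by
    simp only [S.nijenhuisField_swap X]
    rw [(S.nijenhuisField_tensorial_left X x).add hY hY', neg_add]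

/-- The Nijenhuis tensor `N(A, B) = [JA, JB] - [A, B] - J[JA, B] - J[A, JB]`,
as a bilinear map on each tangent space. -/
def nijenhuis (x : M) : TangentSpace I x →L[ℝ] TangentSpace I x →L[ℝ] TangentSpace I x :=
  TensorialAt.mkHom₂ (I := I) (F := E) (F' := E) (fun A B ↦ S.nijenhuisField A B x) x
    (fun B _ ↦ S.nijenhuisField_tensorial_left B x)
    (fun A _ ↦ S.nijenhuisField_tensorial_right A x)

theorem nijenhuis_apply (hX : MDiffAt (T% X) x) (hY : MDiffAt (T% Y) x) :
    S.nijenhuis x (X x) (Y x) = S.nijenhuisField X Y x :=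
  TensorialAt.mkHom₂_apply _ _ hX hY

/-- The 2-form `N_w(a, b) = ⟨N(a, b), w⟩`, for `w ∈ T_x M`. -/
def nijenhuisForm (x : M) (w a b : TangentSpace I x) : ℝ :=
  inner ℝ (S.nijenhuis x a b) w

/-- The almost complex structure is integrable: its Nijenhuis tensor vanishes. -/
def IsIntegrable : Prop :=
  ∀ x : M, S.nijenhuis x = 0

variable [IsContMDiffRiemannianBundle I ∞ E (fun x : M ↦ TangentSpace I x)]

theorem nablaJ_tensorial (x : M) :
    TensorialAt I E (fun Y ↦ leviCivita I M (S.mapField Y) x - S.J x ∘L leviCivita I M Y x) x where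
  smul {f Y} hf hY := by
    have e : S.mapField (f • Y) = f • S.mapField Y := by ext y; simp [mapField]
    rw [e, (leviCivita I M).isCovariantDerivativeOn.leibniz hY hf,
      (leviCivita I M).isCovariantDerivativeOn.leibniz (S.mdifferentiableAt_mapField hY) hf]
    ext v
    simp [mapField]
    module
  add {Y Y'} hY hY' := by
    have e : S.mapField (Y + Y') = S.mapField Y + S.mapField Y' := by ext y; simp [mapField]
    rw [e, (leviCivita I M).isCovariantDerivativeOn.add hY hY',
      (leviCivita I M).isCovariantDerivativeOn.add (S.mdifferentiableAt_mapField hY)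
        (S.mdifferentiableAt_mapField hY')]
    ext v
    simp
    module

/-- The covariant derivative of `J`: `S.nablaJ x v` is the endomorphism `∇_v J` of `T_x M`, given
by `(∇_X J) Y = ∇_X (JY) - J (∇_X Y)`. -/
def nablaJ (x : M) : TangentSpace I x →L[ℝ] TangentSpace I x →L[ℝ] TangentSpace I x :=
  (TensorialAt.mkHom (I := I) (F := E)
    (fun Y ↦ leviCivita I M (S.mapField Y) x - S.J x ∘L leviCivita I M Y x) x
    (S.nablaJ_tensorial x)).flip

theorem nablaJ_apply (hY : MDiffAt (T% Y) x) (v : TangentSpace I x) :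
    S.nablaJ x v (Y x) = leviCivita I M (S.mapField Y) x v - S.J x (leviCivita I M Y x v) := by
  simp only [nablaJ, ContinuousLinearMap.flip_apply]
  rw [TensorialAt.mkHom_apply (S.nablaJ_tensorial x) hY]
  rfl

/-- The fundamental form `ω(u, v) = ⟨Ju, v⟩`. -/
def omega (x : M) (u v : TangentSpace I x) : ℝ :=
  inner ℝ (S.J x u) v

/-- The covariant derivative of `ω`, `(∇_u ω)(v, w) = ⟨(∇_u J) v, w⟩`. -/
def nablaOmega (x : M) (u v : TangentSpace I x) : TangentSpace I x →L[ℝ] ℝ :=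
  innerSL ℝ (S.nablaJ x u v)

/-- The codifferential `δω = -∑ᵢ (∇_{eᵢ} ω)(eᵢ, ·)`, with `(eᵢ)` an orthonormal basis of `T_x M`. -/
def codiffOmega (x : M) : TangentSpace I x →L[ℝ] ℝ :=
  -∑ i, S.nablaOmega x (stdOrthonormalBasis ℝ (TangentSpace I x) i)
    (stdOrthonormalBasis ℝ (TangentSpace I x) i)

/-- The Lee form `θ = J δω`. -/
def lee : Π x : M, TangentSpace I x →L[ℝ] ℝ :=
  S.mapOneForm S.codiffOmega

/-- The vector field `θ^♯` which is dual to the Lee form. -/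
def leeSharp (x : M) : TangentSpace I x :=
  (InnerProductSpace.toDual ℝ (TangentSpace I x)).symm (S.lee x)

/-- The 2-form `Φ(u, v) = (1/4) ⟨J(∇_u J), ∇_v J⟩`, where
`⟨A, B⟩ = ∑ᵢ ⟨A eᵢ, B eᵢ⟩` is the inner product of endomorphisms of `T_x M`. -/
def Phi (x : M) (u v : TangentSpace I x) : ℝ :=
  (1 / 4) * ∑ i, inner ℝ (S.J x (S.nablaJ x u (stdOrthonormalBasis ℝ (TangentSpace I x) i)))
    (S.nablaJ x v (stdOrthonormalBasis ℝ (TangentSpace I x) i))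

end AlmostHermitianStructure

end Structure

section Forms

variable [RiemannianBundle (fun x : M ↦ TangentSpace I x)] [IsManifold I ∞ M]
  [FiniteDimensional ℝ E]

variable {I} in
/-- The inner product of 2-forms on `T_x M`, `⟨φ, ψ⟩ = ∑_{i < j} φ(eᵢ, eⱼ) ψ(eᵢ, eⱼ)
= (1/2) ∑_{i, j} φ(eᵢ, eⱼ) ψ(eᵢ, eⱼ)`, with `(eᵢ)` an orthonormal basis of `T_x M`. -/
def twoFormInner (x : M) (φ ψ : TangentSpace I x → TangentSpace I x → ℝ) : ℝ :=
  (1 / 2) * ∑ i, ∑ j,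
    φ (stdOrthonormalBasis ℝ (TangentSpace I x) i) (stdOrthonormalBasis ℝ (TangentSpace I x) j)
    * ψ (stdOrthonormalBasis ℝ (TangentSpace I x) i) (stdOrthonormalBasis ℝ (TangentSpace I x) j)

variable [IsContMDiffRiemannianBundle I ∞ E (fun x : M ↦ TangentSpace I x)]

/-- The covariant derivative of a 1-form, `(∇_X α)(Y) = X(α(Y)) - α(∇_X Y)`,
on vector fields `X`, `Y`. -/
def nablaOneForm (α : Π x : M, TangentSpace I x →L[ℝ] ℝ)
    (X Y : Π x : M, TangentSpace I x) (x : M) : ℝ :=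
  lieDeriv I X (fun y ↦ α y (Y y)) x - α x (leviCivita I M Y x (X x))

variable {I} in
/-- The structure is Vaisman: `J` is integrable and `∇θ = 0`. -/
def AlmostHermitianStructure.IsVaisman (S : AlmostHermitianStructure I M) : Prop :=
  S.IsIntegrable ∧ ∀ X Y : Π x : M, TangentSpace I x, IsSmoothField I X → IsSmoothField I Y →
    ∀ x : M, nablaOneForm I S.lee X Y x = 0

variable {I} in
/-- The equality of 2-forms `-4Φ = d(Jθ)`. -/
def AlmostHermitianStructure.NegFourPhiEq (S : AlmostHermitianStructure I M) : Prop :=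
  ∀ X Y : Π x : M, TangentSpace I x, IsSmoothField I X → IsSmoothField I Y →
    ∀ x : M, -4 * S.Phi x (X x) (Y x) = extDerivOneForm I (S.mapOneForm S.lee) X Y x

end Forms

end AlmostHermitian

end

/-!
Evaluating both sides in a unitary frame of a tangent space shows that `4Φ + d(Jθ)` is the
difference of the two sides of the first-order equation, in dimension four and for every almost
Hermitian structure; this is the first equivalence.

Let `M` be compact and `ξ = θ^♯`. For `Y = JX` the trace of the equation says that `4 div ξ` is the
squared norm of `N`, so `N = 0` and `div ξ = 0` by the divergence theorem, and the equation becomes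
`∇θ(JX, JY) = -∇θ(Y, X)`. As `N = 0`, the Lee form determines `∇J`, and `dω = θ ∧ ω`. Hence `dθ` is
`J`-invariant and orthogonal to `ω`, i.e. anti-self-dual; being closed it is coclosed, so that
`|dθ|²` is a divergence and `dθ = 0`. Now `∇θ` is symmetric, trace free and `J`-anti-invariant. The
Weyl connection of `θ` preserves `J`, therefore its Ricci tensor is `J`-invariant and orthogonal to
`∇θ`. Together with the contracted second Bianchi identity, paired with `ξ`, this exhibits `|∇θ|²`
as a divergence, whence `∇θ = 0`.
-/

noncomputable section

/-! ### The algebra of the Levi-Civita connection -/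

/-- The algebraic skeleton of the Levi-Civita calculus on a compact Riemannian manifold:
`A` stands for the ring of smooth functions and `L` for the module of smooth vector fields. The
module `L` need not be free; the metric is only required to have a finite dual pair of generating
families, which is enough to form traces. -/
structure LeviCivitaCalculus (A L : Type*) [CommRing A] [Algebra ℝ A] [AddCommGroup L]
    [Module A L] where
  /-- the metric -/
  g : L →ₗ[A] L →ₗ[A] A
  /-- the derivative of a function along a vector field -/
  der : L →ₗ[A] Derivation ℝ A A
  /-- the connection; it is torsion free, so that `∇_X Y - ∇_Y X` plays the role of `[X, Y]` -/
  nabla : L →ₗ[A] L →+ L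
  g_symm (X Y : L) : g X Y = g Y X
  nabla_smul (X Y : L) (f : A) : nabla X (f • Y) = f • nabla X Y + der X f • Y
  der_g (Z X Y : L) : der Z (g X Y) = g (nabla Z X) Y + g X (nabla Z Y)
  der_bracket (X Y : L) (f : A) :
    der (nabla X Y - nabla Y X) f = der X (der Y f) - der Y (der X f)
  jacobi (X Y Z : L) :
    nabla X (nabla Y Z - nabla Z Y) - nabla (nabla Y Z - nabla Z Y) X
      = (nabla (nabla X Y - nabla Y X) Z - nabla Z (nabla X Y - nabla Y X))
        + (nabla Y (nabla X Z - nabla Z X) - nabla (nabla X Z - nabla Z X) Y)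
  /-- the index set of the generating families -/
  ι : Type
  [fintype_ι : Fintype ι]
  /-- the generators -/
  e : ι → L
  /-- the dual generators -/
  e' : ι → L
  sum_frame (X : L) : ∑ i, g X (e' i) • e i = X

namespace LeviCivitaCalculus

attribute [instance] LeviCivitaCalculus.fintype_ι

variable {A L P : Type*} [CommRing A] [Algebra ℝ A] [AddCommGroup L] [Module A L]
  [AddCommGroup P] [Module A P] (C : LeviCivitaCalculus A L)

section Trace

theorem ext_g {X Y : L} (h : ∀ Z, C.g X Z = C.g Y Z) : X = Y := by
  rw [← C.sum_frame X, ← C.sum_frame Y]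
  simp only [h]

theorem sum_g_smul (f : L →ₗ[A] P) (X : L) : ∑ i, C.g X (C.e' i) • f (C.e i) = f X := by
  simpa using congrArg f (C.sum_frame X)

theorem sum_frame' (X : L) : ∑ i, C.g X (C.e i) • C.e' i = X :=
  C.ext_g fun Z ↦ by
    rw [← C.sum_g_smul (C.g X) Z]
    simp only [map_sum, map_smul, LinearMap.sum_apply, LinearMap.smul_apply, smul_eq_mul]
    exact Finset.sum_congr rfl fun i _ ↦ by rw [C.g_symm Z, mul_comm]

theorem sum_g_smul' (f : L →ₗ[A] P) (X : L) : ∑ i, C.g X (C.e i) • f (C.e' i) = f X := by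
  simpa using congrArg f (C.sum_frame' X)

/-- The metric contraction of a bilinear map. -/
def trace : (L →ₗ[A] L →ₗ[A] P) →ₗ[A] P :=
  ∑ i, LinearMap.applyₗ (C.e' i) ∘ₗ LinearMap.applyₗ (C.e i)

theorem trace_apply (B : L →ₗ[A] L →ₗ[A] P) : C.trace B = ∑ i, B (C.e i) (C.e' i) := by
  simp [trace]

theorem trace_flip (B : L →ₗ[A] L →ₗ[A] P) : C.trace B.flip = C.trace B := by
  calc C.trace B.flip = ∑ i, ∑ j, C.g (C.e' i) (C.e' j) • B (C.e j) (C.e i) := by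
        rw [trace_apply]
        exact Finset.sum_congr rfl fun i _ ↦ (C.sum_g_smul (B.flip (C.e i)) _).symm
    _ = ∑ j, ∑ i, C.g (C.e' j) (C.e' i) • B (C.e j) (C.e i) := by
        rw [Finset.sum_comm]
        simp only [C.g_symm (C.e' _) (C.e' _)]
    _ = C.trace B := by
        rw [trace_apply]
        exact Finset.sum_congr rfl fun j _ ↦ C.sum_g_smul (B (C.e j)) _

theorem trace_comp {K K' : L →ₗ[A] L} (hK : ∀ X Y, C.g (K X) Y = C.g X (K' Y))
    (B : L →ₗ[A] L →ₗ[A] P) : C.trace (B ∘ₗ K) = C.trace (B.compl₂ K') := by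
  calc C.trace (B ∘ₗ K) = ∑ i, ∑ j, C.g (K (C.e i)) (C.e' j) • B (C.e j) (C.e' i) := by
        rw [trace_apply]
        exact Finset.sum_congr rfl fun i _ ↦ (C.sum_g_smul (B.flip (C.e' i)) _).symm
    _ = ∑ j, ∑ i, C.g (K' (C.e' j)) (C.e i) • B (C.e j) (C.e' i) := by
        rw [Finset.sum_comm]
        simp only [hK, C.g_symm (C.e _) (K' _)]
    _ = C.trace (B.compl₂ K') := by
        rw [trace_apply]
        exact Finset.sum_congr rfl fun j _ ↦ C.sum_g_smul' (B (C.e j)) _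

theorem trace_comp_of_skew {K : L →ₗ[A] L} (hK : ∀ X Y, C.g (K X) Y = -C.g X (K Y))
    (B : L →ₗ[A] L →ₗ[A] P) : C.trace (B ∘ₗ K) = -C.trace (B.compl₂ K) := by
  rw [C.trace_comp (K' := -K) (by simp [hK])]
  simp [trace_apply]

/-- The vector field which is dual to a 1-form. -/
def sharp : (L →ₗ[A] A) →ₗ[A] L := ∑ i, (LinearMap.applyₗ (C.e i)).smulRight (C.e' i)

theorem sharp_apply (α : L →ₗ[A] A) : C.sharp α = ∑ i, α (C.e i) • C.e' i := by
  simp [sharp]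

@[simp]
theorem g_sharp (α : L →ₗ[A] A) (X : L) : C.g (C.sharp α) X = α X := by
  rw [← C.sum_g_smul α X, sharp_apply]
  simp only [map_sum, map_smul, LinearMap.sum_apply, LinearMap.smul_apply, smul_eq_mul]
  exact Finset.sum_congr rfl fun i _ ↦ by rw [C.g_symm, mul_comm]

@[simp]
theorem sharp_g (X : L) : C.sharp (C.g X) = X := C.ext_g fun Y ↦ C.g_sharp _ Y

theorem trace_smulRight (α : L →ₗ[A] A) (β : L →ₗ[A] P) :
    C.trace (α.smulRight β) = β (C.sharp α) := by
  simp [trace_apply, sharp_apply]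

/-- The metric inner product of two bilinear forms. -/
def inner (β γ : L →ₗ[A] L →ₗ[A] A) : A :=
  ∑ i, ∑ j, β (C.e i) (C.e j) * γ (C.e' i) (C.e' j)

theorem inner_g_comp (S : L →ₗ[A] L) (γ : L →ₗ[A] L →ₗ[A] A) :
    C.inner (C.g ∘ₗ S) γ = C.trace (γ.compl₂ S) := by
  rw [← trace_flip, trace_apply]
  exact Finset.sum_congr rfl fun i _ ↦ C.sum_g_smul' (γ (C.e' i)) (S (C.e i))

theorem inner_sub_left (β β' γ : L →ₗ[A] L →ₗ[A] A) :
    C.inner (β - β') γ = C.inner β γ - C.inner β' γ := by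
  simp [inner, sub_mul, Finset.sum_sub_distrib]

theorem inner_flip_flip (β γ : L →ₗ[A] L →ₗ[A] A) :
    C.inner β.flip γ.flip = C.inner β γ :=
  Finset.sum_comm

end Trace

theorem eq_of_two_mul {a b : A} (h : 2 * a = 2 * b) : a = b := by
  have h_half : algebraMap ℝ A (1 / 2) * 2 = 1 := by
    rw [← map_ofNat (algebraMap ℝ A) 2, ← map_mul]; norm_num
  linear_combination algebraMap ℝ A (1 / 2) * h + (b - a) * h_half

theorem eq_zero_of_eq_neg {a : A} (h : a = -a) : a = 0 :=
  eq_of_two_mul (by linear_combination h)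

theorem trace_compl₂_of_symm {β : L →ₗ[A] L →ₗ[A] A} (hβ : ∀ X Y, β X Y = β Y X)
    {K : L →ₗ[A] L} (hK : ∀ X Y, C.g (K X) Y = -C.g X (K Y)) : C.trace (β.compl₂ K) = 0 := by
  have h_flip : (β.compl₂ K).flip = β ∘ₗ K := LinearMap.ext₂ fun X Y ↦ hβ _ _
  apply eq_zero_of_eq_neg
  rw [← C.trace_comp_of_skew hK, ← h_flip, trace_flip]

theorem trace_of_skew {β : L →ₗ[A] L →ₗ[A] A} (hβ : ∀ X Y, β X Y = -β Y X) :
    C.trace β = 0 := by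
  apply eq_zero_of_eq_neg
  conv_lhs => rw [← C.trace_flip β]
  simp only [trace_apply, LinearMap.flip_apply, hβ (C.e' _), Finset.sum_neg_distrib]

section CovariantDerivative

/-- The covariant derivative `(∇_X β)(Y, Z)` of a bilinear form. -/
def covDeriv (β : L →ₗ[A] L →ₗ[A] A) : L →ₗ[A] L →ₗ[A] L →ₗ[A] A :=
  LinearMap.mk₂ A
    (fun X Y ↦
      { toFun Z := C.der X (β Y Z) - β (C.nabla X Y) Z - β Y (C.nabla X Z)
        map_add' Z Z' := by simp only [map_add]; abel
        map_smul' f Z := by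
          simp only [map_smul, C.nabla_smul, map_add, smul_eq_mul, Derivation.leibniz,
            RingHom.id_apply]
          ring })
    (fun X X' Y ↦ LinearMap.ext fun Z ↦ by simp; ring)
    (fun f X Y ↦ LinearMap.ext fun Z ↦ by simp; ring)
    (fun X Y Y' ↦ LinearMap.ext fun Z ↦ by simp; ring)
    (fun f X Y ↦ LinearMap.ext fun Z ↦ by simp [C.nabla_smul]; ring)

theorem covDeriv_apply (β : L →ₗ[A] L →ₗ[A] A) (X Y Z : L) :
    C.covDeriv β X Y Z = C.der X (β Y Z) - β (C.nabla X Y) Z - β Y (C.nabla X Z) := rfl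

/-- The covariant derivative `(∇_X K) Y` of an endomorphism field. -/
def covDerivEnd (K : L →ₗ[A] L) : L →ₗ[A] L →ₗ[A] L :=
  LinearMap.mk₂ A (fun X Y ↦ C.nabla X (K Y) - K (C.nabla X Y))
    (fun X X' Y ↦ by simp; abel)
    (fun f X Y ↦ by simp [smul_sub])
    (fun X Y Y' ↦ by simp; abel)
    (fun f X Y ↦ by simp [C.nabla_smul, smul_sub])

theorem covDerivEnd_apply (K : L →ₗ[A] L) (X Y : L) :
    C.covDerivEnd K X Y = C.nabla X (K Y) - K (C.nabla X Y) := rfl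

theorem nabla_apply (K : L →ₗ[A] L) (X Y : L) :
    C.nabla X (K Y) = C.covDerivEnd K X Y + K (C.nabla X Y) := by
  rw [covDerivEnd_apply, sub_add_cancel]

theorem covDeriv_comp (β : L →ₗ[A] L →ₗ[A] A) (K : L →ₗ[A] L) (X : L) :
    C.covDeriv (β ∘ₗ K) X = C.covDeriv β X ∘ₗ K + β ∘ₗ C.covDerivEnd K X := by
  ext Y Z
  simp only [covDeriv_apply, LinearMap.comp_apply, LinearMap.add_apply, covDerivEnd_apply, map_sub,
    LinearMap.sub_apply]
  ring

theorem covDeriv_compl₂ (β : L →ₗ[A] L →ₗ[A] A) (K : L →ₗ[A] L) (X : L) :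
    C.covDeriv (β.compl₂ K) X = (C.covDeriv β X).compl₂ K + β.compl₂ (C.covDerivEnd K X) := by
  ext Y Z
  simp [covDeriv_apply, covDerivEnd_apply]

theorem sum_nabla_frame (B : L →ₗ[A] L →ₗ[A] P) (Z : L) :
    ∑ i, (B (C.nabla Z (C.e i)) (C.e' i) + B (C.e i) (C.nabla Z (C.e' i))) = 0 := by
  have h_frame (X : L) :
      ∑ i, (C.g X (C.e' i) • C.nabla Z (C.e i) + C.g X (C.nabla Z (C.e' i)) • C.e i) = 0 := by
    have h := congrArg (C.nabla Z) (C.sum_frame X)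
    simp only [map_sum, C.nabla_smul, C.der_g, add_smul, Finset.sum_add_distrib,
      C.sum_frame (C.nabla Z X)] at h
    rwa [add_left_comm, add_eq_left, ← Finset.sum_add_distrib] at h
  calc ∑ i, (B (C.nabla Z (C.e i)) (C.e' i) + B (C.e i) (C.nabla Z (C.e' i)))
      = ∑ i, ∑ j, B (C.g (C.e j) (C.e' i) • C.nabla Z (C.e i)
          + C.g (C.e j) (C.nabla Z (C.e' i)) • C.e i) (C.e' j) := by
        refine Finset.sum_congr rfl fun i _ ↦ ?_
        simp only [map_add, map_smul, LinearMap.add_apply, LinearMap.smul_apply,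
          Finset.sum_add_distrib, C.g_symm (C.e _), C.sum_g_smul']
    _ = ∑ j, B (∑ i, (C.g (C.e j) (C.e' i) • C.nabla Z (C.e i)
          + C.g (C.e j) (C.nabla Z (C.e' i)) • C.e i)) (C.e' j) := by
        rw [Finset.sum_comm]
        simp only [map_sum, LinearMap.sum_apply]
    _ = 0 := by simp only [h_frame, map_zero, LinearMap.zero_apply, Finset.sum_const_zero]

theorem der_trace (β : L →ₗ[A] L →ₗ[A] A) (Z : L) :
    C.der Z (C.trace β) = C.trace (C.covDeriv β Z) := by
  rw [← sub_eq_zero, ← C.sum_nabla_frame β Z]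
  simp only [trace_apply, covDeriv_apply, map_sum, ← Finset.sum_sub_distrib]
  exact Finset.sum_congr rfl fun i _ ↦ by ring

end CovariantDerivative

end LeviCivitaCalculus

namespace LeviCivitaCalculus

variable {A L : Type*} [CommRing A] [Algebra ℝ A] [AddCommGroup L] [Module A L]
  (C : LeviCivitaCalculus A L)

section Divergence

/-- The endomorphism field `X ↦ ∇_X ξ`. -/
def grad (ξ : L) : L →ₗ[A] L where
  toFun X := C.nabla X ξ
  map_add' X Y := by simp
  map_smul' f X := by simp

@[simp]
theorem grad_apply (ξ X : L) : C.grad ξ X = C.nabla X ξ := rfl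

/-- The bilinear form `⟨∇_X ξ, Y⟩`, the covariant derivative of the 1-form dual to `ξ`. -/
def gradForm (ξ : L) : L →ₗ[A] L →ₗ[A] A := C.g ∘ₗ C.grad ξ

@[simp]
theorem gradForm_apply (ξ X Y : L) : C.gradForm ξ X Y = C.g (C.nabla X ξ) Y := rfl

/-- The divergence of a vector field. -/
def div : L →+ A where
  toFun X := C.trace (C.gradForm X)
  map_zero' := by simp [trace_apply]
  map_add' X Y := by simp [trace_apply, Finset.sum_add_distrib]

theorem div_apply (X : L) : C.div X = C.trace (C.gradForm X) := rfl

theorem div_smul (f : A) (X : L) : C.div (f • X) = f * C.div X + C.der X f := by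
  have h_der : ∑ i, C.g X (C.e' i) * C.der (C.e i) f = C.der X f := by
    simpa using C.sum_g_smul
      { toFun Y := C.der Y f, map_add' Y Z := by simp, map_smul' a Y := by simp } X
  have h (i : C.ι) : C.gradForm (f • X) (C.e i) (C.e' i)
      = f * C.gradForm X (C.e i) (C.e' i) + C.g X (C.e' i) * C.der (C.e i) f := by
    simp [C.nabla_smul, mul_comm]
  simp only [div_apply, trace_apply, h, Finset.sum_add_distrib, ← Finset.mul_sum, h_der]

theorem div_sharp (β : L →ₗ[A] L →ₗ[A] A) (X : L) :
    C.div (C.sharp (β X))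
      = C.trace ((C.covDeriv β).flip X) + C.trace (β ∘ₗ C.grad X) := by
  have h (i : C.ι) : C.g (C.nabla (C.e i) (C.sharp (β X))) (C.e' i)
      = C.covDeriv β (C.e i) X (C.e' i) + β (C.nabla (C.e i) X) (C.e' i) := by
    have h_der := C.der_g (C.e i) (C.sharp (β X)) (C.e' i)
    rw [g_sharp, g_sharp] at h_der
    rw [covDeriv_apply, h_der]
    ring
  simp [div_apply, trace_apply, h, Finset.sum_add_distrib]

end Divergence

section Curvature

/-- The curvature tensor `R(X, Y)Z`. -/
def curvature : L →ₗ[A] L →ₗ[A] L →ₗ[A] L :=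
  LinearMap.mk₂ A
    (fun X Y ↦
      { toFun Z := C.nabla X (C.nabla Y Z) - C.nabla Y (C.nabla X Z)
          - C.nabla (C.nabla X Y - C.nabla Y X) Z
        map_add' Z Z' := by simp only [map_add]; abel
        map_smul' f Z := by
          simp only [C.nabla_smul, map_add, C.der_bracket, RingHom.id_apply, smul_sub, sub_smul]
          abel })
    (fun X X' Y ↦ LinearMap.ext fun Z ↦ by simp; abel)
    (fun f X Y ↦ LinearMap.ext fun Z ↦ by simp [C.nabla_smul, smul_sub]; abel)
    (fun X Y Y' ↦ LinearMap.ext fun Z ↦ by simp; abel)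
    (fun f X Y ↦ LinearMap.ext fun Z ↦ by simp [C.nabla_smul, smul_sub]; abel)

variable (V X Y Z W : L)

theorem curvature_apply : C.curvature X Y Z = C.nabla X (C.nabla Y Z) - C.nabla Y (C.nabla X Z)
    - C.nabla (C.nabla X Y - C.nabla Y X) Z := rfl

theorem curvature_swap : C.curvature X Y Z = -C.curvature Y X Z := by
  simp only [curvature_apply, map_sub, AddMonoidHom.sub_apply]; abel

theorem curvature_bianchi :
    C.curvature X Y Z + C.curvature Y Z X + C.curvature Z X Y = 0 := by
  rw [← sub_eq_zero.2 (C.jacobi X Y Z)]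
  simp only [curvature_apply, map_sub, AddMonoidHom.sub_apply]
  abel

theorem g_curvature_skew : C.g (C.curvature X Y Z) W = -C.g (C.curvature X Y W) Z := by
  have h := C.der_g (C.nabla X Y - C.nabla Y X) Z W
  rw [C.der_bracket] at h
  simp only [map_add, C.der_g, map_sub, LinearMap.sub_apply, AddMonoidHom.sub_apply] at h
  simp only [curvature_apply, map_sub, LinearMap.sub_apply, AddMonoidHom.sub_apply, C.g_symm _ Z]
  linear_combination h

theorem g_curvature_pair : C.g (C.curvature X Y Z) W = C.g (C.curvature Z W X) Y := by
  have swap (X Y Z W : L) : C.g (C.curvature X Y Z) W = -C.g (C.curvature Y X Z) W := by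
    rw [curvature_swap, map_neg, LinearMap.neg_apply]
  have bianchi (X Y Z W : L) : C.g (C.curvature X Y Z) W + C.g (C.curvature Y Z X) W
      + C.g (C.curvature Z X Y) W = 0 := by
    simp only [← LinearMap.add_apply, ← map_add, C.curvature_bianchi, map_zero,
      LinearMap.zero_apply]
  have b1 := bianchi X Y Z W
  have b2 := bianchi Y Z W X
  have b3 := bianchi Z W X Y
  have b4 := bianchi W X Y Z
  rw [C.g_curvature_skew Y Z W, C.g_curvature_skew Z W Y, swap W Y] at b2
  rw [swap W X, C.g_curvature_skew X W, swap X Z, C.g_curvature_skew Z X] at b3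
  rw [swap W X, C.g_curvature_skew X Y, C.g_curvature_skew Y W] at b4
  exact eq_of_two_mul (by linear_combination b1 + b2 - b3 - b4)

/-- The covariant derivative `(∇_V R)(X, Y)Z` of the curvature tensor. -/
def derCurvature : L :=
  C.nabla V (C.curvature X Y Z) - C.curvature (C.nabla V X) Y Z - C.curvature X (C.nabla V Y) Z
    - C.curvature X Y (C.nabla V Z)

theorem derCurvature_swap : C.derCurvature V X Y Z = -C.derCurvature V Y X Z := by
  simp only [derCurvature, C.curvature_swap X, C.curvature_swap (C.nabla V X), map_neg]; abel

theorem g_derCurvature_skew :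
    C.g (C.derCurvature V X Y Z) W = -C.g (C.derCurvature V X Y W) Z := by
  have h := congrArg (C.der V) (C.g_curvature_skew X Y Z W)
  rw [map_neg, C.der_g, C.der_g] at h
  simp only [derCurvature, map_sub, LinearMap.sub_apply, C.g_curvature_skew _ _ _ W]
  linear_combination h - C.g_curvature_skew X Y Z (C.nabla V W)

theorem derCurvature_bianchi :
    C.derCurvature V X Y Z + C.derCurvature X Y V Z + C.derCurvature Y V X Z = 0 := by
  have h := congrArg (C.nabla · Z) (C.jacobi V X Y)
  simp only [map_sub, map_add, AddMonoidHom.sub_apply, AddMonoidHom.add_apply] at h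
  rw [← sub_eq_zero] at h
  rw [← neg_eq_zero, ← h]
  simp only [derCurvature, curvature_apply, map_sub, AddMonoidHom.sub_apply]
  abel

/-- The bilinear form `(X, W) ↦ ⟨R(X, Y)Z, W⟩`, whose trace is the Ricci tensor. -/
def curvatureForm : L →ₗ[A] L →ₗ[A] A := C.g ∘ₗ (C.curvature.flip Y).flip Z

@[simp]
theorem curvatureForm_apply : C.curvatureForm Y Z X W = C.g (C.curvature X Y Z) W := rfl

/-- The Ricci tensor. -/
def ricci : L →ₗ[A] L →ₗ[A] A := ∑ i, (C.curvature (C.e i)).compr₂ (C.g.flip (C.e' i))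

theorem ricci_apply : C.ricci Y Z = C.trace (C.curvatureForm Y Z) := by
  simp [ricci, trace_apply]

theorem ricci_symm : C.ricci Y Z = C.ricci Z Y := by
  rw [ricci_apply, ricci_apply, ← trace_flip]
  congr 1
  ext X W
  rw [LinearMap.flip_apply, curvatureForm_apply, curvatureForm_apply, g_curvature_pair,
    curvature_swap, map_neg, LinearMap.neg_apply, g_curvature_skew, neg_neg]

theorem covDeriv_ricci :
    C.covDeriv C.ricci V Y Z = ∑ i, C.g (C.derCurvature V (C.e i) Y Z) (C.e' i) := by
  rw [covDeriv_apply, ricci_apply, der_trace]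
  simp only [ricci_apply, trace_apply, ← Finset.sum_sub_distrib]
  refine Finset.sum_congr rfl fun i _ ↦ ?_
  simp only [covDeriv_apply, curvatureForm_apply, C.der_g, derCurvature, map_sub,
    LinearMap.sub_apply]
  ring

/-- The scalar curvature. -/
def scal : A := C.trace C.ricci

/-- The contracted second Bianchi identity. -/
theorem der_scal : C.der V C.scal = 2 * C.trace ((C.covDeriv C.ricci).flip V) := by
  have h_bianchi : ∑ i, ∑ j, (C.g (C.derCurvature V (C.e j) (C.e i) (C.e' i)) (C.e' j)
      + C.g (C.derCurvature (C.e j) (C.e i) V (C.e' i)) (C.e' j)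
      + C.g (C.derCurvature (C.e i) V (C.e j) (C.e' i)) (C.e' j)) = 0 := by
    simp only [← LinearMap.add_apply, ← map_add, C.derCurvature_bianchi, map_zero,
      LinearMap.zero_apply, Finset.sum_const_zero]
  have h_swap : ∑ i, ∑ j, C.g (C.derCurvature (C.e i) V (C.e j) (C.e' i)) (C.e' j)
      = -∑ i, ∑ j, C.g (C.derCurvature (C.e i) (C.e j) V (C.e' i)) (C.e' j) := by
    simp only [C.derCurvature_swap _ V, map_neg, LinearMap.neg_apply, Finset.sum_neg_distrib]
  have h_skew : ∑ i, ∑ j, C.g (C.derCurvature (C.e j) (C.e i) V (C.e' i)) (C.e' j)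
      = -∑ i, ∑ j, C.g (C.derCurvature (C.e i) (C.e j) V (C.e' i)) (C.e' j) := by
    rw [Finset.sum_comm]
    simp only [← Finset.sum_neg_distrib]
    exact Finset.sum_congr rfl fun _ _ ↦ Finset.sum_congr rfl fun _ _ ↦
      C.g_derCurvature_skew _ _ _ _ _
  have h_tr : C.trace ((C.covDeriv C.ricci).flip V)
      = ∑ i, ∑ j, C.g (C.derCurvature (C.e i) (C.e j) V (C.e' i)) (C.e' j) := by
    simp only [trace_apply, LinearMap.flip_apply, covDeriv_ricci]
  simp only [Finset.sum_add_distrib] at h_bianchi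
  rw [scal, der_trace, trace_apply, h_tr]
  simp only [covDeriv_ricci]
  linear_combination h_bianchi - h_swap - h_skew

theorem div_einstein : C.div (2 • C.sharp (C.ricci X) - C.scal • X)
    = 2 * C.trace (C.ricci ∘ₗ C.grad X) - C.scal * C.div X := by
  rw [map_sub, map_nsmul, div_smul, div_sharp, der_scal, nsmul_eq_mul, Nat.cast_ofNat]
  ring

end Curvature
end LeviCivitaCalculus

namespace LeviCivitaCalculus

variable {A L : Type*} [CommRing A] [Algebra ℝ A] [AddCommGroup L] [Module A L]
  (C : LeviCivitaCalculus A L)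

section SkewEndomorphism

/-- The second covariant derivative `(∇²_{X, Y} K) Z` of an endomorphism field. -/
def covDerivEnd₂ (K : L →ₗ[A] L) (X Y Z : L) : L :=
  C.nabla X (C.covDerivEnd K Y Z) - C.covDerivEnd K (C.nabla X Y) Z
    - C.covDerivEnd K Y (C.nabla X Z)

theorem ricci_identity (K : L →ₗ[A] L) (X Y Z : L) :
    C.covDerivEnd₂ K X Y Z - C.covDerivEnd₂ K Y X Z
      = C.curvature X Y (K Z) - K (C.curvature X Y Z) := by
  simp only [covDerivEnd₂, covDerivEnd_apply, curvature_apply, map_sub, AddMonoidHom.sub_apply]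
  abel

theorem nabla_trace_covDerivEnd (K : L →ₗ[A] L) (Z : L) :
    C.nabla Z (C.trace (C.covDerivEnd K)) = ∑ i, C.covDerivEnd₂ K Z (C.e i) (C.e' i) := by
  rw [← sub_eq_zero, ← C.sum_nabla_frame (C.covDerivEnd K) Z, trace_apply, map_sum,
    ← Finset.sum_sub_distrib]
  exact Finset.sum_congr rfl fun i _ ↦ by rw [covDerivEnd₂]; abel

variable {C} {K : L →ₗ[A] L} (hK : ∀ X Y, C.g (K X) Y = -C.g X (K Y))

include hK

theorem g_covDerivEnd_skew (X Y Z : L) :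
    C.g (C.covDerivEnd K X Y) Z = -C.g Y (C.covDerivEnd K X Z) := by
  have h := congrArg (C.der X) (hK Y Z)
  simp only [map_neg, C.der_g, C.nabla_apply, map_add, LinearMap.add_apply] at h
  linear_combination h - hK Y (C.nabla X Z) - hK (C.nabla X Y) Z

theorem g_covDerivEnd₂_skew (X Y Z W : L) :
    C.g (C.covDerivEnd₂ K X Y Z) W = -C.g Z (C.covDerivEnd₂ K X Y W) := by
  have h := congrArg (C.der X) (g_covDerivEnd_skew hK Y Z W)
  simp only [map_neg, C.der_g] at h
  simp only [covDerivEnd₂, map_sub, LinearMap.sub_apply]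
  linear_combination h - g_covDerivEnd_skew hK Y Z (C.nabla X W)
    - g_covDerivEnd_skew hK (C.nabla X Y) Z W - g_covDerivEnd_skew hK Y (C.nabla X Z) W

/-- The divergence of the divergence of a skew endomorphism field vanishes: by the Ricci identity it
is a contraction of the Ricci tensor with `K`. -/
theorem div_trace_covDerivEnd : C.div (C.trace (C.covDerivEnd K)) = 0 := by
  set s := ∑ j, ∑ i, C.g (C.covDerivEnd₂ K (C.e j) (C.e i) (C.e' i)) (C.e' j)
  set s' := ∑ j, ∑ i, C.g (C.covDerivEnd₂ K (C.e i) (C.e j) (C.e' i)) (C.e' j)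
  have h_div : C.div (C.trace (C.covDerivEnd K)) = s := by
    simp only [div_apply, trace_apply _ (C.gradForm _), gradForm_apply, nabla_trace_covDerivEnd,
      map_sum, LinearMap.sum_apply, s]
  have h_skew : s = -s' := by
    simp only [s, s', ← Finset.sum_neg_distrib]
    rw [Finset.sum_comm]
    exact Finset.sum_congr rfl fun i _ ↦ Finset.sum_congr rfl fun j _ ↦ by
      rw [g_covDerivEnd₂_skew hK, C.g_symm]
  have h_ricci : ∑ i, ∑ j, C.g (C.curvature (C.e j) (C.e i) (K (C.e' i))) (C.e' j) = 0 := by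
    rw [← C.trace_compl₂_of_symm C.ricci_symm hK]
    simp only [trace_apply, LinearMap.compl₂_apply, ricci_apply, curvatureForm_apply]
  have h_comm : s - s' = 0 := by
    have h (i j : C.ι) : C.g (C.covDerivEnd₂ K (C.e j) (C.e i) (C.e' i)) (C.e' j)
        - C.g (C.covDerivEnd₂ K (C.e i) (C.e j) (C.e' i)) (C.e' j)
        = C.g (C.curvature (C.e j) (C.e i) (K (C.e' i))) (C.e' j)
          + C.g (C.curvature (C.e i) (C.e j) (K (C.e' j))) (C.e' i) := by
      rw [← LinearMap.sub_apply, ← map_sub, ricci_identity, map_sub, LinearMap.sub_apply, hK,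
        C.g_curvature_skew (C.e i), C.curvature_swap (C.e i), map_neg, LinearMap.neg_apply,
        sub_eq_add_neg]
    simp only [s, s', ← Finset.sum_sub_distrib, h]
    simp only [Finset.sum_add_distrib, h_ricci]
    rw [Finset.sum_comm, h_ricci, zero_add]
  rw [h_div]
  exact eq_zero_of_eq_neg (by linear_combination h_skew + h_comm)

end SkewEndomorphism

section ExteriorDerivative

variable (ξ X Y Z : L)

/-- The exterior derivative of the 1-form dual to `ξ`. -/
def extDeriv : L →ₗ[A] L →ₗ[A] A := C.gradForm ξ - (C.gradForm ξ).flip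

theorem extDeriv_apply : C.extDeriv ξ X Y = C.g (C.nabla X ξ) Y - C.g (C.nabla Y ξ) X := rfl

theorem extDeriv_swap : C.extDeriv ξ X Y = -C.extDeriv ξ Y X := by simp [extDeriv_apply]

theorem covDeriv_extDeriv_cyclic : C.covDeriv (C.extDeriv ξ) X Y Z
    + C.covDeriv (C.extDeriv ξ) Y Z X + C.covDeriv (C.extDeriv ξ) Z X Y = 0 := by
  have h := congrArg (C.g · ξ) (C.curvature_bianchi X Y Z)
  simp only [map_add, LinearMap.add_apply, C.g_curvature_skew _ _ _ ξ, map_zero,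
    LinearMap.zero_apply] at h
  simp only [curvature_apply, map_sub, LinearMap.sub_apply, AddMonoidHom.sub_apply] at h
  simp only [covDeriv_apply, extDeriv_apply, map_sub, C.der_g]
  linear_combination -h

theorem two_mul_div_sharp_extDeriv : 2 * C.div (C.sharp (C.extDeriv ξ ξ))
    = 2 * C.trace ((C.covDeriv (C.extDeriv ξ)).flip ξ) - C.inner (C.extDeriv ξ) (C.extDeriv ξ) := by
  have h_flip : (C.extDeriv ξ).flip = -C.extDeriv ξ :=
    LinearMap.ext₂ fun X Y ↦ C.extDeriv_swap ξ Y X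
  have h_trace : C.trace (C.extDeriv ξ ∘ₗ C.grad ξ) = -C.inner (C.gradForm ξ) (C.extDeriv ξ) := by
    rw [gradForm, inner_g_comp, ← trace_flip, ← map_neg]
    congr 1
    exact LinearMap.ext₂ fun X Y ↦ C.extDeriv_swap ξ _ _
  have h_inner : C.inner (C.extDeriv ξ) (C.extDeriv ξ)
      = 2 * C.inner (C.gradForm ξ) (C.extDeriv ξ) := by
    have h : C.inner (C.gradForm ξ).flip (C.extDeriv ξ)
        = -C.inner (C.gradForm ξ) (C.extDeriv ξ) := by
      rw [← inner_flip_flip, LinearMap.flip_flip, h_flip]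
      simp [inner]
    conv_lhs => rw [extDeriv, inner_sub_left, ← extDeriv, h]
    ring
  rw [div_sharp, h_trace, h_inner]
  ring

end ExteriorDerivative

end LeviCivitaCalculus

namespace LeviCivitaCalculus

variable {A L : Type*} [CommRing A] [Algebra ℝ A] [AddCommGroup L] [Module A L]
  (C : LeviCivitaCalculus A L)

theorem covDeriv_of_skew {J : L →ₗ[A] L} {F : L →ₗ[A] L →ₗ[A] A}
    (hFJ : ∀ X Y, F (J X) Y = -F X (J Y)) (X Y Z : L) :
    C.covDeriv F X (J Y) Z + F (C.covDerivEnd J X Y) Z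
      = -C.covDeriv F X Y (J Z) - F Y (C.covDerivEnd J X Z) := by
  have hF : F ∘ₗ J = -F.compl₂ J := LinearMap.ext₂ hFJ
  have h_der := congrArg (fun β ↦ C.covDeriv β X Y Z) hF
  have h_neg : C.covDeriv (-F.compl₂ J) X Y Z = -C.covDeriv (F.compl₂ J) X Y Z := by
    simp [covDeriv_apply]; ring
  simp only [h_neg, covDeriv_comp, covDeriv_compl₂, LinearMap.add_apply, LinearMap.compl₂_apply,
    LinearMap.comp_apply] at h_der
  linear_combination h_der

/-- The data of a Hermitian surface: an orthogonal almost complex structure `J` and the vector field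
`ξ` dual to its Lee form, which determines the covariant derivative of `J`. -/
structure IsHermitianSurface (J : L →ₗ[A] L) (ξ : L) : Prop where
  J_J (X : L) : J (J X) = -X
  g_J (X Y : L) : C.g (J X) Y = -C.g X (J Y)
  trace_g : C.trace C.g = 4
  two_g_covDerivEnd (X Y Z : L) : 2 * C.g (C.covDerivEnd J X Y) Z
    = C.g ξ (J Y) * C.g X Z - C.g ξ Y * C.g (J X) Z - C.g X (J Y) * C.g ξ Z + C.g X Y * C.g (J ξ) Z

namespace IsHermitianSurface

variable {C} {J : L →ₗ[A] L} {ξ : L} (h : C.IsHermitianSurface J ξ)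

include h

theorem two_smul_covDerivEnd (X Y : L) : (2 : A) • C.covDerivEnd J X Y
    = C.g ξ (J Y) • X - C.g ξ Y • J X - C.g X (J Y) • ξ + C.g X Y • J ξ :=
  C.ext_g fun Z ↦ by simp [h.two_g_covDerivEnd X Y Z]

/-- `ξ` is the Lee field: `Jξ` is the divergence of `J`. -/
theorem trace_covDerivEnd : C.trace (C.covDerivEnd J) = J ξ := by
  refine C.ext_g fun Z ↦ eq_of_two_mul ?_
  have h_term (i : C.ι) : 2 * C.g (C.covDerivEnd J (C.e i) (C.e' i)) Z
      = -(C.g (J ξ) (C.e' i) * C.g (C.e i) Z) - C.g ξ (C.e' i) * C.g (J (C.e i)) Z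
        - C.g (C.e i) (J (C.e' i)) * C.g ξ Z + C.g (C.e i) (C.e' i) * C.g (J ξ) Z := by
    rw [h.two_g_covDerivEnd, h.g_J ξ (C.e' i), neg_mul, neg_neg]
  have h₁ : ∑ i, C.g (J ξ) (C.e' i) * C.g (C.e i) Z = C.g (J ξ) Z :=
    C.sum_g_smul (C.g.flip Z) (J ξ)
  have h₂ : ∑ i, C.g ξ (C.e' i) * C.g (J (C.e i)) Z = C.g (J ξ) Z :=
    C.sum_g_smul (C.g.flip Z ∘ₗ J) ξ
  have h₃ : ∑ i, C.g (C.e i) (J (C.e' i)) = 0 := by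
    simpa [trace_apply] using C.trace_compl₂_of_symm C.g_symm h.g_J
  have h₄ : ∑ i, C.g (C.e i) (C.e' i) = 4 := by rw [← trace_apply, h.trace_g]
  rw [trace_apply, map_sum, LinearMap.sum_apply, Finset.mul_sum]
  simp only [h_term, Finset.sum_add_distrib, Finset.sum_sub_distrib, Finset.sum_neg_distrib,
    ← Finset.sum_mul, h₁, h₂, h₃, h₄]
  ring

theorem trace_gradForm_J : C.trace ((C.gradForm ξ).compl₂ J) = 0 := by
  have h_term (i : C.ι) : C.g (C.nabla (C.e i) (J ξ)) (C.e' i)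
      = -C.g ξ (C.covDerivEnd J (C.e i) (C.e' i)) - C.g (C.nabla (C.e i) ξ) (J (C.e' i)) := by
    rw [nabla_apply, map_add, LinearMap.add_apply, g_covDerivEnd_skew h.g_J, h.g_J, sub_eq_add_neg]
  have h_Jξ : C.g ξ (J ξ) = 0 := eq_zero_of_eq_neg (by rw [← h.g_J, C.g_symm])
  have h_div := div_trace_covDerivEnd h.g_J
  rw [h.trace_covDerivEnd, div_apply, trace_apply] at h_div
  simp only [gradForm_apply, h_term, Finset.sum_sub_distrib, Finset.sum_neg_distrib] at h_div
  rw [← map_sum, ← trace_apply, h.trace_covDerivEnd, h_Jξ, neg_zero, zero_sub, neg_eq_zero] at h_div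
  simpa [trace_apply] using h_div

theorem trace_J_J {P : Type*} [AddCommGroup P] [Module A P] (B : L →ₗ[A] L →ₗ[A] P) :
    C.trace ((B ∘ₗ J).compl₂ J) = C.trace B := by
  have hJ : (B.compl₂ J).compl₂ J = -B := LinearMap.ext₂ fun X Y ↦ by simp [h.J_J]
  have := C.trace_comp_of_skew h.g_J (B.compl₂ J)
  rwa [hJ, map_neg, neg_neg] at this

section ClosedPrimitiveForm

variable {F : L →ₗ[A] L →ₗ[A] A}

theorem trace_compl₂_covDerivEnd (hFJ : ∀ X Y, F (J X) Y = -F X (J Y)) (X : L) :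
    C.trace (F.compl₂ (C.covDerivEnd J X)) = 0 := by
  have h_term (i : C.ι) : 2 * F (C.e i) (C.covDerivEnd J X (C.e' i))
      = -(C.g (J ξ) (C.e' i) * F (C.e i) X) - C.g ξ (C.e' i) * F (C.e i) (J X)
        + C.g (J X) (C.e' i) * F (C.e i) ξ + C.g X (C.e' i) * F (C.e i) (J ξ) := by
    rw [← smul_eq_mul, ← map_smul, h.two_smul_covDerivEnd]
    simp [h.g_J, sub_eq_add_neg]
  have h_contract (U V : L) : ∑ i, C.g U (C.e' i) * F (C.e i) V = F U V :=
    C.sum_g_smul (F.flip V) U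
  refine eq_of_two_mul ?_
  simp only [trace_apply, LinearMap.compl₂_apply, Finset.mul_sum, h_term, Finset.sum_add_distrib,
    Finset.sum_sub_distrib, Finset.sum_neg_distrib, h_contract]
  linear_combination hFJ X ξ - hFJ ξ X

theorem sum_covDerivEnd (hF : ∀ X Y, F X Y = -F Y X) (hFJ : ∀ X Y, F (J X) Y = -F X (J Y))
    (hprim : C.trace (F.compl₂ J) = 0) (X : L) :
    ∑ i, F (C.e' i) (C.covDerivEnd J (C.e i) X) = F ξ (J X) := by
  have h_term (i : C.ι) : 2 * F (C.e' i) (C.covDerivEnd J (C.e i) X)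
      = C.g ξ (J X) * F (C.e' i) (C.e i) - C.g ξ X * F (C.e' i) (J (C.e i))
        - C.g (J X) (C.e i) * F (C.e' i) ξ + C.g X (C.e i) * F (C.e' i) (J ξ) := by
    rw [← smul_eq_mul, ← map_smul, h.two_smul_covDerivEnd]
    simp [C.g_symm (C.e i)]
  have h_contract (U V : L) : ∑ i, C.g U (C.e i) * F (C.e' i) V = F U V :=
    C.sum_g_smul' (F.flip V) U
  have h_tr : ∑ i, F (C.e' i) (C.e i) = 0 := by
    rw [← C.trace_of_skew hF, ← trace_flip, trace_apply]
    rfl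
  have h_trJ : ∑ i, F (C.e' i) (J (C.e i)) = 0 := by
    rw [← hprim, ← trace_flip, trace_apply]
    rfl
  refine eq_of_two_mul ?_
  simp only [Finset.mul_sum, h_term, Finset.sum_add_distrib, Finset.sum_sub_distrib, h_contract]
  rw [← Finset.mul_sum, ← Finset.mul_sum, h_tr, h_trJ]
  linear_combination hFJ X ξ - 2 * hF (J X) ξ

theorem trace_covDeriv_J_of_closed (hF : ∀ X Y, F X Y = -F Y X)
    (hclosed : ∀ X Y Z, C.covDeriv F X Y Z + C.covDeriv F Y Z X + C.covDeriv F Z X Y = 0) (X : L) :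
    C.trace ((C.covDeriv F X).compl₂ J) = -2 * C.trace ((C.covDeriv F).compl₂ J) X := by
  have h_swap (X Y Z : L) : C.covDeriv F X Y Z = -C.covDeriv F X Z Y := by
    simp only [covDeriv_apply, hF _ Z, hF Y, map_neg]; ring
  have h_sum : ∑ i, (C.covDeriv F X (C.e i) (J (C.e' i)) + C.covDeriv F (C.e i) (J (C.e' i)) X
      + C.covDeriv F (J (C.e' i)) X (C.e i)) = 0 :=
    Finset.sum_eq_zero fun i _ ↦ hclosed _ _ _
  have h_adj : ∑ i, C.covDeriv F (J (C.e' i)) X (C.e i)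
      = ∑ i, C.covDeriv F (C.e i) (J (C.e' i)) X := by
    have := C.trace_comp_of_skew h.g_J ((C.covDeriv F).flip X)
    rw [← trace_flip] at this
    simpa [trace_apply, h_swap _ X] using this
  simp only [Finset.sum_add_distrib, h_adj] at h_sum
  simp only [trace_apply, LinearMap.compl₂_apply, LinearMap.sum_apply]
  linear_combination h_sum

theorem trace_covDeriv_eq_zero (hF : ∀ X Y, F X Y = -F Y X)
    (hFJ : ∀ X Y, F (J X) Y = -F X (J Y)) (hprim : C.trace (F.compl₂ J) = 0)
    (hclosed : ∀ X Y Z, C.covDeriv F X Y Z + C.covDeriv F Y Z X + C.covDeriv F Z X Y = 0) :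
    C.trace (C.covDeriv F) = 0 := by
  have h_primJ (X : L) : C.trace ((C.covDeriv F X).compl₂ J) = 0 := by
    have h_der := C.der_trace (F.compl₂ J) X
    rwa [hprim, map_zero, covDeriv_compl₂, map_add, h.trace_compl₂_covDerivEnd hFJ, add_zero,
      eq_comm] at h_der
  have h_coJ (X : L) : C.trace ((C.covDeriv F).compl₂ J) X = 0 :=
    eq_of_two_mul (by linear_combination h.trace_covDeriv_J_of_closed hF hclosed X - h_primJ X)
  have h_sum (X : L) : C.trace ((C.covDeriv F).compl₂ J) X = -C.trace (C.covDeriv F) (J X)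
      - F (C.trace (C.covDerivEnd J)) X - ∑ i, F (C.e' i) (C.covDerivEnd J (C.e i) X) := by
    simp only [trace_apply, LinearMap.compl₂_apply, LinearMap.sum_apply, map_sum,
      ← Finset.sum_neg_distrib, ← Finset.sum_sub_distrib]
    exact Finset.sum_congr rfl fun i _ ↦ by
      linear_combination C.covDeriv_of_skew hFJ (C.e i) (C.e' i) X
  have h_J (X : L) : C.trace (C.covDeriv F) (J X) = 0 := by
    have h_eq := h_sum X
    rw [h_coJ, h.trace_covDerivEnd, h.sum_covDerivEnd hF hFJ hprim, hFJ] at h_eq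
    linear_combination h_eq
  ext X
  simpa [h.J_J] using h_J (-J X)

end ClosedPrimitiveForm

/-- If the `J`-invariant part of `∇ξ` is skew, then the squared norm of the exterior derivative of
the Lee form is a divergence: `dθ` is closed, primitive and `J`-invariant, hence coclosed. -/
theorem exists_div_eq_inner_extDeriv
    (hB : ∀ X Y, C.gradForm ξ (J X) (J Y) = -C.gradForm ξ Y X) :
    ∃ X, C.div X = C.inner (C.extDeriv ξ) (C.extDeriv ξ) := by
  have h_skew := C.extDeriv_swap ξ
  have h_J (X Y : L) : C.extDeriv ξ (J X) Y = -C.extDeriv ξ X (J Y) := by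
    have h_JJ : C.extDeriv ξ (J (J X)) (J Y) = C.extDeriv ξ (J X) Y := by
      simp only [extDeriv, LinearMap.sub_apply, LinearMap.flip_apply, hB]
      ring
    rw [← h_JJ, h.J_J, map_neg, LinearMap.neg_apply]
  have h_prim : C.trace ((C.extDeriv ξ).compl₂ J) = 0 := by
    have h_split : C.trace ((C.extDeriv ξ).compl₂ J)
        = C.trace ((C.gradForm ξ).compl₂ J) - C.trace (C.gradForm ξ ∘ₗ J).flip := by
      simp [trace_apply, extDeriv, Finset.sum_sub_distrib]
    rw [h_split, trace_flip, C.trace_comp_of_skew h.g_J, h.trace_gradForm_J, neg_zero, sub_zero]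
  have h_coclosed : C.trace ((C.covDeriv (C.extDeriv ξ)).flip ξ) = 0 := by
    have h_co := congrArg (· ξ)
      (h.trace_covDeriv_eq_zero h_skew h_J h_prim (C.covDeriv_extDeriv_cyclic ξ))
    have h_swap (X Y Z : L) :
        C.covDeriv (C.extDeriv ξ) X Y Z = -C.covDeriv (C.extDeriv ξ) X Z Y := by
      simp only [covDeriv_apply, h_skew _ Z, h_skew Y, map_neg]; ring
    simpa [trace_apply, h_swap _ _ ξ] using h_co
  refine ⟨-2 • C.sharp (C.extDeriv ξ ξ), ?_⟩
  have h_div := C.two_mul_div_sharp_extDeriv ξ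
  rw [h_coclosed] at h_div
  rw [map_zsmul, zsmul_eq_mul]
  push_cast
  linear_combination -h_div

end IsHermitianSurface

end LeviCivitaCalculus

namespace LeviCivitaCalculus

variable {A L : Type*} [CommRing A] [Algebra ℝ A] [AddCommGroup L] [Module A L]
  (C : LeviCivitaCalculus A L)

section WeylCurvature

/-- Eight times the symmetric tensor whose Kulkarni-Nomizu product with the metric is the difference
between the Riemannian curvature and the curvature of the Weyl connection with Lee field `ξ`. -/
def schouten (ξ : L) : L →ₗ[A] L →ₗ[A] A :=
  (4 : A) • C.gradForm ξ + (2 : A) • (C.g ξ).smulRight (C.g ξ) - C.g ξ ξ • C.g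

theorem schouten_apply (ξ X Y : L) : C.schouten ξ X Y
    = 4 * C.gradForm ξ X Y + 2 * (C.g ξ X * C.g ξ Y) - C.g ξ ξ * C.g X Y := rfl

/-- Eight times the curvature of the Weyl connection with Lee field `ξ`, as a bilinear form in its
first and last argument, in which it is to be contracted. -/
def weylCurvature (ξ Y Z : L) : L →ₗ[A] L →ₗ[A] A :=
  (8 : A) • C.curvatureForm Y Z + C.schouten ξ Y Z • C.g
    - ((C.schouten ξ).flip Z).smulRight (C.g Y) + C.g Y Z • C.schouten ξ
    - (C.g Z).smulRight (C.schouten ξ Y)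

theorem weylCurvature_apply (ξ X Y Z W : L) : C.weylCurvature ξ Y Z X W
    = 8 * C.g (C.curvature X Y Z) W + C.schouten ξ Y Z * C.g X W - C.schouten ξ X Z * C.g Y W
      + C.g Y Z * C.schouten ξ X W - C.g Z X * C.schouten ξ Y W := rfl

theorem weylCurvature_pair {ξ : L} (hS : ∀ X Y, C.gradForm ξ X Y = C.gradForm ξ Y X)
    (X Y Z W : L) : C.weylCurvature ξ Y Z X W = C.weylCurvature ξ W X Z Y := by
  have h_symm (X Y : L) : C.schouten ξ X Y = C.schouten ξ Y X := by
    rw [schouten_apply, schouten_apply, hS, C.g_symm X Y]; ring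
  rw [weylCurvature_apply, weylCurvature_apply, C.g_curvature_pair, h_symm W X, h_symm Z X,
    h_symm W Y, h_symm Z Y, C.g_symm Z Y, C.g_symm W X, C.g_symm W Y, C.g_symm Z X]
  ring

end WeylCurvature

namespace IsHermitianSurface

variable {C} {J : L →ₗ[A] L} {ξ : L} (h : C.IsHermitianSurface J ξ)

include h

theorem two_g_covDerivEnd₂ (X Y Z W : L) : 2 * C.g (C.covDerivEnd₂ J X Y Z) W
    = C.gradForm ξ X (J Z) * C.g Y W - C.gradForm ξ X Z * C.g (J Y) W
      - C.g Y (J Z) * C.gradForm ξ X W - C.g Y Z * C.gradForm ξ X (J W)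
      + C.g ξ (C.covDerivEnd J X Z) * C.g Y W - C.g ξ Z * C.g (C.covDerivEnd J X Y) W
      - C.g Y (C.covDerivEnd J X Z) * C.g ξ W + C.g Y Z * C.g (C.covDerivEnd J X ξ) W := by
  have h_der := congrArg (C.der X) (h.two_g_covDerivEnd Y Z W)
  have h_two : C.der X (2 : A) = 0 := by
    rw [← map_ofNat (algebraMap ℝ A) 2, Derivation.map_algebraMap]
  simp only [map_add, map_sub, Derivation.leibniz, smul_eq_mul, C.der_g, h_two, nabla_apply C J,
    LinearMap.add_apply] at h_der
  simp only [covDerivEnd₂, map_sub, LinearMap.sub_apply, gradForm_apply]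
  rw [← neg_eq_iff_eq_neg.2 (h.g_J (C.nabla X ξ) W)]
  linear_combination h_der - h.two_g_covDerivEnd (C.nabla X Y) Z W
    - h.two_g_covDerivEnd Y (C.nabla X Z) W - h.two_g_covDerivEnd Y Z (C.nabla X W)

/-- The Weyl connection preserves `J`. -/
theorem weylCurvature_J (X Y Z W : L) :
    C.weylCurvature ξ Y (J Z) X W = -C.weylCurvature ξ Y Z X (J W) := by
  have h_ricci := congrArg (C.g · W) (C.ricci_identity J X Y Z)
  simp only [map_sub, LinearMap.sub_apply, h.g_J (C.curvature X Y Z)] at h_ricci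
  have s := C.g_symm
  have d₁ := h.two_g_covDerivEnd₂ X Y Z W
  have d₂ := h.two_g_covDerivEnd₂ Y X Z W
  have t₁ := h.two_g_covDerivEnd X Z ξ
  have t₂ := h.two_g_covDerivEnd X Z Y
  have t₃ := h.two_g_covDerivEnd X Y W
  have t₄ := h.two_g_covDerivEnd X ξ W
  have u₁ := h.two_g_covDerivEnd Y Z ξ
  have u₂ := h.two_g_covDerivEnd Y Z X
  have u₃ := h.two_g_covDerivEnd Y X W
  have u₄ := h.two_g_covDerivEnd Y ξ W
  rw [s _ ξ] at t₁ u₁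
  rw [s _ Y] at t₂
  rw [s _ X] at u₂
  have h_skew (X Y : L) : C.g X (J Y) = -C.g Y (J X) := by rw [s, h.g_J]
  have h_zero (X : L) : C.g X (J X) = 0 := eq_zero_of_eq_neg (h_skew X X)
  simp only [h.g_J, h_zero, s X ξ, s Y ξ, s Y X, h_skew X ξ, h_skew Y ξ, h_skew Y X]
    at h_ricci d₁ d₂ t₁ t₂ t₃ t₄ u₁ u₂ u₃ u₄
  simp only [weylCurvature_apply, schouten_apply, s Z X, s (J Z) X]
  linear_combination (-8) * h_ricci + 4 * d₁ - 4 * d₂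
    + 2 * (t₁ * C.g Y W - C.g ξ Z * t₃ - t₂ * C.g ξ W + C.g Y Z * t₄)
    - 2 * (u₁ * C.g X W - C.g ξ Z * u₃ - u₂ * C.g ξ W + C.g X Z * u₄)

theorem trace_weylCurvature (Y Z : L) : C.trace (C.weylCurvature ξ Y Z)
    = 8 * C.ricci Y Z + 2 * C.schouten ξ Y Z + C.trace (C.schouten ξ) * C.g Y Z := by
  have h_sharp : C.g Y (C.sharp ((C.schouten ξ).flip Z)) = C.schouten ξ Y Z := by
    rw [C.g_symm, g_sharp, LinearMap.flip_apply]
  have h_trace : C.trace (C.weylCurvature ξ Y Z)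
      = 8 * C.trace (C.curvatureForm Y Z) + C.schouten ξ Y Z * C.trace C.g
        - C.trace (((C.schouten ξ).flip Z).smulRight (C.g Y)) + C.g Y Z * C.trace (C.schouten ξ)
        - C.trace ((C.g Z).smulRight (C.schouten ξ Y)) := by
    simp only [weylCurvature, trace_apply, LinearMap.add_apply, LinearMap.sub_apply,
      LinearMap.smul_apply, smul_eq_mul, Finset.sum_add_distrib, Finset.sum_sub_distrib,
      Finset.mul_sum]
  rw [h_trace, trace_smulRight, trace_smulRight, h_sharp, sharp_g, h.trace_g, ← ricci_apply]
  ring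

theorem trace_weylCurvature_J (hS : ∀ X Y, C.gradForm ξ X Y = C.gradForm ξ Y X) (Y Z : L) :
    C.trace (C.weylCurvature ξ (J Y) (J Z)) = C.trace (C.weylCurvature ξ Y Z) := by
  have h_JJ (X Y Z W : L) : C.weylCurvature ξ Y (J Z) X (J W) = C.weylCurvature ξ Y Z X W := by
    rw [h.weylCurvature_J, h.J_J, map_neg, neg_neg]
  rw [← h.trace_J_J]
  simp only [trace_apply, LinearMap.compl₂_apply, LinearMap.comp_apply]
  exact Finset.sum_congr rfl fun i _ ↦ by
    rw [h_JJ, C.weylCurvature_pair hS, h_JJ, ← C.weylCurvature_pair hS]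

theorem trace_compl₂_eq_zero {B : L →ₗ[A] L →ₗ[A] A} (hB : ∀ X Y, B (J X) (J Y) = B X Y)
    {S : L →ₗ[A] L} (hS : ∀ X, S (J X) = -J (S X)) : C.trace (B.compl₂ S) = 0 := by
  have h_neg : ((B.compl₂ S) ∘ₗ J).compl₂ J = -B.compl₂ S :=
    LinearMap.ext₂ fun X Y ↦ by simp [hS, hB]
  apply eq_zero_of_eq_neg
  conv_lhs => rw [← h.trace_J_J, h_neg]
  simp only [trace_apply, LinearMap.neg_apply, Finset.sum_neg_distrib]

/-- If `∇ξ` is symmetric, trace free and anticommutes with `J`, then it is orthogonal to the Ricci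
tensor of the Weyl connection, which is `J`-invariant. -/
theorem trace_ricci_grad (hS : ∀ X Y, C.gradForm ξ X Y = C.gradForm ξ Y X)
    (hJ : ∀ X, C.grad ξ (J X) = -J (C.grad ξ X)) (hdiv : C.div ξ = 0) :
    8 * C.trace (C.ricci ∘ₗ C.grad ξ) + 8 * C.inner (C.gradForm ξ) (C.gradForm ξ)
      + 4 * C.gradForm ξ ξ ξ = 0 := by
  set B : L →ₗ[A] L →ₗ[A] A :=
    (8 : A) • C.ricci + (2 : A) • C.schouten ξ + C.trace (C.schouten ξ) • C.g with hB
  have hB_apply (X Y : L) : B X Y = C.trace (C.weylCurvature ξ X Y) :=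
    (h.trace_weylCurvature X Y).symm
  have h_zero : C.trace (B.compl₂ (C.grad ξ)) = 0 :=
    h.trace_compl₂_eq_zero (fun X Y ↦ by simp only [hB_apply, h.trace_weylCurvature_J hS]) hJ
  have h_ricci : C.trace (C.ricci.compl₂ (C.grad ξ)) = C.trace (C.ricci ∘ₗ C.grad ξ) := by
    rw [← trace_flip]
    exact congrArg _ (LinearMap.ext₂ fun X Y ↦ C.ricci_symm _ _)
  have h_g : C.trace (C.g.compl₂ (C.grad ξ)) = 0 := by
    rw [← hdiv, div_apply, ← trace_flip]
    exact congrArg _ (LinearMap.ext₂ fun X Y ↦ C.g_symm _ _)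
  have h_inner : C.trace ((C.gradForm ξ).compl₂ (C.grad ξ))
      = C.inner (C.gradForm ξ) (C.gradForm ξ) := (C.inner_g_comp _ _).symm
  have h_ξξ : C.trace (((C.g ξ).smulRight (C.g ξ)).compl₂ (C.grad ξ)) = C.gradForm ξ ξ ξ := by
    have : ((C.g ξ).smulRight (C.g ξ)).compl₂ (C.grad ξ)
        = (C.g ξ).smulRight (C.g ξ ∘ₗ C.grad ξ) := rfl
    rw [this, trace_smulRight, sharp_g, C.gradForm_apply, C.g_symm]
    rfl
  have h_expand : C.trace (B.compl₂ (C.grad ξ))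
      = 8 * C.trace (C.ricci.compl₂ (C.grad ξ))
        + 2 * (4 * C.trace ((C.gradForm ξ).compl₂ (C.grad ξ))
        + 2 * C.trace (((C.g ξ).smulRight (C.g ξ)).compl₂ (C.grad ξ))
        - C.g ξ ξ * C.trace (C.g.compl₂ (C.grad ξ)))
        + C.trace (C.schouten ξ) * C.trace (C.g.compl₂ (C.grad ξ)) := by
    simp only [hB, schouten, trace_apply _ (LinearMap.compl₂ _ _), LinearMap.compl₂_apply,
      LinearMap.add_apply, LinearMap.sub_apply, LinearMap.smul_apply, smul_eq_mul,
      Finset.sum_add_distrib, Finset.sum_sub_distrib, ← Finset.mul_sum]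
  rw [h_zero, h_ricci, h_g, h_inner, h_ξξ] at h_expand
  linear_combination -h_expand

/-- If `∇ξ` is symmetric, trace free and anticommutes with `J`, then its squared norm is a
divergence, by the contracted second Bianchi identity. -/
theorem exists_div_eq_inner_gradForm (hS : ∀ X Y, C.gradForm ξ X Y = C.gradForm ξ Y X)
    (hJ : ∀ X, C.grad ξ (J X) = -J (C.grad ξ X)) (hdiv : C.div ξ = 0) :
    ∃ X, C.div X = C.inner (C.gradForm ξ) (C.gradForm ξ) := by
  suffices ∃ X, C.div X = 4 * C.inner (C.gradForm ξ) (C.gradForm ξ) by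
    obtain ⟨X, hX⟩ := this
    refine ⟨algebraMap ℝ A (1 / 4) • X, ?_⟩
    rw [div_smul, Derivation.map_algebraMap, add_zero, hX, ← mul_assoc,
      ← map_ofNat (algebraMap ℝ A) 4, ← map_mul]
    norm_num
  have h_einstein := C.div_einstein ξ
  have h_norm := C.div_smul (C.g ξ ξ) ξ
  rw [C.der_g, C.g_symm ξ (C.nabla ξ ξ), hdiv] at h_norm
  rw [hdiv] at h_einstein
  refine ⟨-(2 • (2 • C.sharp (C.ricci ξ) - C.scal • ξ) + C.g ξ ξ • ξ), ?_⟩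
  rw [map_neg, map_add, map_nsmul, h_einstein, h_norm, nsmul_eq_mul, Nat.cast_ofNat]
  refine eq_of_two_mul ?_
  linear_combination -h.trace_ricci_grad hS hJ hdiv + 4 * C.gradForm_apply ξ ξ ξ

end IsHermitianSurface

end LeviCivitaCalculus

/-! ### Hermitian linear algebra in dimension four -/

namespace AlmostHermitian

variable {V : Type*} [NormedAddCommGroup V] [InnerProductSpace ℝ V]
  {P : Type*} [AddCommGroup P] [Module ℝ P]
  {ι κ : Type*} [Fintype ι] [Fintype κ]

theorem sum_dual_eq_sum_orthonormalBasis (B : V →ₗ[ℝ] V →ₗ[ℝ] P) {v v' : κ → V}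
    (b : OrthonormalBasis ι ℝ V) (h : ∀ w, ∑ k, inner ℝ w (v' k) • v k = w) :
    ∑ k, B (v k) (v' k) = ∑ i, B (b i) (b i) :=
  calc ∑ k, B (v k) (v' k) = ∑ k, ∑ i, inner ℝ (b i) (v' k) • B (v k) (b i) :=
        Finset.sum_congr rfl fun k _ ↦ by
          conv_lhs => rw [← b.sum_repr' (v' k)]
          simp only [map_sum, map_smul]
    _ = ∑ i, ∑ k, inner ℝ (b i) (v' k) • B (v k) (b i) := Finset.sum_comm
    _ = ∑ i, B (b i) (b i) := Finset.sum_congr rfl fun i _ ↦ by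
          conv_rhs => enter [1, 2]; rw [← h (b i)]
          simp only [map_sum, map_smul, LinearMap.sum_apply, LinearMap.smul_apply]

theorem sum_orthonormalBasis_eq (B : V →ₗ[ℝ] V →ₗ[ℝ] P) (b : OrthonormalBasis ι ℝ V)
    (c : OrthonormalBasis κ ℝ V) : ∑ i, B (b i) (b i) = ∑ k, B (c k) (c k) :=
  sum_dual_eq_sum_orthonormalBasis B c fun v ↦ by
    simpa only [real_inner_comm] using b.sum_repr' v

theorem sum_mul_dual_eq_sum_orthonormalBasis (β γ : V →ₗ[ℝ] V →ₗ[ℝ] ℝ) {v v' : κ → V}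
    (b : OrthonormalBasis ι ℝ V) (h : ∀ w, ∑ k, inner ℝ w (v' k) • v k = w) :
    ∑ k, ∑ l, β (v k) (v l) * γ (v' k) (v' l) = ∑ i, ∑ j, β (b i) (b j) * γ (b i) (b j) :=
  calc ∑ k, ∑ l, β (v k) (v l) * γ (v' k) (v' l)
      = ∑ k, ∑ j, β (v k) (b j) * γ (v' k) (b j) := Finset.sum_congr rfl fun k _ ↦
        sum_dual_eq_sum_orthonormalBasis ((LinearMap.mul ℝ ℝ).compl₁₂ (β (v k)) (γ (v' k))) b h
    _ = ∑ j, ∑ k, β (v k) (b j) * γ (v' k) (b j) := Finset.sum_comm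
    _ = ∑ j, ∑ i, β (b i) (b j) * γ (b i) (b j) := Finset.sum_congr rfl fun j _ ↦
        sum_dual_eq_sum_orthonormalBasis
          ((LinearMap.mul ℝ ℝ).compl₁₂ (β.flip (b j)) (γ.flip (b j))) b h
    _ = ∑ i, ∑ j, β (b i) (b j) * γ (b i) (b j) := Finset.sum_comm

theorem sum_mul_orthonormalBasis_eq (β γ : V →ₗ[ℝ] V →ₗ[ℝ] ℝ) (b : OrthonormalBasis ι ℝ V)
    (c : OrthonormalBasis κ ℝ V) :
    ∑ i, ∑ j, β (b i) (b j) * γ (b i) (b j) = ∑ k, ∑ l, β (c k) (c l) * γ (c k) (c l) :=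
  sum_mul_dual_eq_sum_orthonormalBasis β γ c fun v ↦ by
    simpa only [real_inner_comm] using b.sum_repr' v

theorem eq_zero_of_sum_mul_self_eq_zero (β : V →ₗ[ℝ] V →ₗ[ℝ] ℝ) (b : OrthonormalBasis ι ℝ V)
    (h : ∑ i, ∑ j, β (b i) (b j) * β (b i) (b j) = 0) : β = 0 := by
  rw [← Fintype.sum_prod_type', Fintype.sum_eq_zero_iff_of_nonneg fun p ↦ mul_self_nonneg _] at h
  refine b.toBasis.ext fun i ↦ b.toBasis.ext fun j ↦ ?_
  simpa using congrFun h (i, j)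

theorem exists_norm_eq_one_of_card_lt_finrank (v : ι → V)
    (hι : Fintype.card ι < Module.finrank ℝ V) : ∃ w : V, ‖w‖ = 1 ∧ ∀ i, inner ℝ (v i) w = 0 := by
  have := Module.finite_of_finrank_pos (Nat.zero_lt_of_lt hι)
  let W := Submodule.span ℝ (Set.range v)
  have hW : Module.finrank ℝ W ≤ Fintype.card ι := finrank_range_le_card v
  have hne : Wᗮ ≠ ⊥ := by
    intro h
    have := W.finrank_add_finrank_orthogonal
    rw [h, finrank_bot] at this
    omega
  obtain ⟨w, hw, hw0⟩ := Submodule.exists_mem_ne_zero_of_ne_bot hne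
  refine ⟨(‖w‖⁻¹ : ℝ) • w, norm_smul_inv_norm (𝕜 := ℝ) hw0, fun i ↦ ?_⟩
  rw [inner_smul_right, hw _ (Submodule.subset_span ⟨i, rfl⟩), mul_zero]

section ComplexStructure

variable {J : V →L[ℝ] V}

theorem inner_J_left (hJ : ∀ v, J (J v) = -v) (hg : ∀ v w, inner ℝ (J v) (J w) = inner ℝ v w)
    (v w : V) : inner ℝ (J v) w = -inner ℝ v (J w) := by
  rw [← hg v (J w), hJ, inner_neg_right, neg_neg]

theorem sum_J_orthonormalBasis_eq (hJ : ∀ v, J (J v) = -v)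
    (hg : ∀ v w, inner ℝ (J v) (J w) = inner ℝ v w) (B : V →ₗ[ℝ] V →ₗ[ℝ] P)
    (b : OrthonormalBasis ι ℝ V) : ∑ i, B (J (b i)) (J (b i)) = ∑ i, B (b i) (b i) := by
  refine sum_dual_eq_sum_orthonormalBasis B b fun w ↦ ?_
  have h : ∑ i, inner ℝ (b i) (J w) • J (b i) = -w := by
    rw [← hJ, ← b.sum_repr' (J w), map_sum]
    simp only [map_smul, b.sum_repr']
  simp only [real_inner_comm _ w, inner_J_left hJ hg, neg_smul, Finset.sum_neg_distrib, h, neg_neg]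

theorem inner_J_self (hJ : ∀ v, J (J v) = -v) (hg : ∀ v w, inner ℝ (J v) (J w) = inner ℝ v w)
    (v : V) : inner ℝ v (J v) = 0 := by
  have h := inner_J_left hJ hg v v
  rw [real_inner_comm] at h
  linarith

theorem exists_unitary_basis (hV : Module.finrank ℝ V = 4) (hJ : ∀ v, J (J v) = -v)
    (hg : ∀ v w, inner ℝ (J v) (J w) = inner ℝ v w) :
    ∃ u : OrthonormalBasis (Fin 4) ℝ V, J (u 0) = u 1 ∧ J (u 2) = u 3 := by
  have norm_J (v : V) : ‖J v‖ = ‖v‖ := by simp only [norm_eq_sqrt_real_inner, hg]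
  obtain ⟨v, hv, -⟩ := exists_norm_eq_one_of_card_lt_finrank (![] : Fin 0 → V) (by simp [hV])
  obtain ⟨w, hw, hvw⟩ := exists_norm_eq_one_of_card_lt_finrank ![v, J v] (by simp [hV])
  have hvw₀ : inner ℝ v w = 0 := hvw 0
  have hvw₁ : inner ℝ (J v) w = 0 := hvw 1
  have hvw₂ : inner ℝ v (J w) = 0 := by rw [← neg_eq_zero, ← inner_J_left hJ hg, hvw₁]
  have ho : Orthonormal ℝ ![v, J v, w, J w] := by
    simp [orthonormal_vecCons_iff, Fin.forall_fin_succ, hv, hw, norm_J, hvw₀, hvw₁, hvw₂, hg,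
      inner_J_self hJ hg]
  refine ⟨OrthonormalBasis.mk ho
    (ho.linearIndependent.span_eq_top_of_card_eq_finrank (by simp [hV])).ge, ?_⟩
  simp

end ComplexStructure

/-- The algebraic properties of the covariant derivative `T` of an orthogonal almost complex
structure `J` at a point: `T x` stands for `∇_x J`. -/
structure IsHermitianDerivative (J : V →L[ℝ] V) (T : V →L[ℝ] V →L[ℝ] V) : Prop where
  J_J (v : V) : J (J v) = -v
  inner_J_J (v w : V) : inner ℝ (J v) (J w) = inner ℝ v w
  skew (x v w : V) : inner ℝ (T x v) w = -inner ℝ v (T x w)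
  anti (x v : V) : T x (J v) = -J (T x v)

/-- The Nijenhuis tensor of an almost complex structure `J` with covariant derivative `T`, for a
torsion-free connection. -/
def nijenhuisOf (J : V →L[ℝ] V) (T : V →L[ℝ] V →L[ℝ] V) : V →ₗ[ℝ] V →ₗ[ℝ] V :=
  LinearMap.mk₂ ℝ (fun v w ↦ T (J v) w - T (J w) v + J (T w v) - J (T v w))
    (fun _ _ _ ↦ by simp only [map_add, add_apply]; abel)
    (fun _ _ _ ↦ by simp only [map_smul, smul_apply]; module)
    (fun _ _ _ ↦ by simp only [map_add, add_apply]; abel)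
    (fun _ _ _ ↦ by simp only [map_smul, smul_apply]; module)

variable {J : V →L[ℝ] V} {T : V →L[ℝ] V →L[ℝ] V}

theorem nijenhuisOf_apply (v w : V) :
    nijenhuisOf J T v w = T (J v) w - T (J w) v + J (T w v) - J (T v w) := rfl

theorem nijenhuisOf_self (v : V) : nijenhuisOf J T v v = 0 := by
  rw [nijenhuisOf_apply]
  abel

theorem nijenhuisOf_swap (v w : V) : nijenhuisOf J T v w = -nijenhuisOf J T w v := by
  simp only [nijenhuisOf_apply]
  abel

/-- A unitary basis `u` of a four-dimensional Hermitian vector space, in which the covariant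
derivative `T` of `J` is given by the two linear forms `a = ⟨T(·) u₀, u₂⟩` and
`b = ⟨T(·) u₀, u₃⟩`. -/
structure IsAdaptedFrame (J : V →L[ℝ] V) (T : V →L[ℝ] V →L[ℝ] V)
    (u : OrthonormalBasis (Fin 4) ℝ V) (a b : V →ₗ[ℝ] ℝ) : Prop where
  J_zero : J (u 0) = u 1
  J_one : J (u 1) = -u 0
  J_two : J (u 2) = u 3
  J_three : J (u 3) = -u 2
  T_zero (x : V) : T x (u 0) = a x • u 2 + b x • u 3
  T_one (x : V) : T x (u 1) = b x • u 2 - a x • u 3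
  T_two (x : V) : T x (u 2) = -(a x • u 0) - b x • u 1
  T_three (x : V) : T x (u 3) = a x • u 1 - b x • u 0

namespace IsHermitianDerivative

variable (h : IsHermitianDerivative J T)
include h

theorem nijenhuisOf_J_right (v w : V) : nijenhuisOf J T v (J w) = -J (nijenhuisOf J T v w) := by
  simp only [nijenhuisOf_apply, h.J_J, h.anti, map_neg, map_sub, map_add, neg_apply]
  abel

theorem nijenhuisOf_J_left (v w : V) : nijenhuisOf J T (J v) w = -J (nijenhuisOf J T v w) := by
  rw [nijenhuisOf_swap, h.nijenhuisOf_J_right, nijenhuisOf_swap v, map_neg]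

theorem inner_T_self (x v : V) : inner ℝ v (T x v) = 0 := by
  have := h.skew x v v
  rw [real_inner_comm] at this
  linarith

theorem inner_J_T_self (x v : V) : inner ℝ (J v) (T x v) = 0 := by
  have h₁ := h.skew x v (J v)
  have h₂ := inner_J_left h.J_J h.inner_J_J v (T x v)
  rw [h.anti, inner_neg_right, neg_neg, real_inner_comm] at h₁
  linarith

theorem exists_isAdaptedFrame (hV : Module.finrank ℝ V = 4) :
    ∃ (u : OrthonormalBasis (Fin 4) ℝ V) (a b : V →ₗ[ℝ] ℝ), IsAdaptedFrame J T u a b := by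
  obtain ⟨u, h01, h23⟩ := exists_unitary_basis hV h.J_J h.inner_J_J
  have h10 : J (u 1) = -u 0 := by rw [← h01, h.J_J]
  have h32 : J (u 3) = -u 2 := by rw [← h23, h.J_J]
  let a : V →ₗ[ℝ] ℝ := innerₛₗ ℝ (u 2) ∘ₗ (T.flip (u 0)).toLinearMap
  let b : V →ₗ[ℝ] ℝ := innerₛₗ ℝ (u 3) ∘ₗ (T.flip (u 0)).toLinearMap
  have inner_two (x : V) : inner ℝ (u 2) (T x (u 0)) = a x := rfl
  have inner_three (x : V) : inner ℝ (u 3) (T x (u 0)) = b x := rfl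
  have T_zero (x : V) : T x (u 0) = a x • u 2 + b x • u 3 := by
    have h1 : inner ℝ (u 1) (T x (u 0)) = 0 := by rw [← h01, h.inner_J_T_self]
    conv_lhs => rw [← u.sum_repr' (T x (u 0)), Fin.sum_univ_four, h.inner_T_self, h1, inner_two,
      inner_three]
    module
  have T_one (x : V) : T x (u 1) = b x • u 2 - a x • u 3 := by
    rw [← h01, h.anti, T_zero, map_add, map_smul, map_smul, h23, h32]
    module
  have T_two (x : V) : T x (u 2) = -(a x • u 0) - b x • u 1 := by
    have h0 : inner ℝ (u 0) (T x (u 2)) = -a x := by rw [real_inner_comm, h.skew, inner_two]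
    have h1 : inner ℝ (u 1) (T x (u 2)) = -b x := by
      rw [real_inner_comm, h.skew, T_one]
      simp [inner_sub_right, inner_smul_right]
    have h3 : inner ℝ (u 3) (T x (u 2)) = 0 := by rw [← h23, h.inner_J_T_self]
    conv_lhs => rw [← u.sum_repr' (T x (u 2)), Fin.sum_univ_four, h.inner_T_self, h0, h1, h3]
    module
  have T_three (x : V) : T x (u 3) = a x • u 1 - b x • u 0 := by
    rw [← h23, h.anti, T_two, map_sub, map_neg, map_smul, map_smul, h01, h10]
    module
  exact ⟨u, a, b, h01, h10, h23, h32, T_zero, T_one, T_two, T_three⟩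

end IsHermitianDerivative

namespace IsAdaptedFrame

variable {u : OrthonormalBasis (Fin 4) ℝ V} {a b : V →ₗ[ℝ] ℝ} (hu : IsAdaptedFrame J T u a b)
include hu

theorem J_sum_T : J (∑ i, T (u i) (u i)) = (b (u 2) - a (u 3)) • u 0 - (a (u 2) + b (u 3)) • u 1
    + (a (u 1) - b (u 0)) • u 2 + (a (u 0) + b (u 1)) • u 3 := by
  simp only [Fin.sum_univ_four, hu.T_zero, hu.T_one, hu.T_two, hu.T_three, map_add, map_sub,
    map_neg, map_smul, hu.J_zero, hu.J_one, hu.J_two, hu.J_three]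
  module

theorem nijenhuisOf_zero_one : nijenhuisOf J T (u 0) (u 1) = 0 := by
  simp only [nijenhuisOf_apply, hu.T_zero, hu.T_one, map_add, map_sub, map_neg, map_smul,
    hu.J_zero, hu.J_one, hu.J_two, hu.J_three, neg_apply]
  module

theorem nijenhuisOf_two_three : nijenhuisOf J T (u 2) (u 3) = 0 := by
  simp only [nijenhuisOf_apply, hu.T_two, hu.T_three, map_sub, map_neg, map_smul,
    hu.J_zero, hu.J_one, hu.J_two, hu.J_three, neg_apply]
  module

theorem nijenhuisOf_zero_two : nijenhuisOf J T (u 0) (u 2)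
    = -(a (u 1) + b (u 0)) • u 0 + (a (u 0) - b (u 1)) • u 1
      - (a (u 3) + b (u 2)) • u 2 + (a (u 2) - b (u 3)) • u 3 := by
  simp only [nijenhuisOf_apply, hu.T_zero, hu.T_two, map_add, map_sub, map_neg, map_smul,
    hu.J_zero, hu.J_one, hu.J_two, hu.J_three]
  module

theorem coeff_of_nijenhuisOf_eq_zero (hN : nijenhuisOf J T (u 0) (u 2) = 0) :
    b (u 0) = -a (u 1) ∧ b (u 1) = a (u 0) ∧ b (u 2) = -a (u 3) ∧ b (u 3) = a (u 2) := by
  have h (k : Fin 4) : inner ℝ (nijenhuisOf J T (u 0) (u 2)) (u k) = 0 := by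
    rw [hN, inner_zero_left]
  simp only [hu.nijenhuisOf_zero_two, inner_add_left, inner_sub_left, real_inner_smul_left,
    u.inner_eq_ite] at h
  have h₀ := h 0
  have h₁ := h 1
  have h₂ := h 2
  have h₃ := h 3
  simp only [Fin.reduceEq, if_true, if_false] at h₀ h₁ h₂ h₃
  refine ⟨?_, ?_, ?_, ?_⟩ <;> linarith

theorem sum_inner_J_T (x y : V) :
    ∑ i, inner ℝ (J (T x (u i))) (T y (u i)) = 4 * (a x * b y - b x * a y) := by
  simp only [Fin.sum_univ_four, hu.T_zero, hu.T_one, hu.T_two, hu.T_three, map_add, map_sub,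
    map_neg, map_smul, hu.J_zero, hu.J_one, hu.J_two, hu.J_three, inner_add_left, inner_add_right,
    inner_sub_left, inner_sub_right, inner_neg_left, inner_neg_right, real_inner_smul_left,
    real_inner_smul_right, u.inner_eq_ite, Fin.reduceEq, if_true, if_false]
  ring

end IsAdaptedFrame

namespace IsHermitianDerivative

variable (h : IsHermitianDerivative J T) {u : OrthonormalBasis (Fin 4) ℝ V} {a b : V →ₗ[ℝ] ℝ}
include h

-- The components `N(u₀, u₂)` and `JN(u₀, u₂)` each occur, up to sign, four times in the frame.
theorem sum_inner_nijenhuisOf (hu : IsAdaptedFrame J T u a b) (v w : V) :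
    ∑ i, ∑ j, inner ℝ (nijenhuisOf J T (u i) (u j)) v * inner ℝ (nijenhuisOf J T (u i) (u j)) w
      = 4 * (inner ℝ (nijenhuisOf J T (u 0) (u 2)) v * inner ℝ (nijenhuisOf J T (u 0) (u 2)) w
        + inner ℝ (J (nijenhuisOf J T (u 0) (u 2))) v
          * inner ℝ (J (nijenhuisOf J T (u 0) (u 2))) w) := by
  have h03 : nijenhuisOf J T (u 0) (u 3) = -J (nijenhuisOf J T (u 0) (u 2)) := by
    rw [← hu.J_two, h.nijenhuisOf_J_right]
  have h12 : nijenhuisOf J T (u 1) (u 2) = -J (nijenhuisOf J T (u 0) (u 2)) := by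
    rw [← hu.J_zero, h.nijenhuisOf_J_left]
  have h13 : nijenhuisOf J T (u 1) (u 3) = -nijenhuisOf J T (u 0) (u 2) := by
    rw [← hu.J_zero, h.nijenhuisOf_J_left, h03, map_neg, h.J_J, neg_neg]
  simp only [Fin.sum_univ_four, nijenhuisOf_self, nijenhuisOf_swap (u 1) (u 0),
    nijenhuisOf_swap (u 2) (u 0), nijenhuisOf_swap (u 2) (u 1), nijenhuisOf_swap (u 3) (u 0),
    nijenhuisOf_swap (u 3) (u 1), nijenhuisOf_swap (u 3) (u 2), hu.nijenhuisOf_zero_one,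
    hu.nijenhuisOf_two_three, h03, h12, h13, inner_neg_left, inner_zero_left, neg_zero]
  ring

variable (hV : Module.finrank ℝ V = 4) (e : OrthonormalBasis ι ℝ V) {ξ : V}
  (hξ : ξ = -J (∑ i, T (e i) (e i)))
include hV hξ

theorem sum_inner_J_T_sub (x y : V) :
    ∑ i, inner ℝ (J (T x (e i))) (T y (e i)) - inner ℝ ξ (T x y - T y x)
      = -(1 / 2) * ((1 / 2) * ∑ i, ∑ j, inner ℝ (nijenhuisOf J T (e i) (e j)) (J x)
          * inner ℝ (nijenhuisOf J T (e i) (e j)) y)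
        - (1 / 2) * inner ℝ (nijenhuisOf J T x y) (J ξ) := by
  obtain ⟨u, a, b, hu⟩ := h.exists_isAdaptedFrame hV
  have trace_T : ∑ i, T (e i) (e i) = ∑ i, T (u i) (u i) :=
    sum_orthonormalBasis_eq T.toLinearMap₁₂ e u
  have trace_TT : ∑ i, inner ℝ (J (T x (e i))) (T y (e i))
      = ∑ i, inner ℝ (J (T x (u i))) (T y (u i)) :=
    sum_orthonormalBasis_eq
      ((innerₗ V).compl₁₂ (J ∘L T x).toLinearMap (T y).toLinearMap) e u
  have trace_NN : ∑ i, ∑ j, inner ℝ (nijenhuisOf J T (e i) (e j)) (J x)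
        * inner ℝ (nijenhuisOf J T (e i) (e j)) y
      = ∑ i, ∑ j, inner ℝ (nijenhuisOf J T (u i) (u j)) (J x)
        * inner ℝ (nijenhuisOf J T (u i) (u j)) y := by
    simpa only [LinearMap.compr₂_apply, innerₗ_apply_apply, real_inner_comm] using
      sum_mul_orthonormalBasis_eq ((nijenhuisOf J T).compr₂ (innerₗ V (J x)))
        ((nijenhuisOf J T).compr₂ (innerₗ V y)) e u
  rw [trace_T, hu.J_sum_T] at hξ
  rw [trace_TT, trace_NN, hu.sum_inner_J_T, h.sum_inner_nijenhuisOf hu, hu.nijenhuisOf_zero_two,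
    nijenhuisOf_apply, hξ, ← u.sum_repr x, ← u.sum_repr y]
  simp only [Fin.sum_univ_four, hu.T_zero, hu.T_one, hu.T_two, hu.T_three, map_add, map_sub,
    map_neg, map_smul, hu.J_zero, hu.J_one, hu.J_two, hu.J_three, inner_add_left,
    inner_add_right, inner_sub_left, inner_sub_right, inner_neg_left, inner_neg_right,
    real_inner_smul_left, real_inner_smul_right, u.inner_eq_ite, Fin.reduceEq, if_true, if_false,
    add_apply, smul_apply, neg_apply]
  ring

/-- A Hermitian surface is locally conformally Kähler to first order. -/
theorem two_inner_T (hN : ∀ v w, nijenhuisOf J T v w = 0) (x y z : V) :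
    2 * inner ℝ (T x y) z = inner ℝ ξ (J y) * inner ℝ x z - inner ℝ ξ y * inner ℝ (J x) z
      - inner ℝ x (J y) * inner ℝ ξ z + inner ℝ x y * inner ℝ (J ξ) z := by
  obtain ⟨u, a, b, hu⟩ := h.exists_isAdaptedFrame hV
  have trace_T : ∑ i, T (e i) (e i) = ∑ i, T (u i) (u i) :=
    sum_orthonormalBasis_eq T.toLinearMap₁₂ e u
  rw [trace_T, hu.J_sum_T] at hξ
  obtain ⟨b0, b1, b2, b3⟩ := hu.coeff_of_nijenhuisOf_eq_zero (hN _ _)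
  rw [hξ, ← u.sum_repr x, ← u.sum_repr y, ← u.sum_repr z]
  simp only [Fin.sum_univ_four, hu.T_zero, hu.T_one, hu.T_two, hu.T_three, map_add, map_sub,
    map_neg, map_smul, hu.J_zero, hu.J_one, hu.J_two, hu.J_three, inner_add_left,
    inner_add_right, inner_sub_left, inner_neg_left, inner_neg_right,
    real_inner_smul_left, real_inner_smul_right, u.inner_eq_ite, Fin.reduceEq, if_true, if_false,
    add_apply, smul_apply, b0, b1, b2, b3]
  ring

end IsHermitianDerivative

end AlmostHermitian

/-! ### Almost Hermitian four-manifolds -/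

namespace AlmostHermitian

variable {E : Type*} [NormedAddCommGroup E] [NormedSpace ℝ E]
  {H : Type*} [TopologicalSpace H] {I : ModelWithCorners ℝ E H}
  {M : Type*} [TopologicalSpace M] [ChartedSpace H M]
  [RiemannianBundle (fun x : M ↦ TangentSpace I x)] [IsManifold I ∞ M]

theorem mlieBracket_eq_leviCivita_sub [FiniteDimensional ℝ E]
    [IsContMDiffRiemannianBundle I ∞ E (fun x : M ↦ TangentSpace I x)] {x : M}
    {X Y : Π x : M, TangentSpace I x} (hX : MDiffAt (T% X) x) (hY : MDiffAt (T% Y) x) :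
    mlieBracket I X Y x = leviCivita I M Y x (X x) - leviCivita I M X x (Y x) := by
  have := FiniteDimensional.complete ℝ E
  have : IsManifold I 2 M := IsManifold.of_le (n := ∞) (by norm_cast)
  exact ((CovariantDerivative.torsion_eq_zero_iff _).1 (leviCivita_torsion I M) hX hY).symm

namespace AlmostHermitianStructure

variable (S : AlmostHermitianStructure I M)

theorem inner_mapField_left (X Y : Π x : M, TangentSpace I x) (x : M) :
    inner ℝ (S.mapField X x) (Y x) = -inner ℝ (X x) (S.mapField Y x) :=
  inner_J_left (S.J_J x) (S.inner_J_J x) _ _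

theorem mapField_mapField (X : Π x : M, TangentSpace I x) :
    S.mapField (S.mapField X) = (-1 : ℝ) • X := by
  ext x
  simp [mapField, S.J_J]

theorem isSmoothField_mapField {X : Π x : M, TangentSpace I x} (hX : IsSmoothField I X) :
    IsSmoothField I (S.mapField X) :=
  fun x ↦ ContMDiffAt.clm_bundle_apply (b := fun y : M ↦ y) (S.contMDiff_J x) (hX x)

variable [FiniteDimensional ℝ E] [IsContMDiffRiemannianBundle I ∞ E (fun x : M ↦ TangentSpace I x)]

theorem isHermitianDerivative (x : M) : IsHermitianDerivative (S.J x) (S.nablaJ x) where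
  J_J := S.J_J x
  inner_J_J := S.inner_J_J x
  skew u v w := by
    have hu := FiberBundle.mdifferentiableAt_extend I E u
    have hv := FiberBundle.mdifferentiableAt_extend I E v
    have hw := FiberBundle.mdifferentiableAt_extend I E w
    have metric_left := leviCivita_metric hu (S.mdifferentiableAt_mapField hv) hw
    have metric_right := leviCivita_metric hu hv (S.mdifferentiableAt_mapField hw)
    have nablaJ_v := S.nablaJ_apply hv u
    have nablaJ_w := S.nablaJ_apply hw u
    simp only [S.inner_mapField_left] at metric_left
    rw [lieDeriv, mvfderiv_fun_neg] at metric_left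
    rw [lieDeriv] at metric_right
    simp only [FiberBundle.extend_apply_self, neg_apply, mapField]
      at metric_left metric_right nablaJ_v nablaJ_w
    rw [nablaJ_v, nablaJ_w, inner_sub_left, inner_sub_right,
      inner_J_left (S.J_J x) (S.inner_J_J x) (leviCivita I M _ x u)]
    rw [inner_J_left (S.J_J x) (S.inner_J_J x) v] at metric_left
    linarith
  anti u v := by
    have hv := FiberBundle.mdifferentiableAt_extend I E v
    have nablaJ_v := S.nablaJ_apply hv u
    have nablaJ_Jv := S.nablaJ_apply (S.mdifferentiableAt_mapField hv) u
    rw [mapField_mapField, (leviCivita I M).isCovariantDerivativeOn.smul_const _ hv] at nablaJ_Jv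
    simp only [FiberBundle.extend_apply_self, mapField, smul_apply] at nablaJ_v nablaJ_Jv
    rw [nablaJ_v, nablaJ_Jv, map_sub, S.J_J]
    module

theorem nijenhuis_eq_nijenhuisOf (x : M) (v w : TangentSpace I x) :
    S.nijenhuis x v w = nijenhuisOf (S.J x) (S.nablaJ x) v w := by
  have hv := FiberBundle.mdifferentiableAt_extend I E v
  have hw := FiberBundle.mdifferentiableAt_extend I E w
  have hJv := S.mdifferentiableAt_mapField hv
  have hJw := S.mdifferentiableAt_mapField hw
  have h_nijenhuis := S.nijenhuis_apply hv hw
  have nablaJ_w_v := S.nablaJ_apply hv w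
  have nablaJ_v_w := S.nablaJ_apply hw v
  have nablaJ_Jw_v := S.nablaJ_apply hv (S.J x w)
  have nablaJ_Jv_w := S.nablaJ_apply hw (S.J x v)
  rw [nijenhuisField, mlieBracket_eq_leviCivita_sub hv hw, mlieBracket_eq_leviCivita_sub hJv hw,
    mlieBracket_eq_leviCivita_sub hv hJw, mlieBracket_eq_leviCivita_sub hJv hJw] at h_nijenhuis
  simp only [FiberBundle.extend_apply_self, mapField]
    at h_nijenhuis nablaJ_w_v nablaJ_v_w nablaJ_Jw_v nablaJ_Jv_w
  rw [h_nijenhuis, nijenhuisOf_apply, nablaJ_w_v, nablaJ_v_w, nablaJ_Jw_v, nablaJ_Jv_w]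
  simp only [map_sub, S.J_J]
  module

theorem lee_apply (x : M) (v : TangentSpace I x) : S.lee x v = inner ℝ (S.leeSharp x) v := by
  simp [leeSharp]

theorem leeSharp_eq (x : M) :
    S.leeSharp x = -S.J x (∑ i, S.nablaJ x (stdOrthonormalBasis ℝ (TangentSpace I x) i)
      (stdOrthonormalBasis ℝ (TangentSpace I x) i)) := by
  refine ext_inner_right ℝ fun v ↦ ?_
  rw [← lee_apply, inner_neg_left, inner_J_left (S.J_J x) (S.inner_J_J x), sum_inner]
  simp [lee, mapOneForm, codiffOmega, nablaOmega]

variable {x : M} {X Y : Π x : M, TangentSpace I x}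

theorem extDerivOneForm_mapOneForm_lee (hX : MDiffAt (T% X) x) (hY : MDiffAt (T% Y) x) :
    extDerivOneForm I (S.mapOneForm S.lee) X Y x
      = -(nablaOneForm I S.lee X (S.mapField Y) x - nablaOneForm I S.lee Y (S.mapField X) x)
        - inner ℝ (S.leeSharp x) (S.nablaJ x (X x) (Y x) - S.nablaJ x (Y x) (X x)) := by
  rw [S.nablaJ_apply hX, S.nablaJ_apply hY, extDerivOneForm, mlieBracket_eq_leviCivita_sub hX hY,
    ← lee_apply]
  simp only [mapOneForm, nablaOneForm, lieDeriv, neg_apply, ContinuousLinearMap.comp_apply,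
    mvfderiv_fun_neg, map_sub, mapField]
  ring

variable (hE : Module.finrank ℝ E = 4)
include hE

theorem four_Phi_add_extDerivOneForm (hX : MDiffAt (T% X) x) (hY : MDiffAt (T% Y) x) :
    4 * S.Phi x (X x) (Y x) + extDerivOneForm I (S.mapOneForm S.lee) X Y x
      = -(nablaOneForm I S.lee X (S.mapField Y) x - nablaOneForm I S.lee Y (S.mapField X) x)
        + (-(1 / 2) * twoFormInner x (S.nijenhuisForm x (S.J x (X x))) (S.nijenhuisForm x (Y x))
          - (1 / 2) * S.nijenhuisForm x (S.J x (S.leeSharp x)) (X x) (Y x)) := by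
  have h := (S.isHermitianDerivative x).sum_inner_J_T_sub hE
    (stdOrthonormalBasis ℝ (TangentSpace I x)) (S.leeSharp_eq x) (X x) (Y x)
  simp only [← nijenhuis_eq_nijenhuisOf] at h
  rw [extDerivOneForm_mapOneForm_lee S hX hY]
  simp only [twoFormInner, nijenhuisForm, Phi]
  rw [← h]
  ring

theorem negFourPhiEq_iff : S.NegFourPhiEq ↔
    ∀ X Y : Π x : M, TangentSpace I x, IsSmoothField I X → IsSmoothField I Y → ∀ x : M,
      nablaOneForm I S.lee X (S.mapField Y) x - nablaOneForm I S.lee Y (S.mapField X) x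
        = -(1 / 2) * twoFormInner x (S.nijenhuisForm x (S.J x (X x))) (S.nijenhuisForm x (Y x))
          - (1 / 2) * S.nijenhuisForm x (S.J x (S.leeSharp x)) (X x) (Y x) := by
  refine forall₅_congr fun X Y hX hY x ↦ ?_
  have h := S.four_Phi_add_extDerivOneForm hE ((hX x).mdifferentiableAt (by simp))
    ((hY x).mdifferentiableAt (by simp))
  constructor <;> intro h' <;> linarith

variable {S} in
theorem IsVaisman.negFourPhiEq (h : S.IsVaisman) : S.NegFourPhiEq := by
  rw [negFourPhiEq_iff S hE]
  intro X Y hX hY x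
  rw [h.2 X _ hX (S.isSmoothField_mapField hY), h.2 Y _ hY (S.isSmoothField_mapField hX)]
  simp [twoFormInner, nijenhuisForm, h.1 x]

end AlmostHermitianStructure

end AlmostHermitian

/-! ### The Levi-Civita calculus of a compact Riemannian manifold -/

namespace AlmostHermitian

section Gram

variable {V : Type*} [NormedAddCommGroup V] [InnerProductSpace ℝ V] [FiniteDimensional ℝ V]
  {ι : Type*} [Fintype ι] [DecidableEq ι]

/-- Cramer's rule for the Gram matrix `G` of `u`: the families `u` and `G⁻¹ u` are dual bases. It is
multiplied with `det G`, so that it also holds if `u` is linearly dependent. -/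
theorem sum_inner_adjugate_gram_smul (hι : Fintype.card ι = Module.finrank ℝ V) (u : ι → V)
    (w : V) :
    ∑ i, inner ℝ w (∑ j, (Matrix.gram ℝ u).adjugate i j • u j) • u i
      = (Matrix.gram ℝ u).det • w := by
  set G := Matrix.gram ℝ u with hG
  set z := ∑ i, inner ℝ w (∑ j, G.adjugate i j • u j) • u i with hz
  have hzu (k : ι) : inner ℝ (z - G.det • w) (u k) = 0 := by
    have hadj (j : ι) : ∑ i, G.adjugate i j * G i k = if k = j then G.det else 0 := by
      have h := congrFun₂ (Matrix.mul_adjugate G) k j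
      rw [Matrix.mul_apply, Matrix.smul_apply, Matrix.one_apply, smul_eq_mul, mul_ite, mul_one,
        mul_zero] at h
      rw [← h]
      refine Finset.sum_congr rfl fun i _ ↦ ?_
      rw [hG, Matrix.gram_apply, Matrix.gram_apply, real_inner_comm, mul_comm]
    have h : inner ℝ z (u k) = ∑ j, inner ℝ w (u j) * ∑ i, G.adjugate i j * G i k := by
      simp only [hz, sum_inner, inner_sum, real_inner_smul_left, real_inner_smul_right,
        Finset.sum_mul, Finset.mul_sum]
      rw [Finset.sum_comm]
      refine Finset.sum_congr rfl fun j _ ↦ Finset.sum_congr rfl fun i _ ↦ ?_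
      rw [hG, Matrix.gram_apply]
      ring
    simp [h, hadj, inner_sub_left, real_inner_smul_left, mul_comm]
  have hzspan : z ∈ Submodule.span ℝ (Set.range u) :=
    Submodule.sum_mem _ fun i _ ↦ Submodule.smul_mem _ _ (Submodule.subset_span ⟨i, rfl⟩)
  have hmem : z - G.det • w ∈ Submodule.span ℝ (Set.range u) := by
    by_cases hdet : G.det = 0
    · simpa [hdet] using hzspan
    · rw [(Matrix.linearIndependent_of_det_gram_ne_zero hdet).span_eq_top_of_card_eq_finrank' hι]
      exact Submodule.mem_top
  rw [← sub_eq_zero, ← inner_self_eq_zero (𝕜 := ℝ)]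
  have hle : Submodule.span ℝ (Set.range u) ≤ LinearMap.ker (innerₛₗ ℝ (z - G.det • w)) :=
    Submodule.span_le.2 (by rintro _ ⟨k, rfl⟩; exact hzu k)
  exact hle hmem

end Gram

variable {E : Type*} [NormedAddCommGroup E] [NormedSpace ℝ E]
  {H : Type*} [TopologicalSpace H] {I : ModelWithCorners ℝ E H}
  {M : Type*} [TopologicalSpace M] [ChartedSpace H M] [IsManifold I ∞ M]

namespace IsSmoothField

variable {X Y : Π x : M, TangentSpace I x} {f : M → ℝ}

theorem mdifferentiableAt (hX : IsSmoothField I X) (x : M) : MDiffAt (T% X) x :=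
  (hX x).mdifferentiableAt (by simp)

theorem smul (hf : CMDiff ∞ f) (hX : IsSmoothField I X) : IsSmoothField I (f • X) :=
  ContMDiff.smul_section hf hX

theorem sum {ι : Type*} {s : Finset ι} {X : ι → Π x : M, TangentSpace I x}
    (hX : ∀ i ∈ s, IsSmoothField I (X i)) : IsSmoothField I (fun x ↦ ∑ i ∈ s, X i x) :=
  ContMDiff.sum_section hX

theorem contMDiff_lieDeriv (hX : IsSmoothField I X) (hf : CMDiff ∞ f) :
    CMDiff ∞ (lieDeriv I X f) :=
  (contMDiff_snd_tangentBundle_modelSpace ℝ 𝓘(ℝ, ℝ) (n := ∞)).comp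
    ((hf.contMDiff_tangentMap (by simp)).comp hX)

theorem contMDiff_inner [RiemannianBundle (fun x : M ↦ TangentSpace I x)]
    [IsContMDiffRiemannianBundle I ∞ E (fun x : M ↦ TangentSpace I x)]
    (hX : IsSmoothField I X) (hY : IsSmoothField I Y) :
    CMDiff ∞ (fun x ↦ (inner ℝ (X x) (Y x) : ℝ)) :=
  ContMDiff.inner_bundle hX hY

theorem mlieBracket [CompleteSpace E] (hX : IsSmoothField I X) (hY : IsSmoothField I Y) :
    IsSmoothField I (mlieBracket I X Y) := by
  have : IsManifold I ((⊤ : ℕ∞) + 1) M := by simpa using ‹IsManifold I ∞ M›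
  have : IsManifold I (minSmoothness ℝ 2) M := IsManifold.of_le (n := ∞) (by simp; norm_cast)
  exact ContDiff.mlieBracket_vectorField (m := ⊤) (n := ⊤) hX hY (by simp)

end IsSmoothField

theorem exists_isSmoothField_apply_eq [FiniteDimensional ℝ E] [T2Space M] [SigmaCompactSpace M]
    (x : M) (v : TangentSpace I x) :
    ∃ X : Π x : M, TangentSpace I x, IsSmoothField I X ∧ X x = v := by
  classical
  obtain ⟨s, hs⟩ := exists_contMDiffSection_forall_mem_convex_of_local (n := ⊤) I
    (F_fiber := E) (fun x : M ↦ TangentSpace I x) (fun y ↦ {w | ∀ h : x = y, w = h ▸ v})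
    (fun y ↦ by
      by_cases h : x = y
      · subst h
        simp
      · simpa [h] using convex_univ) fun y ↦ by
    by_cases h : x = y
    · subst h
      obtain ⟨U, hU, hs⟩ := FiberBundle.exists_contMDiffOn_extend (k := ∞) I E v
      refine ⟨U, hU, _, hs, fun y hy h ↦ ?_⟩
      subst h
      simp
    · refine ⟨{x}ᶜ, isOpen_compl_singleton.mem_nhds (Ne.symm h), 0, ?_, fun y hy h' ↦
        absurd h'.symm hy⟩
      exact (ContMDiff.contMDiffOn (s := {x}ᶜ)
        (0 : Cₛ^∞⟮I; E, (fun x : M ↦ TangentSpace I x)⟯).contMDiff)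
  exact ⟨s, s.contMDiff, hs x rfl⟩

variable (I M) in
/-- The smooth vector fields on `M`. -/
abbrev SmoothField := Cₛ^∞⟮I; E, (fun x : M ↦ TangentSpace I x)⟯

variable (I M) in
/-- The smooth functions on `M`. -/
abbrev SmoothFunction := C^∞⟮I, M; 𝓘(ℝ), ℝ⟯

omit [IsManifold I ∞ M] in
theorem SmoothFunction.sum_apply {κ : Type*} (s : Finset κ) (f : κ → SmoothFunction I M) (x : M) :
    (∑ i ∈ s, f i) x = ∑ i ∈ s, f i x :=
  map_sum (ContMDiffMap.evalRingHom x) f s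

namespace SmoothField

theorem isSmoothField (X : SmoothField I M) : IsSmoothField I X := X.contMDiff

instance : SMul (SmoothFunction I M) (SmoothField I M) where
  smul f X := ⟨fun x ↦ f x • X x, IsSmoothField.smul f.contMDiff X.isSmoothField⟩

@[simp]
theorem smul_apply (f : SmoothFunction I M) (X : SmoothField I M) (x : M) :
    (f • X) x = f x • X x := rfl

@[simp]
theorem add_apply (X Y : SmoothField I M) (x : M) : (X + Y) x = X x + Y x := rfl

@[simp]
theorem neg_apply (X : SmoothField I M) (x : M) : (-X) x = - X x := rfl

instance : Module (SmoothFunction I M) (SmoothField I M) where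
  one_smul X := by ext x; simp
  mul_smul f g X := by ext x; simp [mul_smul]
  smul_zero f := by ext x; simp
  smul_add f X Y := by ext x; simp
  add_smul f g X := by ext x; simp [add_smul]
  zero_smul X := by ext x; simp

@[simp]
theorem sum_apply {κ : Type*} (s : Finset κ) (X : κ → SmoothField I M) (x : M) :
    (∑ i ∈ s, X i) x = ∑ i ∈ s, X i x :=
  (congrFun (map_sum (ContMDiffSection.coeAddHom I E ∞ (fun x : M ↦ TangentSpace I x)) X s) x).trans
    (Finset.sum_apply _ _ _)

theorem exists_apply_eq [FiniteDimensional ℝ E] [T2Space M] [SigmaCompactSpace M]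
    (x : M) (v : TangentSpace I x) : ∃ X : SmoothField I M, X x = v :=
  let ⟨X, hX, h⟩ := exists_isSmoothField_apply_eq x v
  ⟨⟨X, hX⟩, h⟩

/-- The directional derivatives of smooth functions along smooth vector fields. -/
def der : SmoothField I M →ₗ[SmoothFunction I M] Derivation ℝ (SmoothFunction I M)
    (SmoothFunction I M) where
  toFun X := Derivation.mk'
    { toFun f := ⟨_, X.isSmoothField.contMDiff_lieDeriv f.contMDiff⟩
      map_add' f f' := by
        ext x
        exact congrArg (fun L ↦ L (X x)) (mvfderiv_add (f.contMDiff.mdifferentiable (by simp) x)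
          (f'.contMDiff.mdifferentiable (by simp) x))
      map_smul' c f := by
        ext x
        have h := congrArg (fun L ↦ L (X x)) (mvfderiv_mul (f := fun _ : M ↦ c)
          mdifferentiableAt_const (f.contMDiff.mdifferentiable (by simp) x))
        rw [mvfderiv_const, smul_zero, add_zero] at h
        exact h }
    fun f f' ↦ by
      ext x
      exact congrArg (fun L ↦ L (X x)) (mvfderiv_mul (f.contMDiff.mdifferentiable (by simp) x)
        (f'.contMDiff.mdifferentiable (by simp) x))
  map_add' X X' := by
    ext f x
    exact map_add (mvfderiv I f x) _ _
  map_smul' a X := by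
    ext f x
    exact map_smul (mvfderiv I f x) _ _

/-- The Lie bracket of smooth vector fields. -/
def bracket [CompleteSpace E] (X Y : SmoothField I M) : SmoothField I M :=
  ⟨_, X.isSmoothField.mlieBracket Y.isSmoothField⟩

section Bracket

variable [CompleteSpace E]

theorem bracket_add (X Y Z : SmoothField I M) : bracket X (Y + Z) = bracket X Y + bracket X Z := by
  ext x
  exact mlieBracket_add_right (Y.isSmoothField.mdifferentiableAt x)
    (Z.isSmoothField.mdifferentiableAt x)

theorem bracket_smul (X Y : SmoothField I M) (f : SmoothFunction I M) :
    bracket X (f • Y) = der X f • Y + f • bracket X Y := by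
  ext x
  exact mlieBracket_smul_right (f.contMDiff.mdifferentiable (by simp) x)
    (Y.isSmoothField.mdifferentiableAt x)

theorem bracket_jacobi (X Y Z : SmoothField I M) :
    bracket X (bracket Y Z) = bracket (bracket X Y) Z + bracket Y (bracket X Z) := by
  have : IsManifold I (minSmoothness ℝ 3) M := IsManifold.of_le (n := ∞) (by simp; norm_cast)
  have hle : minSmoothness ℝ 2 ≤ ∞ := by simp; norm_cast
  ext x
  exact congrFun (leibniz_identity_mlieBracket (X.isSmoothField.of_le hle)
    (Y.isSmoothField.of_le hle) (Z.isSmoothField.of_le hle)) x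

/-- The Jacobi identity for `X`, `Y` and `f • Z`. -/
theorem der_bracket_smul (X Y Z : SmoothField I M) (f : SmoothFunction I M) :
    der (bracket X Y) f • Z = (der X (der Y f) - der Y (der X f)) • Z := by
  have h := bracket_jacobi X Y (f • Z)
  simp only [bracket_smul, bracket_add, bracket_jacobi X Y Z] at h
  rw [← sub_eq_zero] at h ⊢
  rw [← neg_eq_zero, ← h]
  module

theorem der_bracket [FiniteDimensional ℝ E] [T2Space M] [SigmaCompactSpace M]
    (X Y : SmoothField I M) (f : SmoothFunction I M) :
    der (bracket X Y) f = der X (der Y f) - der Y (der X f) := by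
  ext x
  rcases subsingleton_or_nontrivial E with hE | hE
  · have h0 (Z : SmoothField I M) (f : SmoothFunction I M) : der Z f x = 0 := by
      have hZ : Z x = 0 := Subsingleton.elim (α := E) _ _
      exact (congrArg (mvfderiv I f x) hZ).trans (map_zero _)
    simp [h0]
  · obtain ⟨v, hv⟩ := exists_ne (0 : E)
    obtain ⟨Z, hZ⟩ := exists_apply_eq (I := I) x v
    have h := congrArg (fun W : SmoothField I M ↦ W x) (der_bracket_smul X Y Z f)
    simp only [smul_apply, hZ] at h
    exact smul_left_injective ℝ hv h

end Bracket

variable [RiemannianBundle (fun x : M ↦ TangentSpace I x)]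
  [IsContMDiffRiemannianBundle I ∞ E (fun x : M ↦ TangentSpace I x)]

variable (I M) in
/-- The Riemannian metric on smooth vector fields. -/
def metric : SmoothField I M →ₗ[SmoothFunction I M] SmoothField I M →ₗ[SmoothFunction I M]
    SmoothFunction I M :=
  LinearMap.mk₂ _ (fun X Y ↦ ⟨_, X.isSmoothField.contMDiff_inner Y.isSmoothField⟩)
    (fun X X' Y ↦ by ext x; exact inner_add_left (𝕜 := ℝ) (X x) (X' x) (Y x))
    (fun f X Y ↦ by ext x; exact real_inner_smul_left (X x) (Y x) (f x))
    (fun X Y Y' ↦ by ext x; exact inner_add_right (𝕜 := ℝ) (X x) (Y x) (Y' x))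
    (fun f X Y ↦ by ext x; exact real_inner_smul_right (X x) (Y x) (f x))

section Gram

variable {κ : Type*} [Fintype κ] [DecidableEq κ] (X : κ → SmoothField I M) (x : M)

/-- The matrix of the inner products of a family of smooth vector fields. -/
def gram : Matrix κ κ (SmoothFunction I M) :=
  Matrix.of fun i j ↦ metric I M (X i) (X j)

theorem mapMatrix_gram :
    (ContMDiffMap.evalRingHom x).mapMatrix (gram X) = Matrix.gram ℝ (fun i ↦ X i x) := rfl

theorem det_gram_apply : (gram X).det x = (Matrix.gram ℝ fun i ↦ X i x).det :=
  RingHom.map_det (ContMDiffMap.evalRingHom x) (gram X)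

theorem adjugate_gram_apply (i j : κ) :
    (gram X).adjugate i j x = (Matrix.gram ℝ fun i ↦ X i x).adjugate i j := by
  rw [← mapMatrix_gram, ← RingHom.map_adjugate]
  rfl

theorem det_gram_nonneg : 0 ≤ (gram X).det x := by
  rw [det_gram_apply]
  exact (Matrix.posSemidef_gram ℝ _).det_nonneg

variable [FiniteDimensional ℝ E]

/-- The family of vector fields which is dual to `X`, multiplied with the determinant of the Gram
matrix of `X` in order to be defined everywhere. -/
def gramDual (i : κ) : SmoothField I M :=
  ∑ j, (gram X).adjugate i j • X j

theorem sum_inner_gramDual_smul (hκ : Fintype.card κ = Module.finrank ℝ E)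
    (v : TangentSpace I x) :
    ∑ i, inner ℝ v (gramDual X i x) • X i x = (gram X).det x • v := by
  simp only [gramDual, sum_apply, smul_apply, adjugate_gram_apply, det_gram_apply]
  exact sum_inner_adjugate_gram_smul hκ _ v

omit [DecidableEq κ]
  [IsContMDiffRiemannianBundle I ∞ E (fun x : M ↦ TangentSpace I x)] in
theorem exists_orthonormal_apply [T2Space M] [SigmaCompactSpace M]
    (hκ : Fintype.card κ = Module.finrank ℝ E) :
    ∃ X : κ → SmoothField I M, Orthonormal ℝ fun i ↦ X i x := by
  let b := (stdOrthonormalBasis ℝ (TangentSpace I x)).reindex (Fintype.equivFinOfCardEq hκ).symm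
  choose X hX using fun i ↦ exists_apply_eq (I := I) x (b i)
  exact ⟨X, by simpa only [hX] using b.orthonormal⟩

theorem exists_det_gram_pos [T2Space M] [SigmaCompactSpace M]
    (hκ : Fintype.card κ = Module.finrank ℝ E) :
    ∃ X : κ → SmoothField I M, 0 < (gram X).det x := by
  obtain ⟨X, hX⟩ := exists_orthonormal_apply (I := I) x hκ
  exact ⟨X, by simp [det_gram_apply, Matrix.gram_eq_one_iff_orthonormal.2 hX]⟩

end Gram

end SmoothField

variable [RiemannianBundle (fun x : M ↦ TangentSpace I x)]

variable (I M) in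
/-- Finite families of globally defined smooth vector fields `e`, `e'` which are dual to each other
in the sense that `∑ᵢ ⟨v, e'ᵢ⟩ eᵢ = v`. -/
structure DualFrame where
  /-- the index type -/
  ι : Type
  [fintype_ι : Fintype ι]
  /-- the frame -/
  e : ι → SmoothField I M
  /-- the dual frame -/
  e' : ι → SmoothField I M
  sum_frame (x : M) (v : TangentSpace I x) : ∑ i, (inner ℝ v (e' i x) : ℝ) • e i x = v

attribute [instance] DualFrame.fintype_ι

variable [FiniteDimensional ℝ E] [IsContMDiffRiemannianBundle I ∞ E (fun x : M ↦ TangentSpace I x)]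

theorem SmoothField.exists_finite_sum_det_gram_pos [CompactSpace M] [T2Space M] :
    ∃ (m : ℕ) (X : Fin m → Fin (Module.finrank ℝ E) → SmoothField I M),
      ∀ x, 0 < (∑ k, (gram (X k)).det) x := by
  choose X hX using fun x : M ↦ exists_det_gram_pos (I := I) x (Fintype.card_fin _)
  have hnhds (x : M) : {y | 0 < (gram (X x)).det y} ∈ nhds x :=
    (isOpen_lt continuous_const (gram (X x)).det.contMDiff.continuous).mem_nhds (hX x)
  obtain ⟨t, -, ht⟩ := isCompact_univ.elim_nhds_subcover _ fun x _ ↦ hnhds x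
  refine ⟨t.card, fun k ↦ X (t.equivFin.symm k), fun y ↦ ?_⟩
  obtain ⟨x, hx, hy⟩ := Set.mem_iUnion₂.1 (ht (Set.mem_univ y))
  rw [SmoothFunction.sum_apply]
  exact Finset.sum_pos' (fun k _ ↦ det_gram_nonneg _ y)
    ⟨t.equivFin ⟨x, hx⟩, Finset.mem_univ _, by simpa using hy⟩

variable (I M) in
theorem nonempty_dualFrame [CompactSpace M] [T2Space M] : Nonempty (DualFrame I M) := by
  obtain ⟨m, X, hX⟩ := SmoothField.exists_finite_sum_det_gram_pos (I := I) (M := M)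
  let ψ : SmoothFunction I M := ⟨_, (∑ k, (SmoothField.gram (X k)).det).contMDiff.inv₀
    fun x ↦ (hX x).ne'⟩
  refine ⟨⟨Fin m × Fin (Module.finrank ℝ E), fun p ↦ X p.1 p.2,
    fun p ↦ ψ • SmoothField.gramDual (X p.1) p.2, fun x v ↦ ?_⟩⟩
  have hψ : ψ x * ∑ k, (SmoothField.gram (X k)).det x = 1 := by
    rw [← SmoothFunction.sum_apply]
    exact inv_mul_cancel₀ (hX x).ne'
  calc ∑ p : Fin m × Fin (Module.finrank ℝ E),
        inner ℝ v ((ψ • SmoothField.gramDual (X p.1) p.2) x) • X p.1 p.2 x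
      = ∑ k, ψ x • ∑ i, inner ℝ v (SmoothField.gramDual (X k) i x) • X k i x := by
        simp only [Fintype.sum_prod_type, SmoothField.smul_apply, real_inner_smul_right, mul_smul,
          Finset.smul_sum]
    _ = (ψ x * ∑ k, (SmoothField.gram (X k)).det x) • v := by
        simp only [SmoothField.sum_inner_gramDual_smul _ x (Fintype.card_fin _), Finset.mul_sum,
          Finset.sum_smul, mul_smul]
    _ = v := by rw [hψ, one_smul]

variable {X Y Z : Π x : M, TangentSpace I x}

theorem IsSmoothField.contMDiff_koszul (hX : IsSmoothField I X) (hY : IsSmoothField I Y)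
    (hZ : IsSmoothField I Z) : CMDiff ∞ (koszul I X Y Z) := by
  have := FiniteDimensional.complete ℝ E
  have h := (((((hX.contMDiff_lieDeriv (hY.contMDiff_inner hZ)).add
    (hY.contMDiff_lieDeriv (hX.contMDiff_inner hZ))).sub
    (hZ.contMDiff_lieDeriv (hX.contMDiff_inner hY))).add
    ((hX.mlieBracket hY).contMDiff_inner hZ)).sub
    ((hX.mlieBracket hZ).contMDiff_inner hY)).sub ((hY.mlieBracket hZ).contMDiff_inner hX)
  exact contMDiff_const.mul h

theorem DualFrame.isSmoothField_leviCivita (F : DualFrame I M) (hX : IsSmoothField I X)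
    (hY : IsSmoothField I Y) : IsSmoothField I (fun x ↦ leviCivita I M Y x (X x)) := by
  have h : (fun x ↦ leviCivita I M Y x (X x))
      = fun x ↦ ∑ i, (koszul I X Y (F.e' i) • ⇑(F.e i)) x := by
    ext x
    rw [← F.sum_frame x (leviCivita I M Y x (X x))]
    refine Finset.sum_congr rfl fun i _ ↦ ?_
    rw [inner_leviCivita (hX.mdifferentiableAt x) (hY.mdifferentiableAt x)
      ((F.e' i).isSmoothField.mdifferentiableAt x)]
    rfl
  rw [h]
  exact IsSmoothField.sum fun i _ ↦
    IsSmoothField.smul (hX.contMDiff_koszul hY (F.e' i).isSmoothField) (F.e i).isSmoothField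

namespace DualFrame

variable (F : DualFrame I M)

/-- The Levi-Civita connection on smooth vector fields. -/
def nabla : SmoothField I M →ₗ[SmoothFunction I M] SmoothField I M →+ SmoothField I M where
  toFun X :=
    { toFun Y := ⟨_, F.isSmoothField_leviCivita X.isSmoothField Y.isSmoothField⟩
      map_zero' := by
        ext x
        exact congrArg (fun L ↦ L x (X x)) (leviCivita I M).zero
      map_add' Y Y' := by
        ext x
        exact congrArg (fun L ↦ L (X x)) ((leviCivita I M).isCovariantDerivativeOn.add
          (Y.isSmoothField.mdifferentiableAt x) (Y'.isSmoothField.mdifferentiableAt x)) }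
  map_add' X X' := by
    ext Y x
    exact map_add (leviCivita I M Y x) _ _
  map_smul' a X := by
    ext Y x
    exact map_smul (leviCivita I M Y x) _ _

theorem nabla_sub_nabla [CompleteSpace E] (X Y : SmoothField I M) :
    F.nabla X Y - F.nabla Y X = SmoothField.bracket X Y := by
  ext x
  exact (mlieBracket_eq_leviCivita_sub (X.isSmoothField.mdifferentiableAt x)
    (Y.isSmoothField.mdifferentiableAt x)).symm

variable [T2Space M] [SigmaCompactSpace M]

/-- The Levi-Civita calculus on the smooth vector fields of a Riemannian manifold with a global dual
frame. -/
def calculus : LeviCivitaCalculus (SmoothFunction I M) (SmoothField I M) where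
  g := SmoothField.metric I M
  der := SmoothField.der
  nabla := F.nabla
  g_symm X Y := by ext x; exact real_inner_comm (Y x) (X x)
  nabla_smul X Y f := by
    ext x
    exact congrArg (fun L ↦ L (X x)) ((leviCivita I M).isCovariantDerivativeOn.leibniz
      (Y.isSmoothField.mdifferentiableAt x) (f.contMDiff.mdifferentiable (by simp) x))
  der_g Z X Y := by
    ext x
    exact leviCivita_metric (Z.isSmoothField.mdifferentiableAt x)
      (X.isSmoothField.mdifferentiableAt x) (Y.isSmoothField.mdifferentiableAt x)
  der_bracket X Y f := by
    have := FiniteDimensional.complete ℝ E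
    rw [nabla_sub_nabla]
    exact SmoothField.der_bracket X Y f
  jacobi X Y Z := by
    have := FiniteDimensional.complete ℝ E
    simp only [nabla_sub_nabla]
    exact SmoothField.bracket_jacobi X Y Z
  ι := F.ι
  e := F.e
  e' := F.e'
  sum_frame X := by
    ext x
    simp only [SmoothField.sum_apply]
    exact F.sum_frame x (X x)

end DualFrame

end AlmostHermitian

/-! ### The divergence theorem -/

namespace AlmostHermitian

section Jacobi

variable {n : Type*} [Fintype n] [DecidableEq n]

/-- Jacobi's formula. -/
theorem hasFDerivWithinAt_det {F : Type*} [NormedAddCommGroup F] [NormedSpace ℝ F]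
    {A : F → Matrix n n ℝ} {A' : n → n → F →L[ℝ] ℝ} {s : Set F} {y : F}
    (hA : ∀ i j, HasFDerivWithinAt (fun z ↦ A z i j) (A' i j) s y) :
    HasFDerivWithinAt (fun z ↦ (A z).det) (∑ i, ∑ j, (A y).adjugate j i • A' i j) s y := by
  let D : ContinuousMultilinearMap ℝ (fun _ : n ↦ n → ℝ) ℝ :=
    ⟨Matrix.detRowAlternating.toMultilinearMap, continuous_id.matrix_det⟩
  convert! HasFDerivWithinAt.multilinear_comp (f := D) fun i ↦ hasFDerivWithinAt_pi.2 (hA i)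
    using 1
  ext v
  simp only [sum_apply, ContinuousLinearMap.comp_apply]
  refine Finset.sum_congr rfl fun i _ ↦ ?_
  have hcramer : D.toContinuousLinearMap (A y) i (fun j ↦ A' i j v)
      = (A y).transpose.cramer (fun j ↦ A' i j v) i :=
    (Matrix.cramer_transpose_apply _ _ _).symm
  refine Eq.trans ?_ hcramer.symm
  rw [Matrix.cramer_eq_adjugate_mulVec, Matrix.mulVec, dotProduct, ← Matrix.adjugate_transpose]
  rfl

variable {E : Type*} [NormedAddCommGroup E] [NormedSpace ℝ E]
  {H : Type*} [TopologicalSpace H] {I : ModelWithCorners ℝ E H}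
  {M : Type*} [TopologicalSpace M] [ChartedSpace H M] {x : M} {A : M → Matrix n n ℝ}

theorem hasMFDerivAt_det (hA : ∀ i j, MDiffAt (fun y ↦ A y i j) x) :
    HasMFDerivAt I 𝓘(ℝ, ℝ) (fun y ↦ (A y).det) x
      (∑ i, ∑ j, (A x).adjugate j i • mvfderiv I (fun y ↦ A y i j) x : E →L[ℝ] ℝ) := by
  have hx := extChartAt_to_inv (I := I) x
  have hdet : Continuous (Matrix.det : Matrix n n ℝ → ℝ) := continuous_id.matrix_det
  refine ⟨hdet.continuousAt.comp (continuousAt_pi.2 fun i ↦ continuousAt_pi.2 fun j ↦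
    (hA i j).continuousAt), ?_⟩
  have h := hasFDerivWithinAt_det (A := fun z ↦ A ((extChartAt I x).symm z))
    fun i j ↦ (hA i j).hasMFDerivAt.2
  simp only [hx] at h
  exact h

theorem mvfderiv_det (hA : ∀ i j, MDiffAt (fun y ↦ A y i j) x) (v : TangentSpace I x) :
    mvfderiv I (fun y ↦ (A y).det) x v
      = ((A x).adjugate * Matrix.of fun i j ↦ mvfderiv I (fun y ↦ A y i j) x v).trace := by
  have h : mvfderiv I (fun y ↦ (A y).det) x
    = ∑ i, ∑ j, (A x).adjugate j i • mvfderiv I (fun y ↦ A y i j) x := (hasMFDerivAt_det hA).mfderiv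
  simp only [h, Matrix.trace, Matrix.diag, Matrix.mul_apply, sum_apply, smul_apply]
  exact Finset.sum_comm

end Jacobi

section CovariantDerivative

variable {E : Type*} [NormedAddCommGroup E] [NormedSpace ℝ E]
  {H : Type*} [TopologicalSpace H] {I : ModelWithCorners ℝ E H}
  {M : Type*} [TopologicalSpace M] [ChartedSpace H M]
  {F : Type*} [NormedAddCommGroup F] [NormedSpace ℝ F]
  {V : M → Type*} [TopologicalSpace (TotalSpace F V)] [∀ x, AddCommGroup (V x)]
  [∀ x, Module ℝ (V x)] [∀ x, TopologicalSpace (V x)] [∀ x, IsTopologicalAddGroup (V x)]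
  [∀ x, ContinuousSMul ℝ (V x)] [FiberBundle F V] [VectorBundle ℝ F V]

theorem covariantDerivative_sum_smul (cov : CovariantDerivative I F V) {κ : Type*} {x : M}
    (s : Finset κ) {f : κ → M → ℝ} {σ : κ → Π x : M, V x} (hf : ∀ k ∈ s, MDiffAt (f k) x)
    (hσ : ∀ k ∈ s, MDiffAt (T% (σ k)) x) (v : TangentSpace I x) :
    cov (fun y ↦ ∑ k ∈ s, f k y • σ k y) x v
      = ∑ k ∈ s, (f k x • cov (σ k) x v + mvfderiv I (f k) x v • σ k x) := by
  classical
  induction s using Finset.induction_on with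
  | empty => exact congrArg (fun L ↦ L x v) cov.zero
  | insert a s ha ih =>
    rw [Finset.forall_mem_insert] at hf hσ
    have hadd := cov.isCovariantDerivativeOn.add (hf.1.smul_section hσ.1)
      (MDifferentiableAt.sum_section fun k hk ↦ (hf.2 k hk).smul_section (hσ.2 k hk))
    simp only [Finset.sum_insert ha, ← ih hf.2 hσ.2]
    refine (congrArg (fun L ↦ L v) hadd).trans ?_
    rw [cov.isCovariantDerivativeOn.leibniz hσ.1 hf.1]
    rfl

end CovariantDerivative

end AlmostHermitian

namespace AlmostHermitian

section VectorSpace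

variable {E : Type*} [NormedAddCommGroup E] [NormedSpace ℝ E]

/-- A constant vector field on a vector space. -/
def constField (v : E) (y : E) : TangentSpace 𝓘(ℝ, E) y := v

theorem mdifferentiableAt_constField (v y : E) : MDiffAt (T% (constField v)) y :=
  (contMDiff_vectorSpace_iff_contDiff (n := 1).2 contDiff_const y).mdifferentiableAt (by simp)

theorem mlieBracket_constField (v w y : E) :
    mlieBracket 𝓘(ℝ, E) (constField v) (constField w) y = 0 := by
  rw [← mlieBracketWithin_univ, mlieBracketWithin_eq_lieBracketWithin]
  change fderivWithin ℝ (fun _ ↦ w) Set.univ y v - fderivWithin ℝ (fun _ ↦ v) Set.univ y w = 0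
  simp

end VectorSpace

variable {E : Type*} [NormedAddCommGroup E] [NormedSpace ℝ E] [FiniteDimensional ℝ E]
  {H : Type*} [TopologicalSpace H] {I : ModelWithCorners ℝ E H}
  {M : Type*} [TopologicalSpace M] [ChartedSpace H M] [IsManifold I ∞ M] {p x : M}

section Frame

variable (I) in
/-- The coordinate vector fields of the chart at `p`. -/
def chartFrame (p : M) (k : Fin (Module.finrank ℝ E)) : Π x : M, TangentSpace I x :=
  (trivializationAt E (fun x : M ↦ TangentSpace I x) p).localFrame (Module.finBasis ℝ E) k

variable (I) in
/-- The coefficients of tangent vectors with respect to the coordinate vector fields of the chart at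
`p`. -/
def chartCoeff (p : M) (k : Fin (Module.finrank ℝ E)) (x : M) : TangentSpace I x →ₗ[ℝ] ℝ :=
  (trivializationAt E (fun x : M ↦ TangentSpace I x) p).localFrameCoeff I (Module.finBasis ℝ E) k x

variable (hx : x ∈ (chartAt H p).source) (k l : Fin (Module.finrank ℝ E))

include hx

theorem chartFrame_eq : chartFrame I p k x
    = (trivializationAt E (fun x : M ↦ TangentSpace I x) p).symmL ℝ x (Module.finBasis ℝ E k) := by
  have hx' : x ∈ (trivializationAt E (fun x : M ↦ TangentSpace I x) p).baseSet := hx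
  rw [chartFrame, Trivialization.localFrame_apply_of_mem_baseSet _ _ hx',
    Trivialization.symmL_apply _ hx']
  simp [Trivialization.basisAt]

theorem sum_chartCoeff_smul (v : TangentSpace I x) :
    ∑ k, chartCoeff I p k x v • chartFrame I p k x = v := by
  have h := Trivialization.eq_sum_localFrameCoeff_smul (I := I) (b := Module.finBasis ℝ E)
    (e := trivializationAt E (fun x : M ↦ TangentSpace I x) p) (s := FiberBundle.extend E v) hx
  rw [FiberBundle.extend_apply_self] at h
  exact h.symm

theorem chartCoeff_chartFrame :
    chartCoeff I p k x (chartFrame I p l x) = if l = k then 1 else 0 := by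
  have hx' : x ∈ (trivializationAt E (fun x : M ↦ TangentSpace I x) p).baseSet := hx
  rw [chartCoeff, chartFrame, Trivialization.localFrameCoeff_apply_of_mem_baseSet _ _ hx',
    Trivialization.localFrame_apply_of_mem_baseSet _ _ hx', Module.Basis.repr_self,
    Finsupp.single_apply]

theorem linearIndependent_chartFrame : LinearIndependent ℝ fun k ↦ chartFrame I p k x := by
  rw [Fintype.linearIndependent_iff]
  intro c hc k
  have h := congrArg (chartCoeff I p k x) hc
  simpa [chartCoeff_chartFrame hx] using h

theorem contMDiffAt_chartFrame : CMDiffAt ∞ (T% (chartFrame I p k)) x :=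
  contMDiffAt_localFrame_of_mem _ _ _ _ hx

theorem mdifferentiableAt_chartFrame : MDiffAt (T% (chartFrame I p k)) x :=
  (contMDiffAt_chartFrame hx k).mdifferentiableAt (by simp)

theorem contMDiffAt_chartCoeff {V : Π x : M, TangentSpace I x} (hV : CMDiffAt ∞ (T% V) x) :
    CMDiffAt ∞ (fun y ↦ chartCoeff I p k y (V y)) x :=
  contMDiffAt_localFrameCoeff _ hx hV k

theorem mfderiv_extChartAt_chartFrame :
    mfderiv I 𝓘(ℝ, E) (extChartAt I p) x (chartFrame I p k x)
      = constField (Module.finBasis ℝ E k) (extChartAt I p x) := by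
  have h := congrArg (fun L ↦ L (chartFrame I p k x))
    (TangentBundle.continuousLinearMapAt_trivializationAt hx)
  refine h.symm.trans ?_
  rw [chartFrame_eq hx]
  exact Trivialization.continuousLinearMapAt_symmL _ hx _

theorem chartFrame_eventuallyEq_mpullback : chartFrame I p k =ᶠ[nhds x]
    mpullback I 𝓘(ℝ, E) (extChartAt I p) (constField (Module.finBasis ℝ E k)) := by
  filter_upwards [(chartAt H p).open_source.mem_nhds hx] with y hy
  rw [mpullback_apply, ← mfderiv_extChartAt_chartFrame hy k]
  obtain ⟨e, he⟩ := isInvertible_mfderiv_extChartAt (I := I) (x := p) (y := y)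
    (by rwa [extChartAt_source])
  rw [← he, ContinuousLinearMap.inverse_equiv]
  exact (e.symm_apply_apply _).symm

theorem mlieBracket_chartFrame : mlieBracket I (chartFrame I p k) (chartFrame I p l) x = 0 := by
  have := FiniteDimensional.complete ℝ E
  have : IsManifold I (minSmoothness ℝ 2) M := IsManifold.of_le (n := ∞) (by simp; norm_cast)
  rw [(chartFrame_eventuallyEq_mpullback hx k).mlieBracket_vectorField_eq
    (chartFrame_eventuallyEq_mpullback hx l), ← mpullback_mlieBracket (n := ∞)
    (mdifferentiableAt_constField _ _) (mdifferentiableAt_constField _ _)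
    (contMDiffAt_extChartAt' hx) (by simp; norm_cast), mpullback_apply, mlieBracket_constField,
    map_zero]

end Frame

variable [RiemannianBundle (fun x : M ↦ TangentSpace I x)]

section Gram

variable (I) in
/-- The matrix of the metric in the chart at `p`. -/
def chartGram (p x : M) : Matrix (Fin (Module.finrank ℝ E)) (Fin (Module.finrank ℝ E)) ℝ :=
  Matrix.gram ℝ fun k ↦ chartFrame I p k x

variable (I) in
/-- The density of the Riemannian volume in the chart at `p`. -/
def chartDensity (p x : M) : ℝ :=
  √(chartGram I p x).det

theorem chartGram_apply (p x : M) (k l : Fin (Module.finrank ℝ E)) :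
    chartGram I p x k l = inner ℝ (chartFrame I p k x) (chartFrame I p l x) := rfl

theorem det_chartGram_pos (hx : x ∈ (chartAt H p).source) : 0 < (chartGram I p x).det := by
  have h : (chartGram I p x).PosDef :=
    Matrix.posDef_gram_of_linearIndependent (linearIndependent_chartFrame hx)
  exact h.det_pos

theorem chartDensity_pos (hx : x ∈ (chartAt H p).source) : 0 < chartDensity I p x :=
  Real.sqrt_pos.2 (det_chartGram_pos hx)

theorem chartDensity_mul_self (hx : x ∈ (chartAt H p).source) :
    chartDensity I p x * chartDensity I p x = (chartGram I p x).det :=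
  Real.mul_self_sqrt (det_chartGram_pos hx).le

end Gram

variable [IsContMDiffRiemannianBundle I ∞ E (fun x : M ↦ TangentSpace I x)]

section Christoffel

variable (I) in
/-- The matrix of `∇ Xₖ` in the coordinate frame `X` of the chart at `p`. Its entries are the
Christoffel symbols. -/
def christoffel (p x : M) (k : Fin (Module.finrank ℝ E)) :
    Matrix (Fin (Module.finrank ℝ E)) (Fin (Module.finrank ℝ E)) ℝ :=
  Matrix.of fun j l ↦
    chartCoeff I p j x (leviCivita I M (chartFrame I p k) x (chartFrame I p l x))

variable (hx : x ∈ (chartAt H p).source) (k l : Fin (Module.finrank ℝ E))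

include hx

theorem leviCivita_chartFrame_comm :
    leviCivita I M (chartFrame I p k) x (chartFrame I p l x)
      = leviCivita I M (chartFrame I p l) x (chartFrame I p k x) := by
  have h := mlieBracket_chartFrame (I := I) hx l k
  rwa [mlieBracket_eq_leviCivita_sub (mdifferentiableAt_chartFrame hx l)
    (mdifferentiableAt_chartFrame hx k), sub_eq_zero] at h

theorem leviCivita_chartFrame :
    leviCivita I M (chartFrame I p l) x (chartFrame I p k x)
      = ∑ j, christoffel I p x k j l • chartFrame I p j x := by
  rw [← leviCivita_chartFrame_comm hx]
  exact (sum_chartCoeff_smul hx _).symm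

theorem mdifferentiableAt_chartGram : MDiffAt (fun y ↦ chartGram I p y k l) x :=
  mdifferentiableAt_inner (mdifferentiableAt_chartFrame hx k) (mdifferentiableAt_chartFrame hx l)

theorem mvfderiv_chartGram : (Matrix.of fun i j ↦
    mvfderiv I (fun y ↦ chartGram I p y i j) x (chartFrame I p k x))
      = (christoffel I p x k).transpose * chartGram I p x
        + chartGram I p x * christoffel I p x k := by
  ext i j
  have h := leviCivita_metric (mdifferentiableAt_chartFrame (I := I) hx k)
    (mdifferentiableAt_chartFrame (I := I) hx i) (mdifferentiableAt_chartFrame (I := I) hx j)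
  rw [leviCivita_chartFrame hx, leviCivita_chartFrame hx, sum_inner, inner_sum] at h
  simp only [real_inner_smul_left, real_inner_smul_right] at h
  refine h.trans ?_
  simp only [Matrix.add_apply, Matrix.mul_apply, Matrix.transpose_apply, chartGram_apply]
  simp only [mul_comm]

theorem mvfderiv_det_chartGram :
    mvfderiv I (fun y ↦ (chartGram I p y).det) x (chartFrame I p k x)
      = 2 * (christoffel I p x k).trace * (chartGram I p x).det := by
  rw [mvfderiv_det (mdifferentiableAt_chartGram hx), mvfderiv_chartGram hx, mul_add,
    Matrix.trace_add, ← mul_assoc, ← mul_assoc, Matrix.trace_mul_comm, ← mul_assoc,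
    Matrix.mul_adjugate, Matrix.adjugate_mul]
  simp only [Matrix.smul_mul, one_mul, Matrix.trace_smul, Matrix.trace_transpose, smul_eq_mul]
  ring

theorem contMDiffAt_chartDensity : CMDiffAt ∞ (chartDensity I p) x := by
  let n := Fin (Module.finrank ℝ E)
  have hentry (i j : n) : CMDiffAt ∞
      (fun y ↦ (inner ℝ (chartFrame I p i y) (chartFrame I p j y) : ℝ)) x :=
    ContMDiffAt.inner_bundle (contMDiffAt_chartFrame (I := I) hx i) (contMDiffAt_chartFrame hx j)
  have hgram : ContMDiffAt I 𝓘(ℝ, n → n → ℝ) ∞ (fun y i j ↦ chartGram I p y i j) x :=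
    contMDiffAt_pi_space.2 fun i ↦ contMDiffAt_pi_space.2 fun j ↦ hentry i j
  have hdet : ContDiff ℝ ∞ fun B : n → n → ℝ ↦ (Matrix.of B).det := by
    simp only [Matrix.det_apply, Matrix.of_apply]
    fun_prop
  exact (Real.contDiffAt_sqrt (det_chartGram_pos hx).ne').contMDiffAt.comp x
    (hdet.contDiffAt.contMDiffAt.comp x hgram)

theorem mvfderiv_chartDensity :
    mvfderiv I (chartDensity I p) x (chartFrame I p k x)
      = chartDensity I p x * (christoffel I p x k).trace := by
  have hμ := (contMDiffAt_chartDensity (I := I) hx).mdifferentiableAt (n := ∞) (by simp)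
  have hsq : (chartDensity I p * chartDensity I p) =ᶠ[nhds x] fun y ↦ (chartGram I p y).det := by
    filter_upwards [(chartAt H p).open_source.mem_nhds hx] with y hy
    exact chartDensity_mul_self (I := I) hy
  have h_det := mvfderiv_det_chartGram (I := I) hx k
  rw [← chartDensity_mul_self (I := I) hx, mvfderiv, ← hsq.mfderiv_eq] at h_det
  have h_mul := congrArg (fun L ↦ L (chartFrame I p k x)) (mvfderiv_mul hμ hμ)
  have h_two := h_mul.symm.trans h_det
  simp only [add_apply, smul_apply, smul_eq_mul] at h_two
  apply mul_left_cancel₀ (chartDensity_pos (I := I) hx).ne'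
  linarith

/-- The coordinate expression of the divergence. -/
theorem sum_mvfderiv_chartDensity_mul_chartCoeff {V : Π x : M, TangentSpace I x}
    (hV : CMDiffAt ∞ (T% V) x) :
    ∑ k, mvfderiv I (fun y ↦ chartDensity I p y * chartCoeff I p k y (V y)) x (chartFrame I p k x)
      = chartDensity I p x * ∑ k, chartCoeff I p k x (leviCivita I M V x (chartFrame I p k x)) := by
  have hμ := (contMDiffAt_chartDensity (I := I) hx).mdifferentiableAt (n := ∞) (by simp)
  have hX := mdifferentiableAt_chartFrame (I := I) hx
  have hf (k) : MDiffAt (fun y ↦ chartCoeff I p k y (V y)) x :=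
    (contMDiffAt_chartCoeff hx k hV).mdifferentiableAt (by simp)
  have hsum : leviCivita I M V x
      = leviCivita I M (fun y ↦ ∑ k, chartCoeff I p k y (V y) • chartFrame I p k y) x := by
    refine (leviCivita I M).isCovariantDerivativeOn.congr_of_eventuallyEq
      (hV.mdifferentiableAt (by simp))
      (MDifferentiableAt.sum_section fun k _ ↦ (hf k).smul_section (hX k)) Filter.univ_mem ?_
    filter_upwards [(chartAt H p).open_source.mem_nhds hx] with y hy
    exact (sum_chartCoeff_smul hy _).symm
  have hcoeff (k) : chartCoeff I p k x (leviCivita I M V x (chartFrame I p k x))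
      = mvfderiv I (fun y ↦ chartCoeff I p k y (V y)) x (chartFrame I p k x)
        + ∑ l, chartCoeff I p l x (V x) * christoffel I p x l k k := by
    rw [hsum, covariantDerivative_sum_smul _ _ (fun k _ ↦ hf k) (fun k _ ↦ hX k)]
    simp only [map_sum, map_add, map_smul, chartCoeff_chartFrame hx, smul_eq_mul, mul_ite, mul_one,
      mul_zero, Finset.sum_add_distrib, Finset.sum_ite_eq', Finset.mem_univ, if_true]
    exact add_comm _ _
  simp only [hcoeff, mvfderiv_fun_mul hμ (hf _), add_apply, smul_apply, smul_eq_mul,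
    mvfderiv_chartDensity hx, Finset.sum_add_distrib, mul_add, Finset.mul_sum]
  congr 1
  rw [Finset.sum_comm]
  refine Finset.sum_congr rfl fun l _ ↦ ?_
  rw [← Finset.mul_sum, ← Finset.mul_sum, Matrix.trace]
  simp only [Matrix.diag]
  ring

end Christoffel

end AlmostHermitian

namespace AlmostHermitian

open MeasureTheory Function

theorem sum_apply_eq_sum_apply {V : Type*} [AddCommGroup V] [Module ℝ V] {ι κ : Type*} [Fintype ι]
    [Fintype κ] {c : ι → V →ₗ[ℝ] ℝ} {a : ι → V} {d : κ → V →ₗ[ℝ] ℝ} {b : κ → V}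
    (hc : ∀ v, ∑ i, c i v • a i = v) (hd : ∀ v, ∑ k, d k v • b k = v) (L : V →ₗ[ℝ] V) :
    ∑ i, c i (L (a i)) = ∑ k, d k (L (b k)) := by
  calc ∑ i, c i (L (a i)) = ∑ i, c i (∑ k, d k (L (a i)) • b k) := by simp only [hd]
    _ = ∑ k, d k (L (∑ i, c i (b k) • a i)) := by
      simp only [map_sum, map_smul, smul_eq_mul]
      rw [Finset.sum_comm]
      simp only [mul_comm]
    _ = ∑ k, d k (L (b k)) := by simp only [hc]

theorem integral_fderiv_eq_zero {E : Type*} [NormedAddCommGroup E] [NormedSpace ℝ E]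
    [FiniteDimensional ℝ E] [MeasurableSpace E] [BorelSpace E] (ν : Measure E) [ν.IsAddHaarMeasure]
    {f : E → ℝ} (hf : ContDiff ℝ 1 f) (hc : HasCompactSupport f) (v : E) :
    ∫ y, fderiv ℝ f y v ∂ν = 0 := by
  have hf' : Integrable f ν := hf.continuous.integrable_of_hasCompactSupport hc
  have hdf : Integrable (fun y ↦ fderiv ℝ f y v) ν :=
    ((hf.continuous_fderiv (by simp)).clm_apply continuous_const).integrable_of_hasCompactSupport
      (hc.fderiv_apply ℝ v)
  have h := integral_mul_fderiv_eq_neg_fderiv_mul_of_integrable (μ := ν) (f := fun _ ↦ (1 : ℝ))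
    (g := f) (v := v) (by simp) (by simpa using hdf) (by simpa using hf') (by simp)
    fun y _ ↦ (hf.differentiable (by simp)) y
  simpa using h

section ReadInChart

variable {E : Type*} [NormedAddCommGroup E] [NormedSpace ℝ E]
  {H : Type*} [TopologicalSpace H] {I : ModelWithCorners ℝ E H}
  {M : Type*} [TopologicalSpace M] [ChartedSpace H M] {p : M} {K : Set M} {u v : M → ℝ}

variable (I) in
/-- The restriction of a function on `M` to the domain of the chart at `p`, read in this chart and
extended by zero. -/
def readInChart (p : M) : (M → ℝ) →+ E → ℝ where
  toFun u := (extChartAt I p).target.indicator (u ∘ (extChartAt I p).symm)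
  map_zero' := Set.indicator_zero ..
  map_add' _ _ := Set.indicator_add ..

theorem readInChart_of_mem {y : E} (hy : y ∈ (extChartAt I p).target) :
    readInChart I p u y = u ((extChartAt I p).symm y) :=
  Set.indicator_of_mem hy _

theorem readInChart_of_notMem {y : E} (hy : y ∉ (extChartAt I p).target) :
    readInChart I p u y = 0 :=
  Set.indicator_of_notMem hy _

theorem symm_mem_chart_source {y : E} (hy : y ∈ (extChartAt I p).target) :
    (extChartAt I p).symm y ∈ (chartAt H p).source := by
  rw [← extChartAt_source I]
  exact (extChartAt I p).map_target hy

theorem readInChart_extChartAt {x : M} (hx : x ∈ (chartAt H p).source) :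
    readInChart I p u (extChartAt I p x) = u x := by
  rw [← extChartAt_source I] at hx
  rw [readInChart_of_mem ((extChartAt I p).map_source hx), (extChartAt I p).left_inv hx]

theorem readInChart_congr (h : ∀ x ∈ (chartAt H p).source, u x = v x) :
    readInChart I p u = readInChart I p v :=
  Set.indicator_congr fun _ hy ↦ h _ (symm_mem_chart_source hy)

theorem readInChart_nonneg (hu : 0 ≤ u) : 0 ≤ readInChart I p u :=
  Set.indicator_nonneg fun _ _ ↦ hu _

theorem isCompact_image_extChartAt (hK : IsCompact K) (hKp : K ⊆ (chartAt H p).source) :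
    IsCompact (extChartAt I p '' K) :=
  hK.image_of_continuousOn ((continuousOn_extChartAt p).mono (by rwa [extChartAt_source]))

theorem readInChart_eq_zero (hu : support u ⊆ K) {y : E} (hy : y ∉ extChartAt I p '' K) :
    readInChart I p u y = 0 := by
  by_cases hy' : y ∈ (extChartAt I p).target
  · rw [readInChart_of_mem hy', ← notMem_support]
    exact fun h ↦ hy ⟨_, hu h, (extChartAt I p).right_inv hy'⟩
  · exact readInChart_of_notMem hy'

variable (hK : IsCompact K) (hKp : K ⊆ (chartAt H p).source) (hu : support u ⊆ K)

include hK hKp hu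

theorem hasCompactSupport_readInChart : HasCompactSupport (readInChart I p u) :=
  .intro (isCompact_image_extChartAt hK hKp) fun _ ↦ readInChart_eq_zero hu

theorem readInChart_eventuallyEq_zero {y : E} (hy : y ∉ (extChartAt I p).target) :
    readInChart I p u =ᶠ[nhds y] fun _ ↦ 0 := by
  have hy' : y ∉ extChartAt I p '' K := by
    rintro ⟨x, hx, rfl⟩
    exact hy ((extChartAt I p).map_source (by rw [extChartAt_source]; exact hKp hx))
  filter_upwards [(isCompact_image_extChartAt hK hKp).isClosed.isOpen_compl.mem_nhds hy']
  exact fun z ↦ readInChart_eq_zero hu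

variable [IsManifold I ∞ M] [I.Boundaryless]

omit hK hKp hu [IsManifold I ∞ M] in
theorem readInChart_eventuallyEq {y : E} (hy : y ∈ (extChartAt I p).target) :
    readInChart I p u =ᶠ[nhds y] u ∘ (extChartAt I p).symm := by
  filter_upwards [(isOpen_extChartAt_target (I := I) p).mem_nhds hy]
  exact fun z ↦ readInChart_of_mem

theorem contDiff_readInChart (hu' : ∀ x ∈ (chartAt H p).source, CMDiffAt ∞ u x) :
    ContDiff ℝ ∞ (readInChart I p u) := by
  refine contDiff_iff_contDiffAt.2 fun y ↦ ?_
  by_cases hy : y ∈ (extChartAt I p).target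
  · have hsymm := (contMDiffOn_extChartAt_symm (I := I) (n := ∞) p).contMDiffAt
      ((isOpen_extChartAt_target (I := I) p).mem_nhds hy)
    exact (contMDiffAt_iff_contDiffAt.1 ((hu' _ (symm_mem_chart_source hy)).comp y hsymm))
      |>.congr_of_eventuallyEq (readInChart_eventuallyEq hy)
  · exact contDiffAt_const.congr_of_eventuallyEq (readInChart_eventuallyEq_zero hK hKp hu hy)

omit hK hKp hu in
theorem hasFDerivAt_comp_extChartAt_symm {x : M} (hx : x ∈ (chartAt H p).source)
    (hf : MDiffAt u x) :
    HasFDerivAt (u ∘ (extChartAt I p).symm) (mvfderiv I u x ∘L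
      (trivializationAt E (fun x : M ↦ TangentSpace I x) p).symmL ℝ x) (extChartAt I p x) := by
  have hx' : x ∈ (extChartAt I p).source := by rwa [extChartAt_source]
  have hsymm := (mdifferentiableWithinAt_extChartAt_symm
    ((extChartAt I p).map_source hx')).hasMFDerivWithinAt
  rw [← TangentBundle.symmL_trivializationAt hx, I.range_eq_univ] at hsymm
  have hu (z : M) (hz : z = x) : HasMFDerivAt I 𝓘(ℝ, ℝ) u z (mvfderiv I u x : E →L[ℝ] ℝ) := by
    subst hz
    exact hf.hasMFDerivAt
  exact hasMFDerivAt_iff_hasFDerivAt.1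
    (HasMFDerivAt.comp _ (hu _ ((extChartAt I p).left_inv hx')) (hasMFDerivWithinAt_univ.1 hsymm))

theorem fderiv_readInChart [FiniteDimensional ℝ E]
    (hu' : ∀ x ∈ (chartAt H p).source, MDiffAt u x) (k : Fin (Module.finrank ℝ E)) :
    (fun y ↦ fderiv ℝ (readInChart I p u) y (Module.finBasis ℝ E k))
      = readInChart I p fun x ↦ mvfderiv I u x (chartFrame I p k x) := by
  ext y
  by_cases hy : y ∈ (extChartAt I p).target
  · have hx := symm_mem_chart_source hy
    have h := hasFDerivAt_comp_extChartAt_symm hx (hu' _ hx)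
    rw [(extChartAt I p).right_inv hy] at h
    rw [(h.congr_of_eventuallyEq (readInChart_eventuallyEq hy)).fderiv, readInChart_of_mem hy,
      chartFrame_eq hx]
    rfl
  · rw [(readInChart_eventuallyEq_zero hK hKp hu hy).fderiv_eq, readInChart_of_notMem hy]
    simp

end ReadInChart

variable {E : Type*} [NormedAddCommGroup E] [NormedSpace ℝ E] [FiniteDimensional ℝ E]
  {H : Type*} [TopologicalSpace H] {I : ModelWithCorners ℝ E H}
  {M : Type*} [TopologicalSpace M] [ChartedSpace H M] [IsManifold I ∞ M] {p q x : M}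

theorem chartFrame_eq_tangentCoordChange (hx : x ∈ (chartAt H p).source)
    (k : Fin (Module.finrank ℝ E)) :
    chartFrame I p k x = tangentCoordChange I p x x (Module.finBasis ℝ E k) := by
  rw [chartFrame_eq hx, TangentBundle.symmL_trivializationAt_eq_core hx]
  rfl

theorem chartFrame_eq_sum (hp : x ∈ (chartAt H p).source) (hq : x ∈ (chartAt H q).source)
    (k : Fin (Module.finrank ℝ E)) :
    chartFrame I q k x = ∑ l, LinearMap.toMatrix (Module.finBasis ℝ E) (Module.finBasis ℝ E)
      (tangentCoordChange I q p x : E →ₗ[ℝ] E) l k • chartFrame I p l x := by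
  have hsum : tangentCoordChange I q p x (Module.finBasis ℝ E k)
      = ∑ l, LinearMap.toMatrix (Module.finBasis ℝ E) (Module.finBasis ℝ E)
        (tangentCoordChange I q p x : E →ₗ[ℝ] E) l k • Module.finBasis ℝ E l := by
    simp only [LinearMap.toMatrix_apply]
    exact ((Module.finBasis ℝ E).sum_repr _).symm
  have hcomp := tangentCoordChange_comp (I := I) (w := q) (x := p) (y := x) (z := x)
    (v := Module.finBasis ℝ E k) (by simp [hp, hq])
  rw [hsum, map_sum] at hcomp
  simp only [map_smul] at hcomp
  rw [chartFrame_eq_tangentCoordChange hq, ← hcomp]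
  exact Finset.sum_congr rfl fun l _ ↦ by
    rw [chartFrame_eq_tangentCoordChange hp]
    rfl

variable [RiemannianBundle (fun x : M ↦ TangentSpace I x)]

theorem chartDensity_eq_abs_det_mul (hp : x ∈ (chartAt H p).source)
    (hq : x ∈ (chartAt H q).source) :
    chartDensity I q x = |(tangentCoordChange I q p x).det| * chartDensity I p x := by
  set D := LinearMap.toMatrix (Module.finBasis ℝ E) (Module.finBasis ℝ E)
      (tangentCoordChange I q p x : E →ₗ[ℝ] E) with hD
  have hgram : chartGram I q x = D.transpose * chartGram I p x * D := by
    ext k l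
    rw [chartGram_apply, chartFrame_eq_sum hp hq k, chartFrame_eq_sum hp hq l, ← hD]
    simp only [sum_inner, inner_sum, real_inner_smul_left, real_inner_smul_right,
      Matrix.mul_apply, Matrix.transpose_apply, chartGram_apply, Finset.sum_mul]
    exact Finset.sum_congr rfl fun _ _ ↦ Finset.sum_congr rfl fun _ _ ↦ by ring
  have hdet : D.det = (tangentCoordChange I q p x).det := LinearMap.det_toMatrix _ _
  rw [chartDensity, hgram, Matrix.det_mul, Matrix.det_mul, Matrix.det_transpose, hdet, chartDensity,
    ← Real.sqrt_sq_eq_abs, ← Real.sqrt_mul (sq_nonneg _)]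
  congr 1
  ring

section ChartIntegral

variable [MeasurableSpace E] (ν : Measure E) {f g : M → ℝ}

variable (I) in
/-- The Riemannian integral of a function supported in the domain of the chart at `p`. The Haar
measure `ν` on the model space fixes the normalisation. -/
def chartIntegral (p : M) (f : M → ℝ) : ℝ :=
  ∫ y, readInChart I p (f * chartDensity I p) y ∂ν

theorem chartIntegral_nonneg (hf : 0 ≤ f) : 0 ≤ chartIntegral I ν p f :=
  integral_nonneg (readInChart_nonneg (mul_nonneg hf fun _ ↦ Real.sqrt_nonneg _))

section ChangeOfCharts

variable [BorelSpace E] [I.Boundaryless]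

theorem chartIntegral_eq_setIntegral (hf : support f ⊆ (chartAt H q).source) :
    chartIntegral I ν p f = ∫ y in ((extChartAt I p).symm.trans (extChartAt I q)).source,
      f ((extChartAt I p).symm y) * chartDensity I p ((extChartAt I p).symm y) ∂ν := by
  have hopen : IsOpen ((extChartAt I p).symm.trans (extChartAt I q)).source :=
    (continuousOn_extChartAt_symm p).isOpen_inter_preimage (isOpen_extChartAt_target p)
      (isOpen_extChartAt_source q)
  rw [chartIntegral, ← setIntegral_eq_integral_of_forall_compl_eq_zero (s :=
    ((extChartAt I p).symm.trans (extChartAt I q)).source)]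
  · exact setIntegral_congr_fun hopen.measurableSet fun y hy ↦ readInChart_of_mem hy.1
  · intro y hy
    by_cases hy' : y ∈ (extChartAt I p).target
    · have hfy : f ((extChartAt I p).symm y) = 0 :=
        notMem_support.1 fun h ↦ hy ⟨hy', by rw [Set.mem_preimage, extChartAt_source]; exact hf h⟩
      rw [readInChart_of_mem hy', Pi.mul_apply, hfy, zero_mul]
    · exact readInChart_of_notMem hy'

theorem chartIntegral_eq [ν.IsAddHaarMeasure] (hp : support f ⊆ (chartAt H p).source)
    (hq : support f ⊆ (chartAt H q).source) :
    chartIntegral I ν p f = chartIntegral I ν q f := by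
  let τ := (extChartAt I q).symm.trans (extChartAt I p)
  have hτ : τ '' τ.source = ((extChartAt I p).symm.trans (extChartAt I q)).source :=
    τ.image_source_eq_target
  have hopen : IsOpen τ.source := (continuousOn_extChartAt_symm q).isOpen_inter_preimage
    (isOpen_extChartAt_target q) (isOpen_extChartAt_source p)
  have hder (y) (hy : y ∈ τ.source) : HasFDerivWithinAt τ
      (tangentCoordChange I q p ((extChartAt I q).symm y)) τ.source y := by
    have h := hasFDerivWithinAt_tangentCoordChange (I := I) (x := q) (y := p)
      (z := (extChartAt I q).symm y) ⟨(extChartAt I q).map_target hy.1, hy.2⟩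
    rw [(extChartAt I q).right_inv hy.1, I.range_eq_univ] at h
    exact h.mono (Set.subset_univ _)
  rw [chartIntegral_eq_setIntegral ν hq, chartIntegral_eq_setIntegral ν hp, ← hτ,
    integral_image_eq_integral_abs_det_fderiv_smul ν hopen.measurableSet hder τ.injOn]
  refine setIntegral_congr_fun hopen.measurableSet fun y hy ↦ ?_
  have hyp : (extChartAt I q).symm y ∈ (extChartAt I p).source := hy.2
  have hτy : (extChartAt I p).symm (τ y) = (extChartAt I q).symm y := (extChartAt I p).left_inv hyp
  rw [extChartAt_source] at hyp
  simp only [hτy, smul_eq_mul, chartDensity_eq_abs_det_mul hyp (symm_mem_chart_source hy.1)]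
  ring

end ChangeOfCharts

variable [IsContMDiffRiemannianBundle I ∞ E (fun x : M ↦ TangentSpace I x)] [BorelSpace E]
  [I.Boundaryless] [ν.IsAddHaarMeasure] {K : Set M}

section Continuous

variable (hK : IsCompact K) (hKp : K ⊆ (chartAt H p).source)
  (hf : ContMDiff I 𝓘(ℝ) ∞ f) (hfK : support f ⊆ K)

include hK hKp hf hfK

omit [BorelSpace E] [MeasurableSpace E] in
theorem continuous_readInChart_mul_chartDensity :
    Continuous (readInChart I p (f * chartDensity I p)) :=
  (contDiff_readInChart hK hKp ((support_mul_subset_left _ _).trans hfK) fun _ hx ↦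
    (hf _).mul (contMDiffAt_chartDensity hx)).continuous

theorem integrable_readInChart_mul_chartDensity :
    Integrable (readInChart I p (f * chartDensity I p)) ν :=
  (continuous_readInChart_mul_chartDensity hK hKp hf hfK).integrable_of_hasCompactSupport
    (hasCompactSupport_readInChart hK hKp ((support_mul_subset_left _ _).trans hfK))

theorem chartIntegral_add (hg : ContMDiff I 𝓘(ℝ) ∞ g) (hgK : support g ⊆ K) :
    chartIntegral I ν p (f + g) = chartIntegral I ν p f + chartIntegral I ν p g := by
  simp only [chartIntegral, add_mul, map_add]
  exact integral_add (integrable_readInChart_mul_chartDensity ν hK hKp hf hfK)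
    (integrable_readInChart_mul_chartDensity ν hK hKp hg hgK)

theorem eq_zero_of_chartIntegral_eq_zero (h0 : 0 ≤ f) (h : chartIntegral I ν p f = 0) : f = 0 := by
  ext x
  by_contra hx
  have hxp := hKp (hfK hx)
  have hpos : 0 < chartIntegral I ν p f :=
    (continuous_readInChart_mul_chartDensity hK hKp hf hfK)
      |>.integral_pos_of_hasCompactSupport_nonneg_nonzero (x := extChartAt I p x)
        (hasCompactSupport_readInChart hK hKp ((support_mul_subset_left _ _).trans hfK))
        (readInChart_nonneg (mul_nonneg h0 fun _ ↦ Real.sqrt_nonneg _))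
        (by rw [readInChart_extChartAt hxp]; exact mul_ne_zero hx (chartDensity_pos hxp).ne')
  exact hpos.ne' h

end Continuous

theorem chartIntegral_divergence {V : Π x : M, TangentSpace I x} (hV : IsSmoothField I V)
    (hK : IsCompact K) (hKp : K ⊆ (chartAt H p).source) (hVK : ∀ x ∉ K, V x = 0) :
    chartIntegral I ν p
      (fun x ↦ ∑ k, chartCoeff I p k x (leviCivita I M V x (chartFrame I p k x))) = 0 := by
  let u (k : Fin (Module.finrank ℝ E)) (y : M) : ℝ := chartDensity I p y * chartCoeff I p k y (V y)
  have hu (k) : ∀ x ∈ (chartAt H p).source, CMDiffAt ∞ (u k) x := fun x hx ↦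
    (contMDiffAt_chartDensity hx).mul (contMDiffAt_chartCoeff hx k (hV x))
  have huK (k) : support (u k) ⊆ K := fun x hx ↦ by
    by_contra h
    exact hx (by simp only [u, hVK x h, map_zero, mul_zero])
  have hC (k) := (contDiff_readInChart (I := I) hK hKp (huK k) (hu k)).of_le (m := 1)
    (by norm_cast)
  have hc (k) := hasCompactSupport_readInChart (I := I) hK hKp (huK k)
  have hdiv : readInChart I p ((fun x ↦ ∑ k, chartCoeff I p k x
        (leviCivita I M V x (chartFrame I p k x))) * chartDensity I p)
      = ∑ k, fun y ↦ fderiv ℝ (readInChart I p (u k)) y (Module.finBasis ℝ E k) := by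
    simp only [fderiv_readInChart hK hKp (huK _) fun x hx ↦ (hu _ x hx).mdifferentiableAt (by simp)]
    rw [← map_sum]
    refine readInChart_congr fun x hx ↦ ?_
    rw [Finset.sum_apply, sum_mvfderiv_chartDensity_mul_chartCoeff hx (hV _)]
    exact mul_comm _ _
  simp only [chartIntegral, hdiv, Finset.sum_apply]
  rw [integral_finsetSum _ fun k _ ↦ (((hC k).continuous_fderiv (by simp)).clm_apply
    continuous_const).integrable_of_hasCompactSupport ((hc k).fderiv_apply ℝ _)]
  exact Finset.sum_eq_zero fun k _ ↦ integral_fderiv_eq_zero ν (hC k) (hc k) _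

end ChartIntegral

end AlmostHermitian

namespace AlmostHermitian

open MeasureTheory Function

variable {E : Type*} [NormedAddCommGroup E] [NormedSpace ℝ E] [FiniteDimensional ℝ E]
  {H : Type*} [TopologicalSpace H] {I : ModelWithCorners ℝ E H}
  {M : Type*} [TopologicalSpace M] [ChartedSpace H M] [IsManifold I ∞ M] [CompactSpace M]
  [T2Space M] {p x : M}

variable (I M) in
theorem exists_smoothFunction_partition [I.Boundaryless] :
    ∃ (t : Finset M) (ρ : M → SmoothFunction I M),
      ∑ i ∈ t, ρ i = 1 ∧ (∀ i, 0 ≤ (ρ i : M → ℝ)) ∧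
        ∀ i, tsupport (ρ i) ⊆ (chartAt H i).source := by
  obtain ⟨ρ, hρ⟩ := SmoothPartitionOfUnity.exists_isSubordinate_chartAt_source I M
  refine ⟨ρ.locallyFinite.finite_nonempty_of_compact.toFinset, fun i ↦ ρ i, ?_, fun i ↦ ρ.nonneg i,
    hρ⟩
  ext x
  rw [SmoothFunction.sum_apply]
  change _ = (1 : ℝ)
  rw [← ρ.sum_eq_one (Set.mem_univ x), finsum_eq_sum_of_support_subset]
  intro i hi
  simp only [Set.Finite.coe_toFinset, Set.mem_ofPred_eq]
  exact ⟨x, hi⟩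

variable [RiemannianBundle (fun x : M ↦ TangentSpace I x)]
  [IsContMDiffRiemannianBundle I ∞ E (fun x : M ↦ TangentSpace I x)] [I.Boundaryless]

section Integral

variable [MeasurableSpace E] [BorelSpace E] (ν : Measure E) [ν.IsAddHaarMeasure]

/-- The Riemannian integral of the multiples of a function supported in the domain of the chart at
`p`. -/
def chartIntegralMul (g : SmoothFunction I M) (hg : tsupport g ⊆ (chartAt H p).source) :
    SmoothFunction I M →+ ℝ :=
  .mk' (fun f ↦ chartIntegral I ν p (g * f : SmoothFunction I M)) fun f f' ↦ by
    have hsupp (f : SmoothFunction I M) : support (g * f : SmoothFunction I M) ⊆ tsupport g :=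
      (support_mul_subset_left _ _).trans (subset_tsupport _)
    rw [mul_add]
    exact chartIntegral_add ν (isClosed_tsupport _).isCompact hg (g * f).contMDiff (hsupp f)
      (g * f').contMDiff (hsupp f')

theorem exists_riemannianIntegral : ∃ Λ : SmoothFunction I M →+ ℝ,
    ∀ p (f : SmoothFunction I M), tsupport f ⊆ (chartAt H p).source →
      Λ f = chartIntegral I ν p f := by
  obtain ⟨t, ρ, hsum, -, hρ⟩ := exists_smoothFunction_partition I M
  refine ⟨∑ i ∈ t, chartIntegralMul ν (ρ i) (hρ i), fun p f hf ↦ ?_⟩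
  have hlocal (i : M) : chartIntegralMul ν (ρ i) (hρ i) f = chartIntegralMul ν f hf (ρ i) := by
    change chartIntegral I ν i (ρ i * f : SmoothFunction I M)
      = chartIntegral I ν p (f * ρ i : SmoothFunction I M)
    rw [mul_comm f]
    exact chartIntegral_eq ν
      ((support_mul_subset_left _ _).trans ((subset_tsupport _).trans (hρ i)))
      ((support_mul_subset_right _ _).trans ((subset_tsupport _).trans hf))
  calc (∑ i ∈ t, chartIntegralMul ν (ρ i) (hρ i)) f
      = ∑ i ∈ t, chartIntegralMul ν f hf (ρ i) := by
        simp only [AddMonoidHom.finsetSum_apply, hlocal]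
    _ = chartIntegralMul ν f hf 1 := by rw [← map_sum, hsum]
    _ = chartIntegral I ν p f :=
        congrArg (fun g : SmoothFunction I M ↦ chartIntegral I ν p g) (mul_one f)

theorem eq_zero_of_riemannianIntegral_eq_zero {Λ : SmoothFunction I M →+ ℝ}
    (hΛ : ∀ p (f : SmoothFunction I M), tsupport f ⊆ (chartAt H p).source →
      Λ f = chartIntegral I ν p f)
    {f : SmoothFunction I M} (h0 : 0 ≤ (f : M → ℝ)) (hf : Λ f = 0) : f = 0 := by
  obtain ⟨t, ρ, hsum, hnonneg, hρ⟩ := exists_smoothFunction_partition I M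
  have hsupp (i : M) : tsupport (ρ i * f : SmoothFunction I M) ⊆ (chartAt H i).source :=
    (tsupport_mul_subset_left (f := ρ i) (g := f)).trans (hρ i)
  have hdecomp : ∑ i ∈ t, ρ i * f = f := by rw [← Finset.sum_mul, hsum, one_mul]
  have hnonneg' (i : M) : 0 ≤ ((ρ i * f : SmoothFunction I M) : M → ℝ) := mul_nonneg (hnonneg i) h0
  have hzero : ∑ i ∈ t, chartIntegral I ν i (ρ i * f : SmoothFunction I M) = 0 :=
    calc ∑ i ∈ t, chartIntegral I ν i (ρ i * f : SmoothFunction I M)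
        = ∑ i ∈ t, Λ (ρ i * f) := Finset.sum_congr rfl fun i _ ↦ (hΛ i _ (hsupp i)).symm
      _ = 0 := by rw [← map_sum, hdecomp, hf]
  rw [← hdecomp]
  refine Finset.sum_eq_zero fun i hi ↦ DFunLike.coe_injective ?_
  exact eq_zero_of_chartIntegral_eq_zero ν (isClosed_tsupport _).isCompact (hsupp i)
    (ρ i * f).contMDiff (subset_tsupport _) (hnonneg' i)
    ((Finset.sum_eq_zero_iff_of_nonneg fun i _ ↦ chartIntegral_nonneg ν (hnonneg' i)).1 hzero i hi)

end Integral

namespace DualFrame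

variable (F : DualFrame I M)

omit [CompactSpace M] [I.Boundaryless] in
theorem div_apply_eq_sum_chartCoeff [SigmaCompactSpace M] (V : SmoothField I M)
    (hx : x ∈ (chartAt H p).source) :
    F.calculus.div V x
      = ∑ k, chartCoeff I p k x (leviCivita I M V x (chartFrame I p k x)) := by
  have hdiv : F.calculus.div V x = ∑ i, inner ℝ (leviCivita I M V x (F.e i x)) (F.e' i x) := by
    rw [LeviCivitaCalculus.div_apply, LeviCivitaCalculus.trace_apply]
    exact SmoothFunction.sum_apply _ _ _
  have htrace := sum_apply_eq_sum_apply (c := fun i ↦ (innerₗ (TangentSpace I x) (F.e' i x)))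
    (a := fun i ↦ F.e i x) (fun v ↦ by
      simp only [innerₗ_apply_apply, real_inner_comm v]
      exact F.sum_frame x v)
    (sum_chartCoeff_smul hx) (leviCivita I M V x : TangentSpace I x →ₗ[ℝ] TangentSpace I x)
  exact hdiv.trans ((Finset.sum_congr rfl fun i _ ↦ real_inner_comm _ _).trans htrace)

omit [I.Boundaryless] in
theorem tsupport_div_smul_subset (f : SmoothFunction I M) (V : SmoothField I M) :
    tsupport (F.calculus.div (f • V)) ⊆ tsupport f := by
  refine closure_minimal (fun x hx ↦ ?_) (isClosed_tsupport _)
  by_contra h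
  have hf : (f : M → ℝ) =ᶠ[nhds x] fun _ ↦ 0 := notMem_tsupport_iff_eventuallyEq.1 h
  have hder : lieDeriv I V f x = 0 := by
    rw [lieDeriv, mvfderiv, ContinuousLinearMap.comp_apply, hf.mfderiv_eq, mfderiv_const]
    exact map_zero _
  refine hx ?_
  rw [F.calculus.div_smul]
  change f x * F.calculus.div V x + lieDeriv I V f x = 0
  rw [hder, image_eq_zero_of_notMem_tsupport h, zero_mul, add_zero]

theorem chartIntegral_div_smul [MeasurableSpace E] [BorelSpace E] (ν : Measure E)
    [ν.IsAddHaarMeasure] {f : SmoothFunction I M} (hf : tsupport f ⊆ (chartAt H p).source)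
    (V : SmoothField I M) : chartIntegral I ν p (F.calculus.div (f • V)) = 0 := by
  rw [← chartIntegral_divergence ν (f • V).isSmoothField (isClosed_tsupport _).isCompact hf
    fun x hx ↦ by rw [SmoothField.smul_apply, image_eq_zero_of_notMem_tsupport hx, zero_smul]]
  simp only [chartIntegral]
  congr 2
  refine readInChart_congr fun x hx ↦ ?_
  rw [Pi.mul_apply, F.div_apply_eq_sum_chartCoeff _ hx]
  rfl

theorem div_eq_zero_of_nonneg (V : SmoothField I M) (h : ∀ x, 0 ≤ F.calculus.div V x) :
    F.calculus.div V = 0 := by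
  borelize E
  let ν : Measure E := Measure.addHaar
  obtain ⟨Λ, hΛ⟩ := exists_riemannianIntegral (I := I) (M := M) ν
  obtain ⟨t, ρ, hsum, -, hρ⟩ := exists_smoothFunction_partition I M
  refine eq_zero_of_riemannianIntegral_eq_zero ν hΛ h ?_
  calc Λ (F.calculus.div V) = Λ (F.calculus.div (∑ i ∈ t, ρ i • V)) := by
        rw [← Finset.sum_smul, hsum, one_smul]
    _ = ∑ i ∈ t, chartIntegral I ν i (F.calculus.div (ρ i • V)) := by
        rw [map_sum, map_sum]
        exact Finset.sum_congr rfl fun i _ ↦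
          hΛ i _ ((F.tsupport_div_smul_subset _ V).trans (hρ i))
    _ = 0 := Finset.sum_eq_zero fun i _ ↦ F.chartIntegral_div_smul ν (hρ i) V

end DualFrame

end AlmostHermitian

/-! ### Compact almost Hermitian four-manifolds -/

namespace AlmostHermitian

variable {E : Type*} [NormedAddCommGroup E] [NormedSpace ℝ E]
  {H : Type*} [TopologicalSpace H] {I : ModelWithCorners ℝ E H}
  {M : Type*} [TopologicalSpace M] [ChartedSpace H M]

theorem SmoothFunction.ofNat_apply (n : ℕ) [n.AtLeastTwo] (x : M) :
    (ofNat(n) : SmoothFunction I M) x = ofNat(n) :=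
  map_ofNat (ContMDiffMap.evalRingHom x) n

variable [FiniteDimensional ℝ E] [IsManifold I ∞ M]
  [RiemannianBundle (fun x : M ↦ TangentSpace I x)]
  [IsContMDiffRiemannianBundle I ∞ E (fun x : M ↦ TangentSpace I x)]

/-- The bilinear form `⟨∇_v X, w⟩` on the tangent space at `x`. -/
def gradFormAt (X : Π x : M, TangentSpace I x) (x : M) :
    TangentSpace I x →ₗ[ℝ] TangentSpace I x →ₗ[ℝ] ℝ :=
  innerₗ (TangentSpace I x) ∘ₗ
    (leviCivita I M X x : TangentSpace I x →ₗ[ℝ] TangentSpace I x)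

omit [IsManifold I ∞ M] [IsContMDiffRiemannianBundle I ∞ E (fun x : M ↦ TangentSpace I x)] in
theorem twoFormInner_self_nonneg (x : M) (φ : TangentSpace I x → TangentSpace I x → ℝ) :
    0 ≤ twoFormInner x φ φ :=
  mul_nonneg (by norm_num) (Finset.sum_nonneg fun _ _ ↦ Finset.sum_nonneg fun _ _ ↦
    mul_self_nonneg _)

namespace DualFrame

variable [T2Space M] (F : DualFrame I M)

theorem div_apply_eq_sum_gradFormAt [SigmaCompactSpace M] (X : SmoothField I M) (x : M) :
    F.calculus.div X x = ∑ i, gradFormAt X x (stdOrthonormalBasis ℝ (TangentSpace I x) i)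
      (stdOrthonormalBasis ℝ (TangentSpace I x) i) := by
  rw [← sum_dual_eq_sum_orthonormalBasis (gradFormAt X x) _ (F.sum_frame x),
    LeviCivitaCalculus.div_apply, LeviCivitaCalculus.trace_apply]
  exact SmoothFunction.sum_apply _ _ _

theorem eq_zero_of_div_eq_inner_self [CompactSpace M] [I.Boundaryless]
    {B : SmoothField I M →ₗ[SmoothFunction I M] SmoothField I M →ₗ[SmoothFunction I M]
      SmoothFunction I M}
    (β : ∀ x : M, TangentSpace I x →ₗ[ℝ] TangentSpace I x →ₗ[ℝ] ℝ)
    (hB : ∀ X Y x, B X Y x = β x (X x) (Y x))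
    (h : ∃ X, F.calculus.div X = F.calculus.inner B B) (x : M) : β x = 0 := by
  obtain ⟨X, hX⟩ := h
  have h_div (x : M) : F.calculus.div X x = ∑ i, ∑ j,
      β x (stdOrthonormalBasis ℝ (TangentSpace I x) i) (stdOrthonormalBasis ℝ (TangentSpace I x) j)
      * β x (stdOrthonormalBasis ℝ (TangentSpace I x) i)
        (stdOrthonormalBasis ℝ (TangentSpace I x) j) := by
    rw [hX, ← sum_mul_dual_eq_sum_orthonormalBasis (β x) (β x) _ (F.sum_frame x)]
    simp only [LeviCivitaCalculus.inner, SmoothFunction.sum_apply, ContMDiffMap.coe_mul,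
      Pi.mul_apply, hB]
    rfl
  have h_zero := F.div_eq_zero_of_nonneg X fun x ↦ by
    rw [h_div]
    exact Finset.sum_nonneg fun i _ ↦ Finset.sum_nonneg fun j _ ↦ mul_self_nonneg _
  refine eq_zero_of_sum_mul_self_eq_zero _ _ ((h_div x).symm.trans ?_)
  rw [h_zero]
  rfl

end DualFrame

namespace AlmostHermitianStructure

variable (S : AlmostHermitianStructure I M)

omit [FiniteDimensional ℝ E] [IsContMDiffRiemannianBundle I ∞ E (fun x : M ↦ TangentSpace I x)] in
/-- The almost complex structure as an endomorphism of the module of smooth vector fields. -/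
def mapSmoothField : SmoothField I M →ₗ[SmoothFunction I M] SmoothField I M where
  toFun X := ⟨_, S.isSmoothField_mapField X.isSmoothField⟩
  map_add' X Y := by ext x; exact map_add (S.J x) _ _
  map_smul' f X := by ext x; exact map_smul (S.J x) _ _

theorem nablaOneForm_lee {X Y : Π x : M, TangentSpace I x} {x : M} (hX : MDiffAt (T% X) x)
    (hY : MDiffAt (T% Y) x) (hξ : MDiffAt (T% S.leeSharp) x) :
    nablaOneForm I S.lee X Y x = gradFormAt S.leeSharp x (X x) (Y x) := by
  simp only [nablaOneForm, lee_apply, leviCivita_metric hX hξ hY]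
  exact add_sub_cancel_right _ _

section DualFrame

variable [T2Space M] [SigmaCompactSpace M] (F : DualFrame I M)

theorem calculus_covDerivEnd_apply (X Y : SmoothField I M) (x : M) :
    F.calculus.covDerivEnd S.mapSmoothField X Y x = S.nablaJ x (X x) (Y x) :=
  (S.nablaJ_apply (Y.isSmoothField.mdifferentiableAt x) _).symm

include F in
theorem isSmoothField_leeSharp : IsSmoothField I S.leeSharp := by
  have h : S.leeSharp = S.mapSmoothField
      (-∑ i, F.calculus.covDerivEnd S.mapSmoothField (F.e i) (F.e' i)) := by
    ext x
    have h_trace := sum_dual_eq_sum_orthonormalBasis (S.nablaJ x).toLinearMap₁₂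
      (stdOrthonormalBasis ℝ (TangentSpace I x)) (F.sum_frame x)
    change _ = S.J x ((-∑ i, F.calculus.covDerivEnd S.mapSmoothField (F.e i) (F.e' i) :
      SmoothField I M) x)
    rw [SmoothField.neg_apply, map_neg, SmoothField.sum_apply, leeSharp_eq]
    simp only [calculus_covDerivEnd_apply]
    exact congrArg (fun v ↦ -S.J x v) h_trace.symm
  rw [h]
  exact SmoothField.isSmoothField _

/-- The vector field dual to the Lee form as an element of the module of smooth vector fields. -/
def leeField : SmoothField I M :=
  ⟨S.leeSharp, S.isSmoothField_leeSharp F⟩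

theorem isHermitianSurface (hE : Module.finrank ℝ E = 4) (hS : S.IsIntegrable) :
    F.calculus.IsHermitianSurface S.mapSmoothField (S.leeField F) where
  J_J X := by ext x; exact S.J_J x _
  g_J X Y := by ext x; exact inner_J_left (S.J_J x) (S.inner_J_J x) _ _
  trace_g := by
    ext x
    have h := sum_dual_eq_sum_orthonormalBasis (innerₗ (TangentSpace I x))
      (stdOrthonormalBasis ℝ (TangentSpace I x)) (F.sum_frame x)
    have h_dim : Module.finrank ℝ (TangentSpace I x) = 4 := hE
    rw [LeviCivitaCalculus.trace_apply]
    refine (SmoothFunction.sum_apply _ _ _).trans (h.trans ?_)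
    rw [SmoothFunction.ofNat_apply]
    simp [h_dim]
  two_g_covDerivEnd X Y Z := by
    ext x
    have h := (S.isHermitianDerivative x).two_inner_T hE
      (stdOrthonormalBasis ℝ (TangentSpace I x)) (S.leeSharp_eq x)
      (fun v w ↦ by rw [← nijenhuis_eq_nijenhuisOf, hS x]; rfl) (X x) (Y x) (Z x)
    rw [← calculus_covDerivEnd_apply S F, ← SmoothFunction.ofNat_apply (I := I) 2 x] at h
    exact h

end DualFrame

namespace NegFourPhiEq

variable {S} [T2Space M] (h : S.NegFourPhiEq)
  (hE : Module.finrank ℝ E = 4) (F : DualFrame I M)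
include h hE F

section SigmaCompact

variable [SigmaCompactSpace M]

theorem gradFormAt_leeSharp_J_sub (x : M) (v w : TangentSpace I x) :
    gradFormAt S.leeSharp x v (S.J x w) - gradFormAt S.leeSharp x w (S.J x v)
      = -(1 / 2) * twoFormInner x (S.nijenhuisForm x (S.J x v)) (S.nijenhuisForm x w)
        - (1 / 2) * S.nijenhuisForm x (S.J x (S.leeSharp x)) v w := by
  obtain ⟨X, rfl⟩ := SmoothField.exists_apply_eq x v
  obtain ⟨Y, rfl⟩ := SmoothField.exists_apply_eq x w
  have hX := X.isSmoothField.mdifferentiableAt x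
  have hY := Y.isSmoothField.mdifferentiableAt x
  have hξ := (S.isSmoothField_leeSharp F).mdifferentiableAt x
  rw [← (S.negFourPhiEq_iff hE).1 h X Y X.isSmoothField Y.isSmoothField x,
    S.nablaOneForm_lee hX (S.mdifferentiableAt_mapField hY) hξ,
    S.nablaOneForm_lee hY (S.mdifferentiableAt_mapField hX) hξ]
  rfl

theorem gradFormAt_leeSharp_J_self_add (x : M) (v : TangentSpace I x) :
    gradFormAt S.leeSharp x (S.J x v) (S.J x v) + gradFormAt S.leeSharp x v v
      = (1 / 2) * twoFormInner x (S.nijenhuisForm x v) (S.nijenhuisForm x v) := by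
  have h_eq := h.gradFormAt_leeSharp_J_sub hE F x (S.J x v) v
  have h_self : S.nijenhuis x (S.J x v) v = 0 := by
    rw [nijenhuis_eq_nijenhuisOf, (S.isHermitianDerivative x).nijenhuisOf_J_left, nijenhuisOf_self,
      map_zero, neg_zero]
  have h_neg : S.nijenhuisForm x (-v) = -S.nijenhuisForm x v := by
    ext a b
    exact inner_neg_right _ _
  rw [S.J_J, map_neg, h_neg, nijenhuisForm, h_self, inner_zero_left] at h_eq
  simp only [twoFormInner, Pi.neg_apply, neg_mul, Finset.sum_neg_distrib] at h_eq ⊢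
  linarith

theorem four_mul_div_leeField (x : M) :
    4 * F.calculus.div (S.leeField F) x = ∑ i, twoFormInner x
      (S.nijenhuisForm x (stdOrthonormalBasis ℝ (TangentSpace I x) i))
      (S.nijenhuisForm x (stdOrthonormalBasis ℝ (TangentSpace I x) i)) := by
  have h_sum := Finset.sum_congr rfl fun i (_ : i ∈ Finset.univ) ↦
    h.gradFormAt_leeSharp_J_self_add hE F x (stdOrthonormalBasis ℝ (TangentSpace I x) i)
  rw [Finset.sum_add_distrib, sum_J_orthonormalBasis_eq (S.J_J x) (S.inner_J_J x),
    ← Finset.mul_sum] at h_sum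
  have h_div := F.div_apply_eq_sum_gradFormAt (S.leeField F) x
  change _ = ∑ i, gradFormAt S.leeSharp x _ _ at h_div
  linarith

theorem isIntegrable_of_div_eq_zero (h_div : F.calculus.div (S.leeField F) = 0) :
    S.IsIntegrable := by
  intro x
  let u := stdOrthonormalBasis ℝ (TangentSpace I x)
  let B (w : TangentSpace I x) : TangentSpace I x →ₗ[ℝ] TangentSpace I x →ₗ[ℝ] ℝ :=
    (S.nijenhuis x).toLinearMap₁₂.compr₂ ((innerₗ (TangentSpace I x)).flip w)
  have h_norm := h.four_mul_div_leeField hE F x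
  rw [h_div, ContMDiffMap.coe_zero, Pi.zero_apply, mul_zero, eq_comm,
    Fintype.sum_eq_zero_iff_of_nonneg fun i ↦ twoFormInner_self_nonneg x _] at h_norm
  have h_form (i) : B (u i) = 0 := eq_zero_of_sum_mul_self_eq_zero _ u
    ((mul_eq_zero.1 (congrFun h_norm i)).resolve_left (by norm_num))
  ext v w
  exact InnerProductSpace.ext_inner_right_basis u.toBasis fun i ↦ by
    rw [OrthonormalBasis.coe_toBasis, zero_apply, zero_apply, inner_zero_left]
    exact congrArg (fun β ↦ β v w) (h_form i)

theorem gradForm_leeField_J_J (hS : S.IsIntegrable) (X Y : SmoothField I M) :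
    F.calculus.gradForm (S.leeField F) (S.mapSmoothField X) (S.mapSmoothField Y)
      = -F.calculus.gradForm (S.leeField F) Y X := by
  ext x
  have h_eq := h.gradFormAt_leeSharp_J_sub hE F x (S.J x (X x)) (Y x)
  rw [S.J_J, map_neg] at h_eq
  simp only [nijenhuisForm, hS x, twoFormInner, zero_apply, inner_zero_left, mul_zero,
    Finset.sum_const_zero, sub_zero, sub_neg_eq_add] at h_eq
  exact eq_neg_of_add_eq_zero_left h_eq

end SigmaCompact

variable [CompactSpace M] [I.Boundaryless]

theorem div_leeField_eq_zero : F.calculus.div (S.leeField F) = 0 :=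
  F.div_eq_zero_of_nonneg _ fun x ↦ by
    have h_nonneg := Finset.sum_nonneg fun i (_ : i ∈ Finset.univ) ↦ twoFormInner_self_nonneg x
      (S.nijenhuisForm x (stdOrthonormalBasis ℝ (TangentSpace I x) i))
    linarith [h.four_mul_div_leeField hE F x]

theorem gradForm_leeField_symm (hS : S.IsIntegrable) (X Y : SmoothField I M) :
    F.calculus.gradForm (S.leeField F) X Y = F.calculus.gradForm (S.leeField F) Y X := by
  have h_closed := F.eq_zero_of_div_eq_inner_self (B := F.calculus.extDeriv (S.leeField F))
    (fun x ↦ gradFormAt S.leeSharp x - (gradFormAt S.leeSharp x).flip) (fun _ _ _ ↦ rfl)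
    ((S.isHermitianSurface F hE hS).exists_div_eq_inner_extDeriv (h.gradForm_leeField_J_J hE F hS))
  ext x
  exact sub_eq_zero.1 (congrArg (fun β ↦ β (X x) (Y x)) (h_closed x))

theorem gradFormAt_leeSharp_eq_zero (hS : S.IsIntegrable) (x : M) :
    gradFormAt S.leeSharp x = 0 := by
  have h_surf := S.isHermitianSurface F hE hS
  have h_symm := h.gradForm_leeField_symm hE F hS
  have h_J (X : SmoothField I M) : F.calculus.grad (S.leeField F) (S.mapSmoothField X)
      = -S.mapSmoothField (F.calculus.grad (S.leeField F) X) := by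
    refine F.calculus.ext_g fun Y ↦ ?_
    have h_JJ := h.gradForm_leeField_J_J hE F hS X (S.mapSmoothField Y)
    rw [h_surf.J_J, map_neg, neg_inj, h_symm (S.mapSmoothField Y)] at h_JJ
    rw [map_neg, LinearMap.neg_apply, h_surf.g_J, neg_neg]
    exact h_JJ
  exact F.eq_zero_of_div_eq_inner_self _ (fun _ _ _ ↦ rfl)
    (h_surf.exists_div_eq_inner_gradForm h_symm h_J (h.div_leeField_eq_zero hE F)) x

omit F in
theorem isVaisman : S.IsVaisman := by
  obtain ⟨F⟩ := nonempty_dualFrame I M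
  have hS := h.isIntegrable_of_div_eq_zero hE F (h.div_leeField_eq_zero hE F)
  refine ⟨hS, fun X Y hX hY x ↦ ?_⟩
  rw [S.nablaOneForm_lee (hX.mdifferentiableAt x) (hY.mdifferentiableAt x)
    ((S.isSmoothField_leeSharp F).mdifferentiableAt x), h.gradFormAt_leeSharp_eq_zero hE F hS x]
  rfl

end NegFourPhiEq

end AlmostHermitianStructure

end AlmostHermitian

end

theorem proposition2p3_general {E : Type*} [NormedAddCommGroup E] [NormedSpace ℝ E]
    [FiniteDimensional ℝ E] (hE : Module.finrank ℝ E = 4) {H : Type*} [TopologicalSpace H]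
    {I : ModelWithCorners ℝ E H} {M : Type*} [TopologicalSpace M] [ChartedSpace H M]
    [IsManifold I ∞ M] [RiemannianBundle (fun x : M ↦ TangentSpace I x)]
    [IsContMDiffRiemannianBundle I ∞ E (fun x : M ↦ TangentSpace I x)]
    (S : AlmostHermitian.AlmostHermitianStructure I M) :
    (S.NegFourPhiEq ↔
      ∀ X Y : Π x : M, TangentSpace I x,
        AlmostHermitian.IsSmoothField I X → AlmostHermitian.IsSmoothField I Y → ∀ x : M,
          AlmostHermitian.nablaOneForm I S.lee X (S.mapField Y) x
              - AlmostHermitian.nablaOneForm I S.lee Y (S.mapField X) x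
            = -(1 / 2) * AlmostHermitian.twoFormInner x
                (S.nijenhuisForm x (S.J x (X x))) (S.nijenhuisForm x (Y x))
              - (1 / 2) * S.nijenhuisForm x (S.J x (S.leeSharp x)) (X x) (Y x)) ∧
    ∀ [CompactSpace M] [T2Space M] [I.Boundaryless], S.NegFourPhiEq ↔ S.IsVaisman :=
  ⟨S.negFourPhiEq_iff hE, ⟨fun h ↦ h.isVaisman hE, fun h ↦ h.negFourPhiEq hE⟩⟩

theorem proposition2p3 {M : Type*} [TopologicalSpace M] [T2Space M]
    [ChartedSpace (EuclideanSpace ℝ (Fin 4)) M] [IsManifold (𝓡 4) ∞ M]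
    [RiemannianBundle (fun x : M ↦ TangentSpace (𝓡 4) x)]
    [IsContMDiffRiemannianBundle (𝓡 4) ∞ (EuclideanSpace ℝ (Fin 4))
      (fun x : M ↦ TangentSpace (𝓡 4) x)]
    (S : AlmostHermitian.AlmostHermitianStructure (𝓡 4) M) :
    (S.NegFourPhiEq ↔
      ∀ X Y : Π x : M, TangentSpace (𝓡 4) x,
        AlmostHermitian.IsSmoothField (𝓡 4) X → AlmostHermitian.IsSmoothField (𝓡 4) Y → ∀ x : M,
          AlmostHermitian.nablaOneForm (𝓡 4) S.lee X (S.mapField Y) x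
              - AlmostHermitian.nablaOneForm (𝓡 4) S.lee Y (S.mapField X) x
            = -(1 / 2) * AlmostHermitian.twoFormInner x
                (S.nijenhuisForm x (S.J x (X x))) (S.nijenhuisForm x (Y x))
              - (1 / 2) * S.nijenhuisForm x (S.J x (S.leeSharp x)) (X x) (Y x)) ∧
    (CompactSpace M → (S.NegFourPhiEq ↔ S.IsVaisman)) :=
  have h := proposition2p3_general finrank_euclideanSpace_fin S
  ⟨h.1, fun _ ↦ h.2⟩
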